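/- Let $k$ be an algebraically closed field of characteristic zero, $V$ a 3-dimensional $k$-vector space, $P(\cdot)$ the projective space of lines, and $G=SL_2(k)$. Let $X=G_2(k^2\otimes V)$ be the Grassmannian of 2-dimensional subspaces of $k^2\otimes V$, in its Plücker embedding in $P(\wedge^2(k^2\otimes V))$; write $[A]\in X$ for the subspace spanned by the (linearly independent) rows of a $2\times2$-matrix $A=\begin{pmatrix}x&x'\\y&y'\end{pmatrix}$ with entries in $V$. Points of $P(S^2k^2\otimes\wedge^2V)$ are written $[\xi,\omega,\eta]$ with $\xi,\omega,\eta\in\wedge^2V$, not all zero. Put $\Phi(A)=(x\wedge y,\;x\wedge y'+x'\wedge y,\;x'\wedge y')$. The group $G$ acts from the right on $X$ by $[A]g=[Ag]$ and on $P(S^2k^2\otimes\wedge^2V)$ by $[\xi,\omega,\eta]g=[(\xi,\omega,\eta)S^2g]$, where for $g=\begin{pmatrix}\alpha&\beta\\\gamma&\delta\end{pmatrix}$ $$S^2g=\begin{pmatrix}\alpha^2&2\alpha\beta&\beta^2\\\alpha\gamma&\alpha\delta+\beta\gamma&\beta\delta\\\gamma^2&2\gamma\delta&\delta^2\end{pmatrix},$$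 so that $\Phi(Ag)=\Phi(A)S^2g$. Let $Z_G\subset X$ be the set of points $[A]$ such that $G$ fixes every vector of the line $[A]$ in $\wedge^2(k^2\otimes V)$, and let $\tilde X\subset P(\wedge^2(k^2\otimes V))\times P(S^2k^2\otimes\wedge^2V)$ be the Zariski closure of the graph $\{([A],[\Phi(A)])\;:\;[A]\in X\smallsetminus Z_G\}$. Then $\tilde X$ is contained in $X\times P(S^2k^2\otimes\wedge^2V)$ and, with its projection $\pi:\tilde X\to X$, is the blow-up $\mathrm{Proj}\bigoplus_n\mathcal I^n$ of $X$ along the (reduced) subvariety $Z_G$ with ideal sheaf $\mathcal I$. Moreover: (a) $\tilde X$ is the set of all points $([A],[\xi,\omega,\eta])$ of $X\times P(S^2k^2\otimes\wedge^2V)$ satisfying (i) $(x\wedge y,\;x\wedge y'+x'\wedge y,\;x'\wedge y')\in k(\xi,\omega,\eta)$, and (ii) $A\wedge\begin{pmatrix}\xi&\omega&\eta&0\\0&\xi&\omega&\eta\end{pmatrix}=0$ (matrix product with entries multiplied in the exterior algebra of $V$). (b) The exceptional divisor $E_G=\pi^{-1}(Z_G)$ is the set of all pairs $\left(\left[\begin{pmatrix}x&0\\0&x\end{pmatrix}\right],[x\wedge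 u,\,x\wedge w,\,x\wedge v]\right)$ with $x,u,v,w\in V$, $x\neq0$, and $x\wedge u,\,x\wedge w,\,x\wedge v$ not all zero. The map $[x]\mapsto\left[\begin{pmatrix}x&0\\0&x\end{pmatrix}\right]$ is an isomorphism of varieties from $P(V)$ onto $Z_G$, and the projection $E_G\to Z_G\cong P(V)$ is a Zariski locally trivial $\mathbb P_5$-bundle. (c) $\tilde X$ is a smooth variety, $\tilde X$ is invariant under the action of $G$ on $X\times P(S^2k^2\otimes\wedge^2V)$, and the projection $\pi:\tilde X\to X$ is $G$-equivariant. -/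

import Mathlib

open scoped LinearAlgebra.Projectivization

namespace KirwanBlowUp

noncomputable section

/-! ## Classical projective geometry over a field `k`

Varieties are sets of points in `ℙ E` or `ℙ E × ℙ F` with their Zariski topology and their
polynomial functions; all notions below are free of coordinates. -/

section Geometry

variable (k : Type*) [Field k]
variable {M : Type*} [AddCommGroup M] [Module k M]
variable {E : Type*} [AddCommGroup E] [Module k E]
variable {F : Type*} [AddCommGroup F] [Module k F]
variable {E' : Type*} [AddCommGroup E'] [Module k E']

/-- `p = [v]`: the vector `v` is nonzero and spans the line `p`. -/
def IsPt (p : ℙ k M) (v : M) : Prop :=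
  ∃ hv : v ≠ 0, Projectivization.mk k v hv = p

variable (M) in
/-- The polynomial functions on the vector space `M`. -/
def polyFun : Subalgebra k (M → k) :=
  Algebra.adjoin k (Set.range fun l : Module.Dual k M => (l : M → k))

/-- Homogeneous polynomial functions. -/
def IsHomog (f : M → k) : Prop :=
  f ∈ polyFun k M ∧ ∃ d : ℕ, ∀ (c : k) (a : M), f (c • a) = c ^ d * f a

/-- Bihomogeneous polynomial functions. -/
def IsBihomog (f : E × F → k) : Prop :=
  f ∈ polyFun k (E × F) ∧ ∃ m n : ℕ, ∀ (c d : k) (a : E) (b : F),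
    f (c • a, d • b) = c ^ m * d ^ n * f (a, b)

/-- The function `f` on `E` does not vanish at the point `p` (used for homogeneous `f`). -/
def NonvanishingAt (f : E → k) (p : ℙ k E) : Prop :=
  ∀ a, IsPt k p a → f a ≠ 0

/-- The function `f` on `E × F` vanishes at the point `w` (used for bihomogeneous `f`). -/
def VanishesAt (f : E × F → k) (w : ℙ k E × ℙ k F) : Prop :=
  ∀ a b, IsPt k w.1 a → IsPt k w.2 b → f (a, b) = 0

/-- The Zariski closure of a subset of `ℙ E × ℙ F`. -/
def zariskiClosure (S : Set (ℙ k E × ℙ k F)) : Set (ℙ k E × ℙ k F) :=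
  {w | ∀ f : E × F → k, IsBihomog k f → (∀ s ∈ S, VanishesAt k f s) → VanishesAt k f w}

/-- The map `f`, considered on the subset `S` of `ℙ E`, is a morphism to `ℙ E'`: near every point
of `S` it is given by homogeneous polynomials of the same degree. -/
def IsRegular (S : Set (ℙ k E)) (f : ℙ k E → ℙ k E') : Prop :=
  ∀ s ∈ S, ∃ G : E → E',
    (∀ l : Module.Dual k E', (fun a => l (G a)) ∈ polyFun k E) ∧
    (∃ d : ℕ, ∀ (c : k) (a : E), G (c • a) = c ^ d • G a) ∧
    (∀ a, IsPt k s a → G a ≠ 0) ∧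
    ∀ p ∈ S, ∀ a, IsPt k p a → G a ≠ 0 → IsPt k (f p) (G a)

/-- The map `f`, considered on the subset `S` of `ℙ E × ℙ F`, is a morphism to `ℙ E'`: near every
point of `S` it is given by bihomogeneous polynomials of the same bidegree. -/
def IsBiregular (S : Set (ℙ k E × ℙ k F)) (f : ℙ k E × ℙ k F → ℙ k E') : Prop :=
  ∀ s ∈ S, ∃ G : E × F → E',
    (∀ l : Module.Dual k E', (fun a => l (G a)) ∈ polyFun k (E × F)) ∧
    (∃ m n : ℕ, ∀ (c d : k) (a : E) (b : F), G (c • a, d • b) = (c ^ m * d ^ n) • G (a, b)) ∧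
    (∀ a b, IsPt k s.1 a → IsPt k s.2 b → G (a, b) ≠ 0) ∧
    ∀ w ∈ S, ∀ a b, IsPt k w.1 a → IsPt k w.2 b → G (a, b) ≠ 0 → IsPt k (f w) (G (a, b))

/-- The coordinate ring of a subset `S` of the vector space `M`: the functions on `S` which are
restrictions of polynomial functions on `M`. -/
def coordRing (S : Set M) : Subalgebra k (S → k) :=
  Algebra.adjoin k (Set.range fun (l : Module.Dual k M) (s : S) => l s.1)

/-- The restriction of a linear form to `S`. -/
def coord (S : Set M) (l : Module.Dual k M) : coordRing k S :=
  ⟨fun s => l s.1, Algebra.subset_adjoin ⟨l, rfl⟩⟩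

/-- The ideal of all elements of the coordinate ring of `S` that vanish on `S ∩ T`. -/
def idealOf (S T : Set M) : Ideal (coordRing k S) where
  carrier := {f | ∀ s : S, s.1 ∈ T → f.1 s = 0}
  add_mem' := by
    intro f g hf hg s hs
    have h1 := hf s hs
    have h2 := hg s hs
    simp [h1, h2]
  zero_mem' := by
    intro s _
    simp
  smul_mem' := by
    intro c f hf s hs
    have h1 := hf s hs
    simp [h1]

/-- The affine open piece `l ≠ 0` of `X ⊆ ℙ E`, as a subset of the affine hyperplane `l = 1`. -/
def chart (l : Module.Dual k E) (X : Set (ℙ k E)) : Set E :=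
  {a | l a = 1 ∧ ∃ p ∈ X, IsPt k p a}

/-- The affine open piece `l ≠ 0, m ≠ 0` of `W ⊆ ℙ E × ℙ F`. -/
def biChart (l : Module.Dual k E) (m : Module.Dual k F) (W : Set (ℙ k E × ℙ k F)) : Set (E × F) :=
  {ab | l ab.1 = 1 ∧ m ab.2 = 1 ∧ ∃ w ∈ W, IsPt k w.1 ab.1 ∧ IsPt k w.2 ab.2}

/-- A closed subset `W` of `ℙ E × ℙ F` is a smooth variety if the coordinate rings of its affine
open pieces are smooth `k`-algebras. -/
def IsSmoothVariety (W : Set (ℙ k E × ℙ k F)) : Prop :=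
  zariskiClosure k W = W ∧
  ∀ (l : Module.Dual k E) (m : Module.Dual k F), Algebra.Smooth k (coordRing k (biChart k l m W))

/-- Over the affine open piece `l ≠ 0` of `X`, the relative affine cone of a subset `W` of
`X × ℙ F`: the zero section together with all vectors representing points of `W`. -/
def relCone (l : Module.Dual k E) (X : Set (ℙ k E)) (W : Set (ℙ k E × ℙ k F)) : Set (E × F) :=
  {ab | l ab.1 = 1 ∧ ∃ p ∈ X, IsPt k p ab.1 ∧
    (ab.2 = 0 ∨ ∃ q, IsPt k q ab.2 ∧ (p, q) ∈ W)}

/-- The closed subset `W` of `X × ℙ F`, with its projection to `X`, is the blow-up `Proj ⨁ I ^ n`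
of `X` along the subvariety `Z` with (reduced) ideal sheaf `I`: over every affine open piece of `X`,
with coordinate ring `R`, the coordinate ring of the relative cone of `W` is isomorphic, as a graded
`R`-algebra, to the Rees algebra `⨁ I ^ n`. (The coordinate ring is generated by the linear
forms on `E`, which are of degree 0, and those on `F`, which are of degree 1.) -/
def IsBlowUp (X Z : Set (ℙ k E)) (W : Set (ℙ k E × ℙ k F)) : Prop :=
  (∀ w ∈ W, w.1 ∈ X) ∧ zariskiClosure k W = W ∧
  ∀ l : Module.Dual k E,
    ∃ e : coordRing k (relCone k l X W) ≃ₐ[k]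
        reesAlgebra (idealOf k (chart k l X) (chart k l Z)),
      (∀ m : Module.Dual k E,
        e (coord k _ (m ∘ₗ LinearMap.fst k E F)) = algebraMap _ _ (coord k (chart k l X) m)) ∧
      ∀ m : Module.Dual k F, ∃ f ∈ idealOf k (chart k l X) (chart k l Z),
        (e (coord k _ (m ∘ₗ LinearMap.snd k E F))).1 = Polynomial.monomial 1 f

/-- The first projection makes `T ⊆ ℙ E × ℙ F` a Zariski locally trivial bundle over `Z ⊆ ℙ E` with
fibre the projective space of dimension `n`. The maps `(p, c) ↦ (p, ψ (p, c))` and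
`w ↦ (w.1, χ w)` are mutually inverse isomorphisms over the open subset `h ≠ 0` of `Z`. -/
def IsProjectiveBundle (n : ℕ) (T : Set (ℙ k E × ℙ k F)) (Z : Set (ℙ k E)) : Prop :=
  (∀ w ∈ T, w.1 ∈ Z) ∧
  ∀ z ∈ Z, ∃ h : E → k, IsHomog k h ∧ NonvanishingAt k h z ∧
    ∃ (ψ : ℙ k E × ℙ k (Fin (n + 1) → k) → ℙ k F)
      (χ : ℙ k E × ℙ k F → ℙ k (Fin (n + 1) → k)),
      IsBiregular k {w | w.1 ∈ Z ∧ NonvanishingAt k h w.1} ψ ∧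
      IsBiregular k {w | w ∈ T ∧ NonvanishingAt k h w.1} χ ∧
      (∀ p ∈ Z, NonvanishingAt k h p → ∀ c, (p, ψ (p, c)) ∈ T ∧ χ (p, ψ (p, c)) = c) ∧
      ∀ w ∈ T, NonvanishingAt k h w.1 → ψ (w.1, χ w) = w.2

/-- The product of a row vector with entries in `M` and a matrix over `k`. -/
def rowMul {m n : Type*} [Fintype m] (A : Matrix m n k) : (m → M) →ₗ[k] (n → M) :=
  LinearMap.pi fun j => ∑ i, A i j • LinearMap.proj i

theorem rowMul_apply {m n : Type*} [Fintype m] (A : Matrix m n k) (v : m → M) (j : n) :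
    rowMul k A v j = ∑ i, A i j • v i := by
  simp [rowMul]

theorem rowMul_one {m : Type*} [Fintype m] [DecidableEq m] :
    rowMul k (1 : Matrix m m k) = (LinearMap.id : (m → M) →ₗ[k] (m → M)) := by
  refine LinearMap.ext fun v => ?_
  funext j
  simp [rowMul_apply, Matrix.one_apply, ite_smul]

theorem rowMul_mul {m n o : Type*} [Fintype m] [Fintype n] (A : Matrix m n k) (B : Matrix n o k) :
    rowMul (M := M) k (A * B) = rowMul k B ∘ₗ rowMul k A := by
  refine LinearMap.ext fun v => ?_
  funext j
  simp only [rowMul_apply, LinearMap.comp_apply, Matrix.mul_apply, Finset.sum_smul,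
    Finset.smul_sum, smul_smul]
  rw [Finset.sum_comm]
  simp only [mul_comm]

end Geometry

/-! ## The Grassmannian of planes in `k² ⊗ V` and its blow-up -/

section Grassmannian

variable (k : Type*) [Field k] (V : Type*) [AddCommGroup V] [Module k V]

/-- `k² ⊗ V`, the space of rows `(x, x')`. -/
abbrev Row := Fin 2 → V

/-- `⋀²(k² ⊗ V)`, the Plücker space. -/
abbrev PluckerSpace := ⋀[k]^2 (Row V)

/-- `S²k² ⊗ ⋀²V`, the space of triples `(ξ, ω, η)`. -/
abbrev Triple := Fin 3 → ⋀[k]^2 V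

variable {V}

/-- The bivector `x ∧ y`. -/
def wedge {M : Type*} [AddCommGroup M] [Module k M] (x y : M) : ⋀[k]^2 M :=
  exteriorPower.ιMulti k 2 ![x, y]

/-- The Plücker vector of a matrix with entries in `V`: the wedge product of its two rows. -/
def pluckerVec (A : Matrix (Fin 2) (Fin 2) V) : PluckerSpace k V :=
  wedge k (A 0) (A 1)

/-- For `A = (x x' ; y y')` the triple `(x ∧ y, x ∧ y' + x' ∧ y, x' ∧ y')`. -/
def Phi (A : Matrix (Fin 2) (Fin 2) V) : Triple k V :=
  ![wedge k (A 0 0) (A 1 0), wedge k (A 0 0) (A 1 1) + wedge k (A 0 1) (A 1 0),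
    wedge k (A 0 1) (A 1 1)]

variable (V)

/-- The Grassmannian `X = G₂(k² ⊗ V)` of 2-dimensional subspaces in its Plücker embedding. The
subspace `[A]` spanned by the linearly independent rows of `A` is the point `[pluckerVec A]`. -/
def grassmannian : Set (ℙ k (PluckerSpace k V)) :=
  {p | ∃ A : Matrix (Fin 2) (Fin 2) V, IsPt k p (pluckerVec k A)}

/-- The action `A ↦ A g` of `SL₂(k)`, on the Plücker space. -/
def actPluckerLin (g : Matrix.SpecialLinearGroup (Fin 2) k) :
    PluckerSpace k V →ₗ[k] PluckerSpace k V :=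
  exteriorPower.map 2 (rowMul k (g : Matrix (Fin 2) (Fin 2) k))

variable {V} in
/-- The symmetric square of a matrix `g = (α β ; γ δ)`, acting on triples from the right. -/
def symSq (g : Matrix (Fin 2) (Fin 2) k) : Matrix (Fin 3) (Fin 3) k :=
  !![g 0 0 ^ 2, 2 * g 0 0 * g 0 1, g 0 1 ^ 2;
     g 0 0 * g 1 0, g 0 0 * g 1 1 + g 0 1 * g 1 0, g 0 1 * g 1 1;
     g 1 0 ^ 2, 2 * g 1 0 * g 1 1, g 1 1 ^ 2]

/-- The action `(ξ, ω, η) ↦ (ξ, ω, η) S²g` of `SL₂(k)` on triples. -/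
def actTripleLin (g : Matrix.SpecialLinearGroup (Fin 2) k) : Triple k V →ₗ[k] Triple k V :=
  rowMul k (symSq k (g : Matrix (Fin 2) (Fin 2) k))

theorem actPluckerLin_one : actPluckerLin k V 1 = LinearMap.id := by
  simp [actPluckerLin, rowMul_one]

theorem actPluckerLin_mul (g h : Matrix.SpecialLinearGroup (Fin 2) k) :
    actPluckerLin k V (g * h) = actPluckerLin k V h ∘ₗ actPluckerLin k V g := by
  rw [actPluckerLin, Matrix.SpecialLinearGroup.coe_mul, rowMul_mul, exteriorPower.map_comp]
  rfl

theorem actPluckerLin_pluckerVec (g : Matrix.SpecialLinearGroup (Fin 2) k)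
    (A : Matrix (Fin 2) (Fin 2) V) :
    actPluckerLin k V g (pluckerVec k A) =
      pluckerVec k fun i => rowMul k (g : Matrix (Fin 2) (Fin 2) k) (A i) := by
  simp only [actPluckerLin, pluckerVec, wedge, exteriorPower.map_apply_ιMulti]
  congr 1
  funext i
  fin_cases i <;> rfl

theorem symSq_one : symSq k 1 = 1 := by
  ext i j
  fin_cases i <;> fin_cases j <;> simp [symSq]

theorem symSq_mul (g h : Matrix (Fin 2) (Fin 2) k) : symSq k (g * h) = symSq k g * symSq k h := by
  ext i j
  fin_cases i <;> fin_cases j <;>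
    simp [symSq, Matrix.mul_apply, Fin.sum_univ_three] <;> ring

theorem actTripleLin_one : actTripleLin k V 1 = LinearMap.id := by
  simp [actTripleLin, symSq_one, rowMul_one]

theorem actTripleLin_mul (g h : Matrix.SpecialLinearGroup (Fin 2) k) :
    actTripleLin k V (g * h) = actTripleLin k V h ∘ₗ actTripleLin k V g := by
  rw [actTripleLin, Matrix.SpecialLinearGroup.coe_mul, symSq_mul, rowMul_mul]
  rfl

theorem wedge_coe {M : Type*} [AddCommGroup M] [Module k M] (x y : M) :
    (wedge k x y : ExteriorAlgebra k M) = ExteriorAlgebra.ι k x * ExteriorAlgebra.ι k y := by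
  simp [wedge, ExteriorAlgebra.ιMulti_apply]

theorem actTripleLin_Phi (g : Matrix.SpecialLinearGroup (Fin 2) k)
    (A : Matrix (Fin 2) (Fin 2) V) :
    actTripleLin k V g (Phi k A) =
      Phi k fun i => rowMul k (g : Matrix (Fin 2) (Fin 2) k) (A i) := by
  funext j
  apply Subtype.ext
  fin_cases j <;>
    simp [actTripleLin, rowMul_apply, Phi, wedge_coe, symSq, Fin.sum_univ_three, mul_add, add_mul,
      smul_smul] <;> module

theorem actPluckerLin_injective (g : Matrix.SpecialLinearGroup (Fin 2) k) :
    Function.Injective (actPluckerLin k V g) := by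
  have h : actPluckerLin k V g⁻¹ ∘ₗ actPluckerLin k V g = LinearMap.id := by
    rw [← actPluckerLin_mul, mul_inv_cancel, actPluckerLin_one]
  exact Function.LeftInverse.injective (g := actPluckerLin k V g⁻¹) fun v => LinearMap.congr_fun h v

theorem actTripleLin_injective (g : Matrix.SpecialLinearGroup (Fin 2) k) :
    Function.Injective (actTripleLin k V g) := by
  have h : actTripleLin k V g⁻¹ ∘ₗ actTripleLin k V g = LinearMap.id := by
    rw [← actTripleLin_mul, mul_inv_cancel, actTripleLin_one]
  exact Function.LeftInverse.injective (g := actTripleLin k V g⁻¹) fun v => LinearMap.congr_fun h v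

/-- The right action `[A] ↦ [A g]`. -/
def actPlucker (g : Matrix.SpecialLinearGroup (Fin 2) k) :
    ℙ k (PluckerSpace k V) → ℙ k (PluckerSpace k V) :=
  Projectivization.map (actPluckerLin k V g) (actPluckerLin_injective k V g)

/-- The right action `([A], [ξ, ω, η]) ↦ ([A g], [(ξ, ω, η) S²g])`. -/
def act (g : Matrix.SpecialLinearGroup (Fin 2) k)
    (w : ℙ k (PluckerSpace k V) × ℙ k (Triple k V)) :
    ℙ k (PluckerSpace k V) × ℙ k (Triple k V) :=
  (actPlucker k V g w.1,
    Projectivization.map (actTripleLin k V g) (actTripleLin_injective k V g) w.2)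

/-- The set `Z_G` of the points of the Grassmannian whose line in the Plücker space is fixed
pointwise by `SL₂(k)`. -/
def fixedLocus : Set (ℙ k (PluckerSpace k V)) :=
  {p | p ∈ grassmannian k V ∧ ∀ (g : Matrix.SpecialLinearGroup (Fin 2) k) (v : PluckerSpace k V),
    IsPt k p v → actPluckerLin k V g v = v}

/-- The closure `X̃` of the graph of `X ∖ Z_G → ℙ (S²k² ⊗ ⋀²V)`, `[A] ↦ [Phi A]`. -/
def blowUp : Set (ℙ k (PluckerSpace k V) × ℙ k (Triple k V)) :=
  zariskiClosure k {w | w.1 ∉ fixedLocus k V ∧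
    ∃ A : Matrix (Fin 2) (Fin 2) V, IsPt k w.1 (pluckerVec k A) ∧ IsPt k w.2 (Phi k A)}

/-- The exceptional divisor: the part of `X̃` over `Z_G`. -/
def exceptionalDivisor : Set (ℙ k (PluckerSpace k V) × ℙ k (Triple k V)) :=
  {w | w ∈ blowUp k V ∧ w.1 ∈ fixedLocus k V}

variable {V}

/-- The condition `A ∧ (ξ ω η 0 ; 0 ξ ω η) = 0`, a matrix product over the exterior algebra. -/
def WedgeCondition (A : Matrix (Fin 2) (Fin 2) V) (t : Triple k V) : Prop :=
  A.map (ExteriorAlgebra.ι k) *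
    (!![(t 0).1, (t 1).1, (t 2).1, 0;
        0, (t 0).1, (t 1).1, (t 2).1] : Matrix (Fin 2) (Fin 4) (ExteriorAlgebra k V)) = 0

end Grassmannian

end

end KirwanBlowUp

/-!
The decomposition `⋀²(k² ⊗ V) = S²k² ⊗ ⋀²V ⊕ ⋀²k² ⊗ S²V` makes `Phi` the restriction of a *linear*
map `phiLin` to the Plücker vectors, and the `SL₂`-invariants are the second summand. So `Z_G` is
the part of `X` where `phiLin` vanishes, and it consists of the points `[diag(x, x)]`: if
`phiLin a = 0` then the Plücker relations give `diagForm f a • a = diagVec x` with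
`x = firstRow f a 0` for every linear form `f` on `V`, and some `diagForm f a` is nonzero.

*Points of the closure.* The graph satisfies bihomogeneous equations which therefore hold on its
closure: the Plücker relations, the proportionality of `phiLin a` and `b`, and the relations
`diagForm_smul_zero_of_mem_blowUp`, `diagForm_smul_one_of_mem_blowUp`,
`diagForm_smul_two_of_mem_blowUp`, which express `b` through contractions of its components. Over
`Z_G` the latter force `b = (x ∧ u, x ∧ w, x ∧ v)`. Conversely all such pairs are limits of points
of the graph along the curves `famMatrix`, on which `Phi` is divisible by the parameter. This is
`mem_blowUp_iff`, from which the equations with the wedge condition, the exceptional divisor, the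
invariance under `SL₂` and the bundle structure are read off.

*Smoothness.* It suffices to find near every point one affine open piece with formally smooth
coordinate ring, since any two affine open pieces have isomorphic localizations
(`isSmoothVariety_of_forall_exists_chart`). The pieces chosen are retracts of vector spaces under
polynomial maps (`formallySmooth_graphChart`, `formallySmooth_exceptionalChart`), so their
coordinate rings are retracts of polynomial rings; near the exceptional divisor the parametrization
is the family `famMatrix` again, with the parameter as equation of the divisor.

*Blow-up.* The components of `phiLin` generate the full vanishing ideal of `Z_G` on every affine
open piece (`idealOf_fixedLocus`): `diagForm f a • a` is congruent to the Plücker vector of a matrix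
`diag(x, x)` modulo these components, so a power of `diagForm f` multiplies every function vanishing
on `Z_G` into the ideal that they generate, and the Nullstellensatz patches these local statements.
The relative cone of the closure of the graph is the closure of the image of
`(a, s) ↦ (a, s • phiLin a)` (`eq_zero_on_relCone`). Functions on it therefore are polynomials in
`s` over the coordinate ring of the affine open piece, generated in degree one by the components of
`phiLin` times `s`: this is the Rees algebra (`exists_algEquiv_reesAlgebra`).
-/

namespace KirwanBlowUp

noncomputable section

/-! ### Polynomial functions and polynomial maps -/

section PolynomialMaps

variable {k : Type*} [Field k]
variable {M : Type*} [AddCommGroup M] [Module k M]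
variable {N : Type*} [AddCommGroup N] [Module k N]
variable {M₁ : Type*} [AddCommGroup M₁] [Module k M₁]
variable {M₂ : Type*} [AddCommGroup M₂] [Module k M₂]

theorem dual_mem_polyFun (l : Module.Dual k M) : (fun a => l a) ∈ polyFun k M :=
  Algebra.subset_adjoin ⟨l, rfl⟩

theorem const_mem_polyFun (c : k) : (fun _ : M => c) ∈ polyFun k M :=
  (polyFun k M).algebraMap_mem c

theorem add_mem_polyFun {f g : M → k} (hf : f ∈ polyFun k M) (hg : g ∈ polyFun k M) :
    (fun a => f a + g a) ∈ polyFun k M := add_mem hf hg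

theorem sub_mem_polyFun {f g : M → k} (hf : f ∈ polyFun k M) (hg : g ∈ polyFun k M) :
    (fun a => f a - g a) ∈ polyFun k M := sub_mem hf hg

theorem mul_mem_polyFun {f g : M → k} (hf : f ∈ polyFun k M) (hg : g ∈ polyFun k M) :
    (fun a => f a * g a) ∈ polyFun k M := mul_mem hf hg

theorem pow_mem_polyFun {f : M → k} (hf : f ∈ polyFun k M) (n : ℕ) :
    (fun a => f a ^ n) ∈ polyFun k M := pow_mem hf n

/-- Induction principle for polynomial functions. -/
theorem polyFun_induction {P : (M → k) → Prop} (lin : ∀ l : Module.Dual k M, P fun a => l a)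
    (const : ∀ c : k, P fun _ => c)
    (add : ∀ f g, f ∈ polyFun k M → g ∈ polyFun k M → P f → P g → P fun a => f a + g a)
    (mul : ∀ f g, f ∈ polyFun k M → g ∈ polyFun k M → P f → P g → P fun a => f a * g a)
    {f : M → k} (hf : f ∈ polyFun k M) : P f := by
  refine Algebra.adjoin_induction (p := fun f _ => P f) ?_ const (fun f g hf hg => add f g hf hg)
    (fun f g hf hg => mul f g hf hg) hf
  rintro _ ⟨l, rfl⟩
  exact lin l

/-- A map between vector spaces whose components are polynomial functions. -/
def IsPolyMap (k : Type*) [Field k] {M N : Type*} [AddCommGroup M] [Module k M]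
    [AddCommGroup N] [Module k N] (G : M → N) : Prop :=
  ∀ l : Module.Dual k N, (fun a => l (G a)) ∈ polyFun k M

theorem IsPolyMap.linear (φ : M →ₗ[k] N) : IsPolyMap k fun a => φ a :=
  fun l => dual_mem_polyFun (l ∘ₗ φ)

theorem IsPolyMap.linear_fst (φ : M →ₗ[k] N) : IsPolyMap k fun ab : M × M₁ => φ ab.1 :=
  IsPolyMap.linear (φ ∘ₗ LinearMap.fst k M M₁)

theorem IsPolyMap.linear_snd (φ : M₁ →ₗ[k] N) : IsPolyMap k fun ab : M × M₁ => φ ab.2 :=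
  IsPolyMap.linear (φ ∘ₗ LinearMap.snd k M M₁)

theorem dual_fst_mem_polyFun (l : Module.Dual k M) :
    (fun ab : M × M₁ => l ab.1) ∈ polyFun k (M × M₁) :=
  dual_mem_polyFun (l ∘ₗ LinearMap.fst k M M₁)

theorem dual_snd_mem_polyFun (l : Module.Dual k M₁) :
    (fun ab : M × M₁ => l ab.2) ∈ polyFun k (M × M₁) :=
  dual_mem_polyFun (l ∘ₗ LinearMap.snd k M M₁)

theorem IsPolyMap.const (b : N) : IsPolyMap k fun _ : M => b :=
  fun l => const_mem_polyFun (l b)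

theorem IsPolyMap.add {G H : M → N} (hG : IsPolyMap k G) (hH : IsPolyMap k H) :
    IsPolyMap k fun a => G a + H a := fun l => by
  simpa only [map_add] using add_mem_polyFun (hG l) (hH l)

theorem IsPolyMap.sub {G H : M → N} (hG : IsPolyMap k G) (hH : IsPolyMap k H) :
    IsPolyMap k fun a => G a - H a := fun l => by
  simpa only [map_sub] using sub_mem_polyFun (hG l) (hH l)

theorem IsPolyMap.neg {G : M → N} (hG : IsPolyMap k G) : IsPolyMap k fun a => -G a := by
  simpa only [zero_sub] using (IsPolyMap.const (0 : N)).sub hG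

theorem IsPolyMap.smul {f : M → k} {G : M → N} (hf : f ∈ polyFun k M) (hG : IsPolyMap k G) :
    IsPolyMap k fun a => f a • G a := fun l => by
  simpa only [map_smul, smul_eq_mul] using mul_mem_polyFun hf (hG l)

theorem comp_mem_polyFun {f : N → k} {G : M → N} (hf : f ∈ polyFun k N) (hG : IsPolyMap k G) :
    (fun a => f (G a)) ∈ polyFun k M := by
  refine polyFun_induction (P := fun f : N → k => (fun a => f (G a)) ∈ polyFun k M) hG
    (fun c => const_mem_polyFun c) (fun f g _ _ => add_mem_polyFun)
    (fun f g _ _ => mul_mem_polyFun) hf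

theorem IsPolyMap.comp {H : N → M₁} {G : M → N} (hH : IsPolyMap k H) (hG : IsPolyMap k G) :
    IsPolyMap k fun a => H (G a) := fun l =>
  comp_mem_polyFun (f := fun b => l (H b)) (hH l) hG

theorem IsPolyMap.pi {ι : Type*} [Finite ι] {G : M → ι → N} (hG : ∀ i, IsPolyMap k fun a => G a i) :
    IsPolyMap k G := by
  classical
  have := Fintype.ofFinite ι
  intro l
  have : (fun a => l (G a)) = ∑ i, fun a => (l ∘ₗ LinearMap.single k (fun _ => N) i) (G a i) := by
    funext a
    rw [Finset.sum_apply]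
    simp only [LinearMap.comp_apply]
    rw [← map_sum]
    congr 1
    exact (LinearMap.sum_single_apply (φ := fun _ : ι => N) (G a)).symm
  rw [this]
  exact sum_mem fun i _ => hG i _

theorem IsPolyMap.prodMk {G : M → N} {H : M → M₁} (hG : IsPolyMap k G) (hH : IsPolyMap k H) :
    IsPolyMap k fun a => (G a, H a) := by
  intro l
  have : (fun a => l (G a, H a)) =
      fun a => (l ∘ₗ LinearMap.inl k N M₁) (G a) + (l ∘ₗ LinearMap.inr k N M₁) (H a) := by
    funext a
    simp [← map_add]
  rw [this]
  exact add_mem_polyFun (hG _) (hH _)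

theorem IsPolyMap.bilin [FiniteDimensional k M₁] {G : M → M₁} {H : M → M₂} (B : M₁ →ₗ[k] M₂ →ₗ[k] N)
    (hG : IsPolyMap k G) (hH : IsPolyMap k H) : IsPolyMap k fun a => B (G a) (H a) := by
  have e : (fun a => B (G a) (H a)) =
      fun a => ∑ i, (Module.finBasis k M₁).coord i (G a) • B (Module.finBasis k M₁ i) (H a) := by
    funext a
    conv_lhs => rw [← (Module.finBasis k M₁).sum_repr (G a)]
    simp only [map_sum, LinearMap.sum_apply, map_smul, LinearMap.smul_apply,
      Module.Basis.coord_apply]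
  rw [e]
  intro l
  simp only [map_sum]
  have e2 : (fun a => ∑ i, l ((Module.finBasis k M₁).coord i (G a) •
      B (Module.finBasis k M₁ i) (H a))) = ∑ i, fun a => l ((Module.finBasis k M₁).coord i (G a) •
      B (Module.finBasis k M₁ i) (H a)) := by
    funext a; simp
  rw [e2]
  exact sum_mem fun i _ => (IsPolyMap.smul (hG _) ((IsPolyMap.linear _).comp hH)) l

/-- Over an infinite field polynomial functions are the same as polynomials. -/
theorem exists_mvPolynomial_equiv_polyFun [Infinite k] [FiniteDimensional k M] :
    Nonempty (MvPolynomial (Fin (Module.finrank k M)) k ≃ₐ[k] polyFun k M) := by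
  let b := Module.finBasis k M
  let X : Fin (Module.finrank k M) → polyFun k M := fun i => ⟨_, dual_mem_polyFun (b.coord i)⟩
  have key : ∀ (P : MvPolynomial (Fin (Module.finrank k M)) k) (a : M),
      (MvPolynomial.aeval X P).1 a = MvPolynomial.eval (fun i => b.coord i a) P := by
    intro P a
    induction P using MvPolynomial.induction_on with
    | C c => simp
    | add p q hp hq => simp [hp, hq]
    | mul_X p i hp =>
      rw [map_mul, map_mul, MvPolynomial.aeval_X, MvPolynomial.eval_X, ← hp]
      rfl
  refine ⟨AlgEquiv.ofBijective (MvPolynomial.aeval X) ⟨?_, ?_⟩⟩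
  · intro P Q h
    refine MvPolynomial.funext fun c => ?_
    have h1 := key P (b.equivFun.symm c)
    rw [h, key Q] at h1
    have : (fun i => b.coord i (b.equivFun.symm c)) = c := by
      funext i
      simp [Module.Basis.equivFun_symm_apply, Module.Basis.coord_apply]
      simp [Finsupp.single_apply]
    rw [this] at h1
    exact h1.symm
  · rintro ⟨f, hf⟩
    suffices h : ∃ P, (MvPolynomial.aeval X P).1 = f by
      obtain ⟨P, hP⟩ := h
      exact ⟨P, Subtype.ext hP⟩
    refine polyFun_induction (P := fun f => ∃ P, (MvPolynomial.aeval X P).1 = f) ?_ ?_ ?_ ?_ hf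
    · intro l
      refine ⟨∑ i, MvPolynomial.C (l (b i)) * MvPolynomial.X i, ?_⟩
      funext a
      rw [key]
      conv_rhs => rw [← b.sum_repr a]
      simp only [map_sum, map_mul, map_smul, MvPolynomial.eval_C, MvPolynomial.eval_X, smul_eq_mul,
        mul_comm, Module.Basis.coord_apply]
    · intro c
      exact ⟨MvPolynomial.C c, by funext a; rw [key]; simp⟩
    · rintro f g - - ⟨P, rfl⟩ ⟨Q, rfl⟩
      exact ⟨P + Q, by rw [map_add]; rfl⟩
    · rintro f g - - ⟨P, rfl⟩ ⟨Q, rfl⟩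
      exact ⟨P * Q, by rw [map_mul]; rfl⟩

theorem formallySmooth_polyFun [Infinite k] [FiniteDimensional k M] :
    Algebra.FormallySmooth k (polyFun k M) := by
  obtain ⟨e⟩ := exists_mvPolynomial_equiv_polyFun (k := k) (M := M)
  exact .of_equiv e

/-- A retract of a formally smooth algebra is formally smooth. -/
theorem formallySmooth_of_retract {A P : Type*} [CommRing A] [Algebra k A] [CommRing P]
    [Algebra k P] [Algebra.FormallySmooth k P] (r : P →ₐ[k] A) (i : A →ₐ[k] P)
    (h : ∀ a, r (i a) = a) : Algebra.FormallySmooth k A :=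
  Algebra.FormallySmooth.of_split r ((Ideal.Quotient.mkₐ k _).comp i)
    (AlgHom.ext fun a => h a)

end PolynomialMaps

/-! ### Coordinate rings -/

section CoordinateRings

variable {k : Type*} [Field k]
variable {M : Type*} [AddCommGroup M] [Module k M]
variable {N : Type*} [AddCommGroup N] [Module k N]

/-- The restriction of polynomial functions to `S`. -/
def restrictPoly (S : Set M) : polyFun k M →ₐ[k] coordRing k S where
  toFun f := ⟨fun s => f.1 s.1, by
    obtain ⟨f, hf⟩ := f
    exact polyFun_induction (P := fun f => (fun s : S => f s.1) ∈ coordRing k S)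
      (fun l => Algebra.subset_adjoin ⟨l, rfl⟩) (fun c => (coordRing k S).algebraMap_mem c)
      (fun f g _ _ hf hg => add_mem hf hg) (fun f g _ _ hf hg => mul_mem hf hg) hf⟩
  map_one' := rfl
  map_mul' _ _ := rfl
  map_zero' := rfl
  map_add' _ _ := rfl
  commutes' _ := rfl

theorem restrictPoly_surjective (S : Set M) :
    Function.Surjective (restrictPoly (k := k) S) := by
  rintro ⟨f, hf⟩
  suffices h : ∃ F : polyFun k M, (restrictPoly S F).1 = f by
    obtain ⟨F, hF⟩ := h
    exact ⟨F, Subtype.ext hF⟩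
  refine Algebra.adjoin_induction (p := fun f _ => ∃ F : polyFun k M, (restrictPoly S F).1 = f)
    ?_ ?_ ?_ ?_ hf
  · rintro _ ⟨l, rfl⟩
    exact ⟨⟨_, dual_mem_polyFun l⟩, rfl⟩
  · intro c
    exact ⟨algebraMap _ _ c, rfl⟩
  · rintro f g - - ⟨F, rfl⟩ ⟨G, rfl⟩
    exact ⟨F + G, rfl⟩
  · rintro f g - - ⟨F, rfl⟩ ⟨G, rfl⟩
    exact ⟨F * G, rfl⟩

theorem coordRing_ext {S : Set M} {f g : coordRing k S} (h : ∀ s, f.1 s = g.1 s) : f = g :=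
  Subtype.ext (funext h)

/-- A map with regular components pulls regular functions back to regular functions. -/
theorem comp_mem_of_coord_mem {T : Type*} (B : Subalgebra k (T → k)) {S : Set M} (θ : T → S)
    (h : ∀ l : Module.Dual k M, (fun t => l (θ t).1) ∈ B) {f : S → k} (hf : f ∈ coordRing k S) :
    (fun t => f (θ t)) ∈ B := by
  refine Algebra.adjoin_induction (p := fun f _ => (fun t => f (θ t)) ∈ B) ?_ ?_ ?_ ?_ hf
  · rintro _ ⟨l, rfl⟩
    exact h l
  · exact fun c => B.algebraMap_mem c
  · exact fun f g _ _ hf hg => add_mem hf hg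
  · exact fun f g _ _ hf hg => mul_mem hf hg

/-- If a subset `S` of a vector space is a retract of a vector space under polynomial maps, then its
coordinate ring is formally smooth. -/
theorem formallySmooth_coordRing_of_retract [Infinite k] [FiniteDimensional k N] {S : Set M}
    (α : N → M) (σ : M → N) (hα : IsPolyMap k α) (hσ : IsPolyMap k σ) (hS : ∀ n, α n ∈ S)
    (h : ∀ s ∈ S, α (σ s) = s) : Algebra.FormallySmooth k (coordRing k S) := by
  have := formallySmooth_polyFun (k := k) (M := N)
  let i : coordRing k S →ₐ[k] polyFun k N :=
    { toFun := fun f => ⟨fun n => f.1 ⟨α n, hS n⟩,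
        comp_mem_of_coord_mem (polyFun k N) (fun n => (⟨α n, hS n⟩ : S)) hα f.2⟩
      map_one' := rfl
      map_mul' := fun _ _ => rfl
      map_zero' := rfl
      map_add' := fun _ _ => rfl
      commutes' := fun _ => rfl }
  let r : polyFun k N →ₐ[k] coordRing k S :=
    (restrictPoly S).comp
      { toFun := fun f => ⟨fun a => f.1 (σ a), comp_mem_polyFun f.2 hσ⟩
        map_one' := rfl
        map_mul' := fun _ _ => rfl
        map_zero' := rfl
        map_add' := fun _ _ => rfl
        commutes' := fun _ => rfl }
  refine formallySmooth_of_retract r i fun f => coordRing_ext fun s => ?_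
  change f.1 ⟨α (σ s.1), _⟩ = f.1 s
  exact congrArg f.1 (Subtype.ext (h s.1 s.2))

theorem finiteType_coordRing [Infinite k] [FiniteDimensional k M] (S : Set M) :
    Algebra.FiniteType k (coordRing k S) := by
  obtain ⟨e⟩ := exists_mvPolynomial_equiv_polyFun (k := k) (M := M)
  exact Algebra.FiniteType.of_surjective ((restrictPoly S).comp e.toAlgHom)
    ((restrictPoly_surjective S).comp e.surjective)

theorem exists_algHom_of_isMaximal [IsAlgClosed k] {R : Type*} [CommRing R] [Algebra k R]
    [Algebra.FiniteType k R] (m : Ideal R) [hm : m.IsMaximal] :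
    ∃ χ : R →ₐ[k] k, ∀ x, χ x = 0 ↔ x ∈ m := by
  let _ : Field (R ⧸ m) := Ideal.Quotient.field m
  have : Module.Finite k (R ⧸ m) := finite_of_finite_type_of_isJacobsonRing k (R ⧸ m)
  have : Algebra.IsIntegral k (R ⧸ m) := inferInstance
  let e := AlgEquiv.ofBijective (Algebra.ofId k (R ⧸ m))
    (IsAlgClosed.algebraMap_bijective_of_isIntegral (k := k) (K := R ⧸ m))
  refine ⟨e.symm.toAlgHom.comp (Ideal.Quotient.mkₐ k m), fun x => ?_⟩
  change e.symm (Ideal.Quotient.mk m x) = 0 ↔ _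
  rw [map_eq_zero_iff _ e.symm.injective, Ideal.Quotient.eq_zero_iff_mem]

/-- Hilbert's Nullstellensatz: a maximal ideal of the coordinate ring of `S` consists of all
functions that vanish at a point. The point lies in the Zariski closure of `S`, that is, all
polynomial functions vanishing on `S` vanish at it. -/
theorem exists_point_of_isMaximal [IsAlgClosed k] [FiniteDimensional k M] {S : Set M}
    (m : Ideal (coordRing k S)) [hm : m.IsMaximal] :
    ∃ a : M, (∀ f ∈ polyFun k M, (∀ s ∈ S, f s = 0) → f a = 0) ∧
      ∀ f : polyFun k M, restrictPoly S f ∈ m ↔ f.1 a = 0 := by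
  have := IsAlgClosed.instInfinite (K := k)
  have := finiteType_coordRing (k := k) S
  obtain ⟨χ₀, hχ₀⟩ := exists_algHom_of_isMaximal (k := k) m
  let χ : polyFun k M →ₐ[k] k := χ₀.comp (restrictPoly S)
  have hχ : ∀ f, χ f = 0 ↔ restrictPoly S f ∈ m := fun f => hχ₀ _
  let D : Module.Dual k (Module.Dual k M) :=
    { toFun := fun l => χ ⟨_, dual_mem_polyFun l⟩
      map_add' := fun l l' => by rw [← map_add]; rfl
      map_smul' := fun c l => by
        rw [RingHom.id_apply, ← map_smul]; rfl }
  obtain ⟨a, ha⟩ := (Module.evalEquiv k M).surjective D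
  have hpt : ∀ f : polyFun k M, χ f = f.1 a := by
    rintro ⟨f, hf⟩
    have : ∃ hf : f ∈ polyFun k M, χ ⟨f, hf⟩ = f a := by
      refine polyFun_induction (P := fun f => ∃ hf : f ∈ polyFun k M, χ ⟨f, hf⟩ = f a)
        ?_ ?_ ?_ ?_ hf
      · intro l
        refine ⟨dual_mem_polyFun l, ?_⟩
        have := LinearMap.congr_fun ha l
        rw [Module.evalEquiv_apply] at this
        exact this.symm
      · intro c
        exact ⟨const_mem_polyFun c, χ.commutes c⟩
      · rintro f g - - ⟨hf, hf'⟩ ⟨hg, hg'⟩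
        exact ⟨add_mem_polyFun hf hg, (map_add χ ⟨f, hf⟩ ⟨g, hg⟩).trans (by rw [hf', hg'])⟩
      · rintro f g - - ⟨hf, hf'⟩ ⟨hg, hg'⟩
        exact ⟨mul_mem_polyFun hf hg, (map_mul χ ⟨f, hf⟩ ⟨g, hg⟩).trans (by rw [hf', hg'])⟩
    exact this.2
  refine ⟨a, fun f hf h0 => ?_, fun f => by rw [← hpt, hχ]⟩
  refine (hpt ⟨f, hf⟩).symm.trans ((hχ _).2 ?_)
  have : restrictPoly S ⟨f, hf⟩ = 0 := coordRing_ext fun s => h0 s.1 s.2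
  rw [this]
  exact m.zero_mem

end CoordinateRings

/-! ### Localization of algebras of functions -/

section FunctionLocalization

variable {k : Type*} [Field k] {T T' : Type*}

/-- For an algebra `A` of functions on `T` and `f ∈ A`, the algebra of all functions on `f ≠ 0` of
the form `a / f ^ n` with `a ∈ A`. -/
def functionLocalization (A : Subalgebra k (T → k)) (f : A) :
    Subalgebra k ({t // f.1 t ≠ 0} → k) where
  carrier := {g | ∃ n : ℕ, ∃ a ∈ A, ∀ t, f.1 t.1 ^ n * g t = a t.1}
  mul_mem' := by
    rintro g g' ⟨n, a, ha, h⟩ ⟨n', a', ha', h'⟩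
    refine ⟨n + n', a * a', mul_mem ha ha', fun t => ?_⟩
    rw [Pi.mul_apply, Pi.mul_apply, ← h, ← h']
    ring
  add_mem' := by
    rintro g g' ⟨n, a, ha, h⟩ ⟨n', a', ha', h'⟩
    refine ⟨n + n', f.1 ^ n' * a + f.1 ^ n * a', add_mem (mul_mem (pow_mem f.2 _) ha)
      (mul_mem (pow_mem f.2 _) ha'), fun t => ?_⟩
    simp only [Pi.add_apply, Pi.mul_apply, Pi.pow_apply, ← h, ← h']
    ring
  algebraMap_mem' c := ⟨0, algebraMap k _ c, A.algebraMap_mem c, fun t => by simp⟩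

/-- The restriction of functions to `f ≠ 0`. -/
def toFunctionLocalization (A : Subalgebra k (T → k)) (f : A) :
    A →ₐ[k] functionLocalization A f where
  toFun a := ⟨fun t => a.1 t.1, 0, a.1, a.2, fun t => by simp⟩
  map_one' := rfl
  map_mul' _ _ := rfl
  map_zero' := rfl
  map_add' _ _ := rfl
  commutes' _ := rfl

theorem nonempty_localization_equiv (A : Subalgebra k (T → k)) (f : A) :
    Nonempty (Localization.Away f ≃ₐ[k] functionLocalization A f) := by
  let _ : Algebra A (functionLocalization A f) := (toFunctionLocalization A f).toAlgebra
  have : IsScalarTower k A (functionLocalization A f) :=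
    IsScalarTower.of_algebraMap_eq fun c => ((toFunctionLocalization A f).commutes c).symm
  have hmap : ∀ (a : A) (t), (algebraMap A (functionLocalization A f) a).1 t = a.1 t.1 :=
    fun _ _ => rfl
  have : IsLocalization.Away f (functionLocalization A f) := by
    refine IsLocalization.Away.mk (S := functionLocalization A f) f ?_ ?_ ?_
    · refine IsUnit.of_mul_eq_one ⟨fun t => (f.1 t.1)⁻¹, 1, 1, one_mem A, fun t => ?_⟩ ?_
      · rw [pow_one, mul_inv_cancel₀ t.2, Pi.one_apply]
      · exact Subtype.ext (funext fun t => mul_inv_cancel₀ t.2)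
    · rintro ⟨g, n, a, ha, h⟩
      refine ⟨n, ⟨a, ha⟩, Subtype.ext (funext fun t => ?_)⟩
      rw [hmap]
      change g t * ((algebraMap A (functionLocalization A f) f ^ n).1 t) = _
      rw [← map_pow, hmap, mul_comm]
      exact h t
    · intro a b hab
      refine ⟨1, Subtype.ext (funext fun t => ?_)⟩
      change (f.1 ^ 1 * a.1) t = (f.1 ^ 1 * b.1) t
      simp only [pow_one, Pi.mul_apply]
      by_cases ht : f.1 t = 0
      · rw [ht, zero_mul, zero_mul]
      · have := congrFun (congrArg Subtype.val hab) ⟨t, ht⟩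
        rw [hmap, hmap] at this
        rw [this]
  exact ⟨(IsLocalization.algEquiv (.powers f) (Localization.Away f)
    (functionLocalization A f)).restrictScalars k⟩

/-- Pullback along a map under which the elements of `A` and the function `1 / f` remain
regular. -/
def functionLocalizationComp {A : Subalgebra k (T → k)} {f : A} {A' : Subalgebra k (T' → k)}
    {f' : A'} (θ : {t // f'.1 t ≠ 0} → {t // f.1 t ≠ 0})
    (h : ∀ a ∈ A, (fun t => a (θ t).1) ∈ functionLocalization A' f')
    (hf : (fun t => (f.1 (θ t).1)⁻¹) ∈ functionLocalization A' f') :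
    functionLocalization A f →ₐ[k] functionLocalization A' f' where
  toFun g := ⟨fun t => g.1 (θ t), by
    obtain ⟨g, n, a, ha, hg⟩ := g
    have : (fun t => g (θ t)) = (fun t => (f.1 (θ t).1)⁻¹) ^ n * fun t => a (θ t).1 := by
      funext t
      rw [Pi.mul_apply, Pi.pow_apply, ← hg, ← mul_assoc, ← mul_pow, inv_mul_cancel₀ (θ t).2,
        one_pow, one_mul]
    change (fun t => g (θ t)) ∈ _
    rw [this]
    exact mul_mem (pow_mem hf n) (h a ha)⟩
  map_one' := rfl
  map_mul' _ _ := rfl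
  map_zero' := rfl
  map_add' _ _ := rfl
  commutes' _ := rfl

end FunctionLocalization

/-! ### Points of projective spaces -/

section Points

variable {k : Type*} [Field k]
variable {M : Type*} [AddCommGroup M] [Module k M]
variable {M' : Type*} [AddCommGroup M'] [Module k M']

theorem IsPt.ne_zero {p : ℙ k M} {v : M} (h : IsPt k p v) : v ≠ 0 := h.1

theorem isPt_mk {v : M} (hv : v ≠ 0) : IsPt k (Projectivization.mk k v hv) v := ⟨hv, rfl⟩

theorem isPt_rep (p : ℙ k M) : IsPt k p p.rep := ⟨p.rep_nonzero, p.mk_rep⟩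

theorem IsPt.smul {p : ℙ k M} {v : M} (h : IsPt k p v) {c : k} (hc : c ≠ 0) : IsPt k p (c • v) := by
  obtain ⟨hv, rfl⟩ := h
  exact ⟨smul_ne_zero hc hv, (Projectivization.mk_eq_mk_iff' k _ _ _ _).2 ⟨c, rfl⟩⟩

theorem IsPt.exists_smul_eq {p : ℙ k M} {v v' : M} (h : IsPt k p v) (h' : IsPt k p v') :
    ∃ c : k, c ≠ 0 ∧ v' = c • v := by
  obtain ⟨hv, rfl⟩ := h
  obtain ⟨hv', h'⟩ := h'
  obtain ⟨c, rfl⟩ := (Projectivization.mk_eq_mk_iff' k _ _ _ _).1 h'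
  exact ⟨c, fun h0 => hv' (by rw [h0, zero_smul]), rfl⟩

theorem IsPt.eq {p p' : ℙ k M} {v : M} (h : IsPt k p v) (h' : IsPt k p' v) : p = p' := by
  obtain ⟨_, rfl⟩ := h
  obtain ⟨_, rfl⟩ := h'
  rfl

theorem IsPt.map {p : ℙ k M} {v : M} (h : IsPt k p v) (φ : M →ₗ[k] M')
    (hφ : Function.Injective φ) : IsPt k (Projectivization.map φ hφ p) (φ v) := by
  obtain ⟨hv, rfl⟩ := h
  exact ⟨fun h0 => hv (hφ (by rw [h0, map_zero])), rfl⟩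

end Points

/-! ### Closed sets and smoothness -/

section Smoothness

variable {k : Type*} [Field k]
variable {E : Type*} [AddCommGroup E] [Module k E]
variable {F : Type*} [AddCommGroup F] [Module k F]

theorem subset_zariskiClosure (S : Set (ℙ k E × ℙ k F)) : S ⊆ zariskiClosure k S :=
  fun w hw _ _ h => h w hw

theorem zariskiClosure_idem (S : Set (ℙ k E × ℙ k F)) :
    zariskiClosure k (zariskiClosure k S) = zariskiClosure k S :=
  (subset_zariskiClosure _).antisymm' fun _ hw f hf h => hw f hf fun _ hs => hs f hf h

/-- A bihomogeneous function vanishes at a point as soon as it vanishes at one representative. -/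
theorem vanishesAt_of_apply_eq_zero {f : E × F → k} (hf : IsBihomog k f) {w : ℙ k E × ℙ k F} {a : E}
    {b : F} (ha : IsPt k w.1 a) (hb : IsPt k w.2 b) (h : f (a, b) = 0) : VanishesAt k f w := by
  obtain ⟨-, m, n, hmn⟩ := hf
  intro a' b' ha' hb'
  obtain ⟨c, -, rfl⟩ := ha.exists_smul_eq ha'
  obtain ⟨d, -, rfl⟩ := hb.exists_smul_eq hb'
  rw [hmn, h, mul_zero]

theorem mem_biChart_of_forall_polyFun {W : Set (ℙ k E × ℙ k F)} (hW : zariskiClosure k W = W)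
    {l : Module.Dual k E} {m : Module.Dual k F} {ab : E × F}
    (h : ∀ f ∈ polyFun k (E × F), (∀ s ∈ biChart k l m W, f s = 0) → f ab = 0) :
    ab ∈ biChart k l m W := by
  have hl : l ab.1 = 1 := sub_eq_zero.1 <| h (fun s => l s.1 - 1)
    (sub_mem_polyFun (dual_fst_mem_polyFun l) (const_mem_polyFun 1))
    fun s hs => sub_eq_zero.2 hs.1
  have hm : m ab.2 = 1 := sub_eq_zero.1 <| h (fun s => m s.2 - 1)
    (sub_mem_polyFun (dual_snd_mem_polyFun m) (const_mem_polyFun 1))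
    fun s hs => sub_eq_zero.2 hs.2.1
  have ha : ab.1 ≠ 0 := fun h0 => one_ne_zero (by rw [← hl, h0, map_zero])
  have hb : ab.2 ≠ 0 := fun h0 => one_ne_zero (by rw [← hm, h0, map_zero])
  refine ⟨hl, hm, (Projectivization.mk k _ ha, Projectivization.mk k _ hb), ?_, isPt_mk ha,
    isPt_mk hb⟩
  rw [← hW]
  intro f hf hfW
  exact vanishesAt_of_apply_eq_zero hf (isPt_mk ha) (isPt_mk hb) <| h f hf.1
    fun s ⟨_, _, w, hw, h1, h2⟩ => hfW w hw _ _ h1 h2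

variable (W : Set (ℙ k E × ℙ k F)) (l p : Module.Dual k E) (m q : Module.Dual k F)

/-- The function `(a, b) ↦ p a * q b` on an affine open piece. -/
def productForm : coordRing k (biChart k l m W) :=
  restrictPoly _ ⟨fun ab => p ab.1 * q ab.2, mul_mem_polyFun
    (dual_fst_mem_polyFun p) (dual_snd_mem_polyFun q)⟩

theorem productForm_apply (s) : (productForm W l p m q).1 s = p s.1.1 * q s.1.2 := rfl

/-- The change of coordinates between two affine open pieces. -/
def chartChange (s : {s // (productForm W l p m q).1 s ≠ 0}) :
    {s // (productForm W p l q m).1 s ≠ 0} :=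
  have hp : p s.1.1.1 ≠ 0 := fun h => s.2 (by rw [productForm_apply, h, zero_mul])
  have hq : q s.1.1.2 ≠ 0 := fun h => s.2 (by rw [productForm_apply, h, mul_zero])
  ⟨⟨((p s.1.1.1)⁻¹ • s.1.1.1, (q s.1.1.2)⁻¹ • s.1.1.2),
    by rw [map_smul, smul_eq_mul, inv_mul_cancel₀ hp],
    by rw [map_smul, smul_eq_mul, inv_mul_cancel₀ hq],
    s.1.2.2.2.imp fun _ hw => ⟨hw.1, hw.2.1.smul (inv_ne_zero hp), hw.2.2.smul (inv_ne_zero hq)⟩⟩,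
  by
    rw [productForm_apply]
    simp only [map_smul, smul_eq_mul, s.1.2.1, s.1.2.2.1, mul_one]
    exact mul_ne_zero (inv_ne_zero hp) (inv_ne_zero hq)⟩

theorem chartChange_val (s : {s // (productForm W l p m q).1 s ≠ 0}) :
    (chartChange W l p m q s).1.1 = ((p s.1.1.1)⁻¹ • s.1.1.1, (q s.1.1.2)⁻¹ • s.1.1.2) := rfl

theorem chartChange_chartChange (s : {s // (productForm W l p m q).1 s ≠ 0}) :
    chartChange W p l q m (chartChange W l p m q s) = s := by
  have hp : p s.1.1.1 ≠ 0 := fun h => s.2 (by rw [productForm_apply, h, zero_mul])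
  have hq : q s.1.1.2 ≠ 0 := fun h => s.2 (by rw [productForm_apply, h, mul_zero])
  refine Subtype.ext (Subtype.ext ?_)
  rw [chartChange_val, chartChange_val]
  simp only [map_smul, smul_eq_mul, s.1.2.1, s.1.2.2.1, mul_one, inv_inv, smul_smul,
    mul_inv_cancel₀ hp, mul_inv_cancel₀ hq, one_smul]

/-- Functions on one affine open piece, considered on another one. -/
def chartChangeHom :
    functionLocalization (coordRing k (biChart k p q W)) (productForm W p l q m) →ₐ[k]
      functionLocalization (coordRing k (biChart k l m W)) (productForm W l p m q) :=
  functionLocalizationComp (chartChange W l p m q)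
    (fun a ha => by
      refine comp_mem_of_coord_mem _ (fun s => (chartChange W l p m q s).1) (fun φ => ?_) ha
      refine ⟨1, _, (restrictPoly (biChart k l m W) ⟨fun ab =>
        q ab.2 * (φ ∘ₗ LinearMap.inl k E F) ab.1 + p ab.1 * (φ ∘ₗ LinearMap.inr k E F) ab.2,
        add_mem_polyFun
          (mul_mem_polyFun (dual_snd_mem_polyFun q)
            (dual_fst_mem_polyFun (φ ∘ₗ LinearMap.inl k E F)))
          (mul_mem_polyFun (dual_fst_mem_polyFun p)
            (dual_snd_mem_polyFun (φ ∘ₗ LinearMap.inr k E F)))⟩).2,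
        fun s => ?_⟩
      have hp : p s.1.1.1 ≠ 0 := fun h => s.2 (by rw [productForm_apply, h, zero_mul])
      have hq : q s.1.1.2 ≠ 0 := fun h => s.2 (by rw [productForm_apply, h, mul_zero])
      rw [productForm_apply, pow_one]
      change p s.1.1.1 * q s.1.1.2 * φ ((p s.1.1.1)⁻¹ • s.1.1.1, (q s.1.1.2)⁻¹ • s.1.1.2) =
        q s.1.1.2 * φ (LinearMap.inl k E F s.1.1.1) + p s.1.1.1 * φ (LinearMap.inr k E F s.1.1.2)
      have e : ((p s.1.1.1)⁻¹ • s.1.1.1, (q s.1.1.2)⁻¹ • s.1.1.2) =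
          (p s.1.1.1)⁻¹ • LinearMap.inl k E F s.1.1.1 +
            (q s.1.1.2)⁻¹ • LinearMap.inr k E F s.1.1.2 := by simp
      rw [e, map_add, map_smul, map_smul]
      simp only [smul_eq_mul]
      field_simp)
    ⟨0, _, (productForm W l p m q).2, fun s => by
      rw [pow_zero, one_mul]
      change (l ((p s.1.1.1)⁻¹ • s.1.1.1) * m ((q s.1.1.2)⁻¹ • s.1.1.2))⁻¹ = p s.1.1.1 * q s.1.1.2
      simp only [map_smul, smul_eq_mul, s.1.2.1, s.1.2.2.1, mul_one, mul_inv, inv_inv]⟩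

theorem formallySmooth_localization_productForm
    [Algebra.FormallySmooth k (coordRing k (biChart k p q W))] :
    Algebra.FormallySmooth k (Localization.Away (productForm W l p m q)) := by
  obtain ⟨e⟩ := nonempty_localization_equiv _ (productForm W l p m q)
  obtain ⟨e'⟩ := nonempty_localization_equiv _ (productForm W p l q m)
  have : Algebra.FormallySmooth k (Localization.Away (productForm W p l q m)) :=
    .comp k (coordRing k (biChart k p q W)) _
  have : Algebra.FormallySmooth k
      (functionLocalization (coordRing k (biChart k p q W)) (productForm W p l q m)) :=
    .of_equiv e'
  have : Algebra.FormallySmooth k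
      (functionLocalization (coordRing k (biChart k l m W)) (productForm W l p m q)) :=
    formallySmooth_of_retract (chartChangeHom W l p m q) (chartChangeHom W p l q m) fun g =>
      Subtype.ext (funext fun s => congrArg g.1 (chartChange_chartChange W l p m q s))
  exact .of_equiv e.symm

variable {W}

/-- A closed subset is smooth if every point has an affine open neighbourhood of the form `p ≠ 0`,
`q ≠ 0` with formally smooth coordinate ring. -/
theorem isSmoothVariety_of_forall_exists_chart [IsAlgClosed k] [FiniteDimensional k E]
    [FiniteDimensional k F] (hW : zariskiClosure k W = W)
    (h : ∀ w ∈ W, ∃ (p : Module.Dual k E) (q : Module.Dual k F),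
      (∀ a b, IsPt k w.1 a → IsPt k w.2 b → p a * q b ≠ 0) ∧
      Algebra.FormallySmooth k (coordRing k (biChart k p q W))) : IsSmoothVariety k W := by
  have := IsAlgClosed.instInfinite (K := k)
  refine ⟨hW, fun l m => ?_⟩
  have := finiteType_coordRing (k := k) (biChart k l m W)
  have hfp : Algebra.FinitePresentation k (coordRing k (biChart k l m W)) :=
    Algebra.FinitePresentation.of_finiteType.1 this
  refine ⟨Algebra.smoothLocus_eq_univ_iff.1 (Set.eq_univ_of_forall fun P => ?_), hfp⟩
  obtain ⟨M, hM, hPM⟩ := Ideal.exists_le_maximal P.asIdeal P.2.ne_top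
  obtain ⟨ab, hab, hmem⟩ := exists_point_of_isMaximal (k := k) M
  obtain ⟨-, -, w, hw, hwa, hwb⟩ := mem_biChart_of_forall_polyFun hW hab
  obtain ⟨p, q, hpq, hs⟩ := h w hw
  have := formallySmooth_localization_productForm W l p m q
  refine Algebra.basicOpen_subset_smoothLocus_iff.2 this ?_
  intro hP
  exact hpq _ _ hwa hwb ((hmem _).1 (hPM hP))

end Smoothness

/-! ### Bivectors and contraction -/

section Bivectors

variable {k : Type*} [Field k]
variable {M : Type*} [AddCommGroup M] [Module k M]
variable {N : Type*} [AddCommGroup N] [Module k N]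

theorem wedge_add_left (x x' y : M) : wedge k (x + x') y = wedge k x y + wedge k x' y :=
  Subtype.ext (by simp [wedge_coe, add_mul])

theorem wedge_add_right (x y y' : M) : wedge k x (y + y') = wedge k x y + wedge k x y' :=
  Subtype.ext (by simp [wedge_coe, mul_add])

theorem wedge_smul_left (c : k) (x y : M) : wedge k (c • x) y = c • wedge k x y :=
  Subtype.ext (by simp [wedge_coe])

theorem wedge_smul_right (c : k) (x y : M) : wedge k x (c • y) = c • wedge k x y :=
  Subtype.ext (by simp [wedge_coe])

variable (k M) in
/-- The wedge product as a bilinear map. -/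
def wedgeBilin : M →ₗ[k] M →ₗ[k] ⋀[k]^2 M :=
  LinearMap.mk₂ k (wedge k) wedge_add_left wedge_smul_left wedge_add_right
    fun c x y => wedge_smul_right c x y

@[simp] theorem wedgeBilin_apply (x y : M) : wedgeBilin k M x y = wedge k x y := rfl

theorem wedge_neg_left (x y : M) : wedge k (-x) y = -wedge k x y := by
  simp only [← wedgeBilin_apply, map_neg, LinearMap.neg_apply]

theorem wedge_sub_left (x x' y : M) : wedge k (x - x') y = wedge k x y - wedge k x' y := by
  simp only [← wedgeBilin_apply, map_sub, LinearMap.sub_apply]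

theorem wedge_sub_right (x y y' : M) : wedge k x (y - y') = wedge k x y - wedge k x y' := by
  simp only [← wedgeBilin_apply, map_sub]

@[simp] theorem wedge_zero_left (y : M) : wedge k 0 y = 0 := by
  simp only [← wedgeBilin_apply, map_zero, LinearMap.zero_apply]

@[simp] theorem wedge_zero_right (x : M) : wedge k x 0 = 0 := by
  simp only [← wedgeBilin_apply, map_zero]

@[simp] theorem wedge_self (x : M) : wedge k x x = 0 :=
  Subtype.ext (by simp [wedge_coe])

theorem wedge_swap (x y : M) : wedge k y x = -wedge k x y := by
  have h := wedge_self (k := k) (x + y)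
  rw [wedge_add_left, wedge_add_right, wedge_add_right, wedge_self, wedge_self, zero_add,
    add_zero] at h
  exact eq_neg_of_add_eq_zero_right h

theorem map_wedge (φ : M →ₗ[k] N) (x y : M) :
    exteriorPower.map 2 φ (wedge k x y) = wedge k (φ x) (φ y) := by
  simp only [wedge, exteriorPower.map_apply_ιMulti]
  congr 1
  funext i
  fin_cases i <;> rfl

theorem bivector_linearMap_ext {φ ψ : ⋀[k]^2 M →ₗ[k] N}
    (h : ∀ x y, φ (wedge k x y) = ψ (wedge k x y)) : φ = ψ := by
  refine exteriorPower.linearMap_ext (AlternatingMap.ext fun v => ?_)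
  have e : v = ![v 0, v 1] := by
    funext i
    fin_cases i <;> rfl
  rw [e]
  exact h (v 0) (v 1)

/-- The linear map on bivectors induced by an alternating bilinear map. -/
def bivectorLift (B : M →ₗ[k] M →ₗ[k] N) (hB : ∀ x, B x x = 0) : ⋀[k]^2 M →ₗ[k] N :=
  exteriorPower.alternatingMapLinearEquiv
    { toFun := fun v => B (v 0) (v 1)
      map_update_add' := fun v i x y => by
        fin_cases i <;> simp [Function.update]
      map_update_smul' := fun v i c x => by
        fin_cases i <;> simp [Function.update]
      map_eq_zero_of_eq' := fun v i j hij hne => by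
        fin_cases i <;> fin_cases j <;> simp_all }

theorem bivectorLift_wedge (B : M →ₗ[k] M →ₗ[k] N) (hB : ∀ x, B x x = 0) (x y : M) :
    bivectorLift B hB (wedge k x y) = B x y := by
  rw [bivectorLift, wedge, exteriorPower.alternatingMapLinearEquiv_apply_ιMulti]
  rfl

/-- The contraction of bivectors with a linear form, `x ∧ y ↦ f(x) y - f(y) x`. -/
def contract (f : Module.Dual k M) : ⋀[k]^2 M →ₗ[k] M :=
  bivectorLift (LinearMap.mk₂ k (fun x y => f x • y - f y • x)
    (fun x x' y => by simp only [map_add, add_smul, smul_add]; abel)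
    (fun c x y => by simp only [map_smul, smul_sub, smul_smul, smul_eq_mul, mul_comm c])
    (fun x y y' => by simp only [map_add, add_smul, smul_add]; abel)
    (fun c x y => by simp only [map_smul, smul_sub, smul_smul, smul_eq_mul, mul_comm c]))
    fun x => by simp

@[simp] theorem contract_wedge (f : Module.Dual k M) (x y : M) :
    contract f (wedge k x y) = f x • y - f y • x :=
  bivectorLift_wedge _ _ x y

theorem apply_contract_swap (f g : Module.Dual k M) (a : ⋀[k]^2 M) :
    g (contract f a) = -f (contract g a) := by
  have : g ∘ₗ contract f = -(f ∘ₗ contract g) := bivector_linearMap_ext fun x y => by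
    simp [mul_comm]
  exact LinearMap.congr_fun this a

theorem apply_contract_self (f : Module.Dual k M) (a : ⋀[k]^2 M) : f (contract f a) = 0 := by
  have : f ∘ₗ contract f = 0 := bivector_linearMap_ext fun x y => by
    simp [mul_comm]
  exact LinearMap.congr_fun this a

theorem contract_add (f g : Module.Dual k M) (a : ⋀[k]^2 M) :
    contract (f + g) a = contract f a + contract g a := by
  have : contract (f + g) = contract f + contract g := bivector_linearMap_ext fun x y => by
    simp only [contract_wedge, LinearMap.add_apply, add_smul]; abel
  exact LinearMap.congr_fun this a

/-- Euler's identity for bivectors. -/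
theorem sum_wedge_contract {ι : Type*} [Fintype ι] (b : Module.Basis ι k M) (a : ⋀[k]^2 M) :
    ∑ i, wedge k (b i) (contract (b.coord i) a) = (2 : k) • a := by
  have : ∑ i, wedgeBilin k M (b i) ∘ₗ contract (b.coord i) = (2 : k) • LinearMap.id := by
    refine bivector_linearMap_ext fun x y => ?_
    simp only [LinearMap.sum_apply, LinearMap.comp_apply, contract_wedge, wedgeBilin_apply,
      wedge_sub_right, wedge_smul_right, Finset.sum_sub_distrib, ← wedge_smul_left,
      Module.Basis.coord_apply]
    simp only [← wedgeBilin_apply, ← LinearMap.sum_apply, ← map_sum, b.sum_repr]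
    simp only [wedgeBilin_apply, LinearMap.smul_apply, LinearMap.id_apply, wedge_swap x y]
    module
  have := LinearMap.congr_fun this a
  simpa using this

theorem exists_apply_contract_ne_zero [CharZero k] [FiniteDimensional k M] {a : ⋀[k]^2 M}
    (ha : a ≠ 0) : ∃ f g : Module.Dual k M, g (contract f a) ≠ 0 := by
  by_contra! h
  refine ha ?_
  have e := sum_wedge_contract (Module.finBasis k M) a
  have h0 : ∀ f, contract f a = 0 := fun f =>
    (Module.forall_dual_apply_eq_zero_iff k _).1 fun g => h f g
  simp only [h0, wedge_zero_right, Finset.sum_const_zero] at e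
  exact (smul_eq_zero.1 e.symm).resolve_left two_ne_zero

/-- The Plücker relations in a form free of coordinates. -/
theorem apply_contract_smul_wedge (f g : Module.Dual k M) (x y : M) :
    g (contract f (wedge k x y)) • wedge k x y =
      wedge k (contract f (wedge k x y)) (contract g (wedge k x y)) := by
  simp only [contract_wedge, wedge_sub_left, wedge_sub_right, wedge_smul_left, wedge_smul_right,
    wedge_self, wedge_swap x y, map_sub, map_smul, smul_eq_mul]
  module

theorem contractLeft_coe (f : Module.Dual k M) (a : ⋀[k]^2 M) :
    CliffordAlgebra.contractLeft f (a : ExteriorAlgebra k M) =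
      ExteriorAlgebra.ι k (contract f a) := by
  have : (CliffordAlgebra.contractLeft (Q := (0 : QuadraticForm k M)) f) ∘ₗ
      (⋀[k]^2 M).subtype = (ExteriorAlgebra.ι k) ∘ₗ contract f :=
    bivector_linearMap_ext fun x y => by
      simp only [LinearMap.comp_apply, Submodule.subtype_apply, wedge_coe, contract_wedge]
      erw [CliffordAlgebra.contractLeft_ι_mul, CliffordAlgebra.contractLeft_ι]
      simp only [map_sub, map_smul, Algebra.algebraMap_eq_smul_one, mul_smul_comm, mul_one]
  exact LinearMap.congr_fun this a

/-- A bivector annihilated by the vector `x` is divisible by `x`. -/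
theorem smul_eq_wedge_contract_of_ι_mul_eq_zero {x : M} {a : ⋀[k]^2 M}
    (h : ExteriorAlgebra.ι k x * (a : ExteriorAlgebra k M) = 0) (f : Module.Dual k M) :
    f x • a = wedge k x (contract f a) := by
  have h1 := congrArg (CliffordAlgebra.contractLeft (Q := (0 : QuadraticForm k M)) f) h
  erw [CliffordAlgebra.contractLeft_ι_mul, contractLeft_coe, map_zero] at h1
  refine Subtype.ext ?_
  rw [wedge_coe]
  exact sub_eq_zero.1 h1

end Bivectors

/-! ### The linear projection `⋀²(k² ⊗ V) → S²k² ⊗ ⋀²V` -/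

section Projection

variable {k : Type*} [Field k] {V : Type*} [AddCommGroup V] [Module k V]

theorem pluckerVec_eq (A : Matrix (Fin 2) (Fin 2) V) : pluckerVec k A = wedge k (A 0) (A 1) := rfl

theorem wedge_eq_pluckerVec (r s : Row V) : wedge k r s = pluckerVec k (Matrix.of ![r, s]) := rfl

variable (k V) in
/-- The linear map that sends a row to its `i`-th component. -/
abbrev rowProj (i : Fin 2) : Row V →ₗ[k] V := LinearMap.proj i

variable (k V) in
/-- The linear map that sends the Plücker vector of `A` to `Phi A`: the projection of
`⋀²(k² ⊗ V) = S²k² ⊗ ⋀²V ⊕ ⋀²k² ⊗ S²V` onto the first summand. -/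
def phiLin : PluckerSpace k V →ₗ[k] Triple k V :=
  LinearMap.pi ![exteriorPower.map 2 (rowProj k V 0),
    exteriorPower.map 2 (rowProj k V 0 + rowProj k V 1) -
      exteriorPower.map 2 (rowProj k V 0) - exteriorPower.map 2 (rowProj k V 1),
    exteriorPower.map 2 (rowProj k V 1)]

theorem phiLin_zero (a : PluckerSpace k V) :
    phiLin k V a 0 = exteriorPower.map 2 (rowProj k V 0) a := rfl

theorem phiLin_one (a : PluckerSpace k V) :
    phiLin k V a 1 = exteriorPower.map 2 (rowProj k V 0 + rowProj k V 1) a -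
      exteriorPower.map 2 (rowProj k V 0) a - exteriorPower.map 2 (rowProj k V 1) a := rfl

theorem phiLin_two (a : PluckerSpace k V) :
    phiLin k V a 2 = exteriorPower.map 2 (rowProj k V 1) a := rfl

theorem phiLin_wedge_zero (r s : Row V) :
    phiLin k V (wedge k r s) 0 = wedge k (r 0) (s 0) := by
  rw [phiLin_zero, map_wedge]; rfl

theorem phiLin_wedge_one (r s : Row V) :
    phiLin k V (wedge k r s) 1 = wedge k (r 0) (s 1) + wedge k (r 1) (s 0) := by
  rw [phiLin_one, map_wedge, map_wedge, map_wedge]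
  simp only [LinearMap.add_apply, LinearMap.proj_apply, wedge_add_left, wedge_add_right]
  abel

theorem phiLin_wedge_two (r s : Row V) :
    phiLin k V (wedge k r s) 2 = wedge k (r 1) (s 1) := by
  rw [phiLin_two, map_wedge]; rfl

theorem phiLin_pluckerVec (A : Matrix (Fin 2) (Fin 2) V) :
    phiLin k V (pluckerVec k A) = Phi k A := by
  rw [pluckerVec_eq]
  funext i
  fin_cases i
  · exact phiLin_wedge_zero _ _
  · exact phiLin_wedge_one _ _
  · exact phiLin_wedge_two _ _

/-- The linear form `f`, applied to the `i`-th component of a row. -/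
def rowForm (f : Module.Dual k V) (i : Fin 2) : Module.Dual k (Row V) := f ∘ₗ LinearMap.proj i

@[simp] theorem rowForm_apply (f : Module.Dual k V) (i : Fin 2) (r : Row V) :
    rowForm f i r = f (r i) := rfl

/-- The Plücker coordinate of the two forms `rowForm f 0` and `rowForm f 1`. On the Plücker vector
of `diag(x, x)` it takes the value `f x * f x`. -/
def diagForm (f : Module.Dual k V) : Module.Dual k (PluckerSpace k V) :=
  rowForm f 1 ∘ₗ contract (rowForm f 0)

/-- The first vector of the basis of a plane that is dual to `rowForm f 0`, `rowForm f 1`,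
multiplied by `diagForm f`. -/
def firstRow (f : Module.Dual k V) : PluckerSpace k V →ₗ[k] Row V := -contract (rowForm f 1)

/-- The second vector of the basis of a plane that is dual to `rowForm f 0`, `rowForm f 1`,
multiplied by `diagForm f`. -/
def secondRow (f : Module.Dual k V) : PluckerSpace k V →ₗ[k] Row V := contract (rowForm f 0)

theorem diagForm_wedge (f : Module.Dual k V) (r s : Row V) :
    diagForm f (wedge k r s) = f (r 0) * f (s 1) - f (s 0) * f (r 1) := by
  simp [diagForm]

theorem firstRow_wedge (f : Module.Dual k V) (r s : Row V) :
    firstRow f (wedge k r s) = f (s 1) • r - f (r 1) • s := by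
  simp [firstRow]

theorem secondRow_wedge (f : Module.Dual k V) (r s : Row V) :
    secondRow f (wedge k r s) = f (r 0) • s - f (s 0) • r := by
  simp [secondRow]

theorem apply_firstRow_zero (f : Module.Dual k V) (a : PluckerSpace k V) :
    f (firstRow f a 0) = diagForm f a := by
  have := apply_contract_swap (rowForm f 0) (rowForm f 1) a
  change f ((-contract (rowForm f 1) a) 0) = rowForm f 1 (contract (rowForm f 0) a)
  rw [this, Pi.neg_apply, map_neg]
  rfl

theorem firstRow_one (f : Module.Dual k V) (a : PluckerSpace k V) :
    firstRow f a 1 = -contract f (phiLin k V a 2) := by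
  have : LinearMap.proj 1 ∘ₗ firstRow f = -(contract f ∘ₗ LinearMap.proj 2 ∘ₗ phiLin k V) :=
    bivector_linearMap_ext fun r s => by
      simp [firstRow_wedge, phiLin_wedge_two]
  exact LinearMap.congr_fun this a

theorem secondRow_zero (f : Module.Dual k V) (a : PluckerSpace k V) :
    secondRow f a 0 = contract f (phiLin k V a 0) := by
  have : LinearMap.proj 0 ∘ₗ secondRow f = contract f ∘ₗ LinearMap.proj 0 ∘ₗ phiLin k V :=
    bivector_linearMap_ext fun r s => by
      simp [secondRow_wedge, phiLin_wedge_zero]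
  exact LinearMap.congr_fun this a

theorem secondRow_one (f : Module.Dual k V) (a : PluckerSpace k V) :
    secondRow f a 1 = firstRow f a 0 + contract f (phiLin k V a 1) := by
  have : LinearMap.proj 1 ∘ₗ secondRow f =
      LinearMap.proj 0 ∘ₗ firstRow f + contract f ∘ₗ LinearMap.proj 1 ∘ₗ phiLin k V :=
    bivector_linearMap_ext fun r s => by
      simp [firstRow_wedge, secondRow_wedge, phiLin_wedge_one]
      abel
  exact LinearMap.congr_fun this a

/-- The Plücker relations. They characterize the decomposable bivectors. -/
def PluckerRelations {M : Type*} [AddCommGroup M] [Module k M] (a : ⋀[k]^2 M) : Prop :=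
  ∀ f g : Module.Dual k M, g (contract f a) • a = wedge k (contract f a) (contract g a)

theorem PluckerRelations.diagForm_smul {a : PluckerSpace k V} (h : PluckerRelations a)
    (f : Module.Dual k V) : diagForm f a • a = wedge k (firstRow f a) (secondRow f a) := by
  refine (h (rowForm f 0) (rowForm f 1)).trans ?_
  rw [wedge_swap, ← wedge_neg_left]
  rfl

variable (k V) in
theorem pluckerRelations_pluckerVec (A : Matrix (Fin 2) (Fin 2) V) :
    PluckerRelations (pluckerVec k A) := fun f g => apply_contract_smul_wedge f g _ _

/-- The closed embedding of `P(V)` onto `Z_G`, as a quadratic map between vector spaces. -/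
def diagVec (x : V) : PluckerSpace k V := pluckerVec k !![x, 0; 0, x]

theorem diagVec_eq (x : V) : diagVec (k := k) x = wedge k ![x, 0] ![0, x] := rfl

theorem phiLin_diagVec (x : V) : phiLin k V (diagVec x) = 0 := by
  rw [diagVec_eq]
  funext i
  fin_cases i
  · exact (phiLin_wedge_zero _ _).trans (by simp)
  · exact (phiLin_wedge_one _ _).trans (by simp)
  · exact (phiLin_wedge_two _ _).trans (by simp)

theorem diagForm_diagVec (f : Module.Dual k V) (x : V) :
    diagForm f (diagVec (k := k) x) = f x * f x := by
  rw [diagVec_eq, diagForm_wedge]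
  simp

theorem firstRow_diagVec (f : Module.Dual k V) (x : V) :
    firstRow f (diagVec (k := k) x) = f x • ![x, 0] := by
  rw [diagVec_eq, firstRow_wedge]
  simp

theorem diagVec_smul (c : k) (x : V) : diagVec (k := k) (c • x) = (c * c) • diagVec x := by
  have h0 : ![c • x, 0] = c • ![x, 0] := by simp
  have h1 : ![0, c • x] = c • ![0, x] := by simp
  rw [diagVec_eq, diagVec_eq, h0, h1, wedge_smul_left, wedge_smul_right, smul_smul]

theorem diagVec_ne_zero {x : V} (hx : x ≠ 0) : diagVec (k := k) x ≠ 0 := by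
  obtain ⟨f, hf⟩ := not_forall.1 fun h => hx ((Module.forall_dual_apply_eq_zero_iff k x).1 h)
  intro h
  have := diagForm_diagVec f x
  rw [h, map_zero] at this
  exact hf (mul_self_eq_zero.1 this.symm)

end Projection

/-! ### The Grassmannian and the fixed locus -/

section FixedLocus

variable {k : Type*} [Field k] {V : Type*} [AddCommGroup V] [Module k V]

theorem pluckerRelations_smul {M : Type*} [AddCommGroup M] [Module k M] {a : ⋀[k]^2 M}
    (h : PluckerRelations a) (c : k) : PluckerRelations (c • a) := fun f g => by
  simp only [map_smul, wedge_smul_left, wedge_smul_right, ← h f g, smul_eq_mul]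
  module

theorem exists_eq_pluckerVec [CharZero k] [FiniteDimensional k V] {a : PluckerSpace k V}
    (ha : a ≠ 0) (h : PluckerRelations a) : ∃ A : Matrix (Fin 2) (Fin 2) V, a = pluckerVec k A := by
  obtain ⟨f, g, hfg⟩ := exists_apply_contract_ne_zero ha
  refine ⟨Matrix.of ![(g (contract f a))⁻¹ • contract f a, contract g a], ?_⟩
  rw [← wedge_eq_pluckerVec, wedge_smul_left, ← h f g, smul_smul, inv_mul_cancel₀ hfg, one_smul]

theorem IsPt.pluckerRelations {p : ℙ k (PluckerSpace k V)} {a : PluckerSpace k V}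
    (ha : IsPt k p a) (hp : p ∈ grassmannian k V) : PluckerRelations a := by
  obtain ⟨A, hA⟩ := hp
  obtain ⟨c, -, rfl⟩ := hA.exists_smul_eq ha
  exact pluckerRelations_smul (pluckerRelations_pluckerVec k V A) c

theorem IsPt.mem_grassmannian [CharZero k] [FiniteDimensional k V] {p : ℙ k (PluckerSpace k V)}
    {a : PluckerSpace k V} (ha : IsPt k p a) (h : PluckerRelations a) : p ∈ grassmannian k V := by
  obtain ⟨A, rfl⟩ := exists_eq_pluckerVec ha.ne_zero h
  exact ⟨A, ha⟩

theorem plucker_linearMap_ext {N : Type*} [AddCommGroup N] [Module k N]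
    {φ ψ : PluckerSpace k V →ₗ[k] N} (h : ∀ A, φ (pluckerVec k A) = ψ (pluckerVec k A)) : φ = ψ :=
  bivector_linearMap_ext fun r s => by rw [wedge_eq_pluckerVec]; exact h _

theorem phiLin_actPluckerLin (g : Matrix.SpecialLinearGroup (Fin 2) k) (a : PluckerSpace k V) :
    phiLin k V (actPluckerLin k V g a) = actTripleLin k V g (phiLin k V a) := by
  have : phiLin k V ∘ₗ actPluckerLin k V g = actTripleLin k V g ∘ₗ phiLin k V :=
    plucker_linearMap_ext fun A => by
      simp only [LinearMap.comp_apply, actPluckerLin_pluckerVec, phiLin_pluckerVec,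
        actTripleLin_Phi]
      exact phiLin_pluckerVec _
  exact LinearMap.congr_fun this a

theorem actPluckerLin_diagVec (g : Matrix.SpecialLinearGroup (Fin 2) k) (x : V) :
    actPluckerLin k V g (diagVec x) = diagVec x := by
  have hdet : g.1 0 0 * g.1 1 1 - g.1 0 1 * g.1 1 0 = 1 := by
    rw [← Matrix.det_fin_two]; exact g.2
  have e0 : rowMul k g.1 ![x, 0] = g.1 0 0 • ![x, 0] + g.1 0 1 • ![0, x] := by
    funext j
    rw [rowMul_apply]
    fin_cases j <;> simp
  have e1 : rowMul k g.1 ![0, x] = g.1 1 0 • ![x, 0] + g.1 1 1 • ![0, x] := by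
    funext j
    rw [rowMul_apply]
    fin_cases j <;> simp
  rw [diagVec_eq, actPluckerLin, map_wedge, e0, e1]
  simp only [wedge_add_left, wedge_add_right, wedge_smul_left, wedge_smul_right, wedge_self,
    wedge_swap ![x, 0] ![0, x]]
  rw [← sub_eq_zero]
  calc _ = (g.1 0 0 * g.1 1 1 - g.1 0 1 * g.1 1 0 - 1) • wedge k ![x, 0] ![0, x] := by module
    _ = 0 := by rw [hdet, sub_self, zero_smul]

/-- The only invariant triple is zero: the torus element `diag(2, 1/2)` kills the outer two
components, and then a unipotent element the middle one. -/
theorem triple_eq_zero_of_invariant [CharZero k] {t : Triple k V}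
    (h : ∀ g, actTripleLin k V g t = t) : t = 0 := by
  have h2 : (2 : k) ≠ 0 := two_ne_zero
  have h3 : (3 : k) ≠ 0 := three_ne_zero
  have hT := h ⟨!![2, 0; 0, 2⁻¹], by rw [Matrix.det_fin_two]; simp⟩
  have hU := h ⟨!![1, 0; 1, 1], by rw [Matrix.det_fin_two]; simp⟩
  have t0 : t 0 = 0 := by
    have := congrFun hT 0
    simp only [actTripleLin, rowMul_apply, symSq, Fin.sum_univ_three] at this
    simp at this
    have h' : (3 : k) • t 0 = 0 := by
      rw [← sub_eq_zero.2 this]; module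
    exact (smul_eq_zero.1 h').resolve_left h3
  have t2 : t 2 = 0 := by
    have := congrFun hT 2
    simp only [actTripleLin, rowMul_apply, symSq, Fin.sum_univ_three] at this
    simp at this
    have h' : (3 : k) • t 2 = 0 := by
      have h4 : (4 : k) • ((2 ^ 2)⁻¹ : k) • t 2 = t 2 := by
        rw [smul_smul]; norm_num
      rw [this] at h4
      rw [← sub_eq_zero.2 h4]; module
    exact (smul_eq_zero.1 h').resolve_left h3
  have t1 : t 1 = 0 := by
    have := congrFun hU 0
    simp only [actTripleLin, rowMul_apply, symSq, Fin.sum_univ_three] at this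
    simpa [t0, t2] using this
  funext i
  fin_cases i
  exacts [t0, t1, t2]

/-- If the projection of a nonzero `a` to `S²k² ⊗ ⋀²V` is zero then `diagForm f a ≠ 0` for some `f`:
the component of `a` in `⋀²k² ⊗ S²V` is a symmetric bilinear form in `f`, and is determined by
its values `diagForm f a` on the diagonal. -/
theorem exists_diagForm_ne_zero [CharZero k] [FiniteDimensional k V] {a : PluckerSpace k V}
    (ha : a ≠ 0) (h : phiLin k V a = 0) : ∃ f : Module.Dual k V, diagForm f a ≠ 0 := by
  by_contra! h0
  have hadd : ∀ (f g : Module.Dual k V) (i : Fin 2),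
      rowForm (f + g) i = rowForm f i + rowForm g i := fun _ _ _ => rfl
  have hD : ∀ f, rowForm f 1 (contract (rowForm f 0) a) = 0 := h0
  have hsym : ∀ f g : Module.Dual k V, rowForm g 1 (contract (rowForm f 0) a) =
      rowForm f 1 (contract (rowForm g 0) a) := by
    intro f g
    have e : rowForm g 1 ∘ₗ contract (rowForm f 0) - rowForm f 1 ∘ₗ contract (rowForm g 0) =
        g ∘ₗ contract f ∘ₗ LinearMap.proj 1 ∘ₗ phiLin k V :=
      bivector_linearMap_ext fun r s => by
        simp [phiLin_wedge_one]
        ring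
    have := LinearMap.congr_fun e a
    simp only [LinearMap.comp_apply, h, map_zero] at this
    exact sub_eq_zero.1 this
  have h01 : ∀ f g : Module.Dual k V, rowForm g 1 (contract (rowForm f 0) a) = 0 := by
    intro f g
    have := hD (f + g)
    rw [hadd, hadd, contract_add] at this
    simp only [LinearMap.add_apply, map_add, hD, zero_add, add_zero, hsym g f] at this
    rw [← two_mul] at this
    exact (mul_eq_zero.1 this).resolve_left two_ne_zero
  have h00 : ∀ f g : Module.Dual k V, rowForm g 0 (contract (rowForm f 0) a) = 0 := by
    intro f g
    have e : rowForm g 0 ∘ₗ contract (rowForm f 0) =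
        g ∘ₗ contract f ∘ₗ LinearMap.proj 0 ∘ₗ phiLin k V :=
      bivector_linearMap_ext fun r s => by simp [phiLin_wedge_zero]
    have := LinearMap.congr_fun e a
    simpa only [LinearMap.comp_apply, h, map_zero] using this
  have h11 : ∀ f g : Module.Dual k V, rowForm g 1 (contract (rowForm f 1) a) = 0 := by
    intro f g
    have e : rowForm g 1 ∘ₗ contract (rowForm f 1) =
        g ∘ₗ contract f ∘ₗ LinearMap.proj 2 ∘ₗ phiLin k V :=
      bivector_linearMap_ext fun r s => by simp [phiLin_wedge_two]
    have := LinearMap.congr_fun e a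
    simpa only [LinearMap.comp_apply, h, map_zero] using this
  obtain ⟨f, g, hfg⟩ := exists_apply_contract_ne_zero ha
  have split : ∀ f : Module.Dual k (Row V), ∃ f₀ f₁ : Module.Dual k V,
      f = rowForm f₀ 0 + rowForm f₁ 1 := by
    intro f
    refine ⟨f ∘ₗ LinearMap.single k (fun _ => V) 0, f ∘ₗ LinearMap.single k (fun _ => V) 1, ?_⟩
    refine LinearMap.ext fun r => ?_
    simp only [LinearMap.add_apply, rowForm_apply, LinearMap.comp_apply, ← map_add]
    congr 1
    funext i
    fin_cases i <;> simp
  obtain ⟨f₀, f₁, rfl⟩ := split f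
  obtain ⟨g₀, g₁, rfl⟩ := split g
  refine hfg ?_
  simp only [contract_add, LinearMap.add_apply, map_add, h00, h01, h11,
    apply_contract_swap (rowForm f₁ 1) (rowForm g₀ 0), neg_zero, add_zero]

theorem PluckerRelations.diagForm_smul_eq_diagVec {a : PluckerSpace k V} (hP : PluckerRelations a)
    (h : phiLin k V a = 0) (f : Module.Dual k V) :
    diagForm f a • a = diagVec (firstRow f a 0) := by
  rw [hP.diagForm_smul, diagVec_eq]
  congr 1
  · funext i
    fin_cases i
    · rfl
    · exact (firstRow_one f a).trans (by rw [h]; simp)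
  · funext i
    fin_cases i
    · exact (secondRow_zero f a).trans (by rw [h]; simp)
    · exact (secondRow_one f a).trans (by rw [h]; simp)

theorem phiLin_eq_zero_of_mem_fixedLocus [CharZero k] {p : ℙ k (PluckerSpace k V)}
    {a : PluckerSpace k V} (ha : IsPt k p a) (hp : p ∈ fixedLocus k V) : phiLin k V a = 0 :=
  triple_eq_zero_of_invariant fun g => by rw [← phiLin_actPluckerLin, hp.2 g a ha]

theorem diagVec_mem_fixedLocus {p : ℙ k (PluckerSpace k V)} {x : V} (h : IsPt k p (diagVec x)) :
    p ∈ fixedLocus k V := by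
  refine ⟨⟨_, h⟩, fun g v hv => ?_⟩
  obtain ⟨c, -, rfl⟩ := h.exists_smul_eq hv
  rw [map_smul, actPluckerLin_diagVec]

theorem IsPt.exists_diagVec [CharZero k] [FiniteDimensional k V] {p : ℙ k (PluckerSpace k V)}
    {a : PluckerSpace k V} (ha : IsPt k p a) (hp : p ∈ grassmannian k V) (h : phiLin k V a = 0) :
    ∃ x, IsPt k p (diagVec x) := by
  obtain ⟨f, hf⟩ := exists_diagForm_ne_zero ha.ne_zero h
  refine ⟨firstRow f a 0, ?_⟩
  rw [← (ha.pluckerRelations hp).diagForm_smul_eq_diagVec h f]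
  exact ha.smul hf

theorem exists_isPt_diagVec_of_mem_fixedLocus [CharZero k] [FiniteDimensional k V]
    {p : ℙ k (PluckerSpace k V)} (hp : p ∈ fixedLocus k V) : ∃ x, IsPt k p (diagVec x) :=
  (isPt_rep p).exists_diagVec hp.1 (phiLin_eq_zero_of_mem_fixedLocus (isPt_rep p) hp)

end FixedLocus

/-! ### The points of the closure of the graph -/

section ClosureOfGraph

variable {k : Type*} [Field k] {V : Type*} [AddCommGroup V] [Module k V]

variable (k V) in
/-- The linear map that sends a triple to its `i`-th component. -/
abbrev tripleProj (i : Fin 3) : Triple k V →ₗ[k] ⋀[k]^2 V := LinearMap.proj i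

variable (k V) in
/-- The graph of `X ∖ Z_G → ℙ (S²k² ⊗ ⋀²V)`, `[A] ↦ [Phi A]`. -/
def graph : Set (ℙ k (PluckerSpace k V) × ℙ k (Triple k V)) :=
  {w | w.1 ∉ fixedLocus k V ∧
    ∃ A : Matrix (Fin 2) (Fin 2) V, IsPt k w.1 (pluckerVec k A) ∧ IsPt k w.2 (Phi k A)}

theorem zariskiClosure_blowUp : zariskiClosure k (blowUp k V) = blowUp k V := zariskiClosure_idem _

variable (k V) in
/-- The pairs `([diag(x, x)], [x ∧ u, x ∧ w, x ∧ v])`. -/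
def exceptionalPairs : Set (ℙ k (PluckerSpace k V) × ℙ k (Triple k V)) :=
  {w | ∃ (x : V) (τ : Fin 3 → V), IsPt k w.1 (diagVec x) ∧ IsPt k w.2 fun i => wedge k x (τ i)}

theorem mem_graph [CharZero k] {w : ℙ k (PluckerSpace k V) × ℙ k (Triple k V)}
    {A : Matrix (Fin 2) (Fin 2) V} (h1 : IsPt k w.1 (pluckerVec k A)) (h2 : IsPt k w.2 (Phi k A)) :
    w ∈ graph k V :=
  ⟨fun h => h2.ne_zero (by rw [← phiLin_pluckerVec, phiLin_eq_zero_of_mem_fixedLocus h1 h]), A, h1,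
    h2⟩

theorem pluckerVec_ne_zero_of_Phi_ne_zero {A : Matrix (Fin 2) (Fin 2) V} (h : Phi k A ≠ 0) :
    pluckerVec k A ≠ 0 := fun h0 => h (by rw [← phiLin_pluckerVec, h0, map_zero])

/-- The curve `s ↦ famMatrix x τ s` passes through `diag(x, x)` at `s = 0`. Its image under `Phi` is
`s • famTriple x τ s`, so the limit of `[Phi]` at `s = 0` is `[x ∧ τ 0, x ∧ τ 1, x ∧ τ 2]`. -/
def famMatrix (x : V) (τ : Fin 3 → V) (s : k) : Matrix (Fin 2) (Fin 2) V :=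
  !![x, -(s • τ 2); s • τ 0, x + s • τ 1]

/-- The triple `Phi (famMatrix x τ s) / s`, continued to `s = 0`. -/
def famTriple (x : V) (τ : Fin 3 → V) (s : k) : Triple k V :=
  ![wedge k x (τ 0), wedge k x (τ 1) - s • wedge k (τ 2) (τ 0),
    wedge k x (τ 2) - s • wedge k (τ 2) (τ 1)]

theorem Phi_famMatrix (x : V) (τ : Fin 3 → V) (s : k) :
    Phi k (famMatrix x τ s) = s • famTriple x τ s := by
  funext i
  fin_cases i <;>
    simp [Phi, famMatrix, famTriple, wedge_add_right, wedge_smul_left, wedge_smul_right,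
      wedge_neg_left, wedge_swap (τ 2) x]
  · module
  · rw [wedge_swap x (τ 2)]; module

theorem famMatrix_zero (x : V) (τ : Fin 3 → V) :
    pluckerVec k (famMatrix x τ (0 : k)) = diagVec x := by
  simp [famMatrix, diagVec]

theorem famTriple_zero (x : V) (τ : Fin 3 → V) :
    famTriple x τ (0 : k) = fun i => wedge k x (τ i) := by
  funext i
  fin_cases i <;> simp [famTriple]

theorem isPolyMap_pluckerVec_famMatrix {N : Type*} [AddCommGroup N] [Module k N]
    [FiniteDimensional k V] {x : N → V} {τ : N → Fin 3 → V} {s : N → k} (hx : IsPolyMap k x)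
    (hτ : IsPolyMap k τ) (hs : s ∈ polyFun k N) :
    IsPolyMap k fun n => pluckerVec k (famMatrix (x n) (τ n) (s n)) := by
  have hτi : ∀ i, IsPolyMap k fun n => τ n i := fun i =>
    (IsPolyMap.linear (LinearMap.proj (φ := fun _ => V) i)).comp hτ
  refine IsPolyMap.bilin (wedgeBilin k (Row V)) (G := fun n => famMatrix (x n) (τ n) (s n) 0)
    (H := fun n => famMatrix (x n) (τ n) (s n) 1) ?_ ?_ <;> refine IsPolyMap.pi fun j => ?_ <;>
      fin_cases j
  · exact hx
  · exact (IsPolyMap.smul hs (hτi 2)).neg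
  · exact IsPolyMap.smul hs (hτi 0)
  · exact hx.add (IsPolyMap.smul hs (hτi 1))

theorem isPolyMap_famTriple {N : Type*} [AddCommGroup N] [Module k N]
    [FiniteDimensional k V] {x : N → V} {τ : N → Fin 3 → V} {s : N → k} (hx : IsPolyMap k x)
    (hτ : IsPolyMap k τ) (hs : s ∈ polyFun k N) :
    IsPolyMap k fun n => famTriple (x n) (τ n) (s n) := by
  have hτi : ∀ i, IsPolyMap k fun n => τ n i := fun i =>
    (IsPolyMap.linear (LinearMap.proj (φ := fun _ => V) i)).comp hτ
  have hw : ∀ {G H : N → V}, IsPolyMap k G → IsPolyMap k H →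
      IsPolyMap k fun n => wedge k (G n) (H n) := fun hG hH => hG.bilin (wedgeBilin k V) hH
  refine IsPolyMap.pi fun j => ?_
  fin_cases j
  · exact hw hx (hτi 0)
  · exact (hw hx (hτi 1)).sub (IsPolyMap.smul hs (hw (hτi 2) (hτi 0)))
  · exact (hw hx (hτi 2)).sub (IsPolyMap.smul hs (hw (hτi 2) (hτi 1)))

theorem apply_zero_of_polyFun_line [Infinite k] {g : k → k} (hg : g ∈ polyFun k k)
    (h : ∀ s, s ≠ 0 → g s = 0) : g 0 = 0 := by
  obtain ⟨P, hP⟩ : ∃ P : Polynomial k, ∀ s, g s = P.eval s := by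
    refine polyFun_induction (P := fun g : k → k => ∃ P : Polynomial k, ∀ s, g s = P.eval s)
      ?_ ?_ ?_ ?_ hg
    · intro l
      refine ⟨Polynomial.C (l 1) * Polynomial.X, fun s => ?_⟩
      rw [Polynomial.eval_mul, Polynomial.eval_C, Polynomial.eval_X, mul_comm, ← smul_eq_mul,
        ← map_smul, smul_eq_mul, mul_one]
    · exact fun c => ⟨Polynomial.C c, fun s => by simp⟩
    · rintro f g - - ⟨P, hP⟩ ⟨Q, hQ⟩
      exact ⟨P + Q, fun s => by simp [hP, hQ]⟩
    · rintro f g - - ⟨P, hP⟩ ⟨Q, hQ⟩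
      exact ⟨P * Q, fun s => by simp [hP, hQ]⟩
  have : Polynomial.X * P = 0 := Polynomial.funext fun s => by
    rw [Polynomial.eval_mul, Polynomial.eval_X, ← hP, Polynomial.eval_zero]
    by_cases hs : s = 0
    · rw [hs, zero_mul]
    · rw [h s hs, mul_zero]
  rw [hP, (mul_eq_zero.1 this).resolve_left Polynomial.X_ne_zero, Polynomial.eval_zero]

theorem exceptionalPairs_subset_blowUp [CharZero k] [FiniteDimensional k V] :
    exceptionalPairs k V ⊆ blowUp k V := by
  rintro w ⟨x, τ, h1, h2⟩ f hf hfΓ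
  rw [← famTriple_zero] at h2
  rw [← famMatrix_zero x τ] at h1
  refine vanishesAt_of_apply_eq_zero hf h1 h2 ?_
  obtain ⟨q, hq⟩ := not_forall.1 fun h =>
    h2.ne_zero ((Module.forall_dual_apply_eq_zero_iff k _).1 h)
  have hpoly : (fun s : k => q (famTriple x τ s) *
      f (pluckerVec k (famMatrix x τ s), famTriple x τ s)) ∈ polyFun k k := by
    have hs : (fun s : k => s) ∈ polyFun k k := dual_mem_polyFun (LinearMap.id : k →ₗ[k] k)
    have h2 := isPolyMap_famTriple (IsPolyMap.const x) (IsPolyMap.const τ) hs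
    exact mul_mem_polyFun (h2 q) (comp_mem_polyFun hf.1
      ((isPolyMap_pluckerVec_famMatrix (IsPolyMap.const x) (IsPolyMap.const τ) hs).prodMk h2))
  refine (mul_eq_zero.1 (apply_zero_of_polyFun_line (g := fun s => q (famTriple x τ s) *
    f (pluckerVec k (famMatrix x τ s), famTriple x τ s)) hpoly fun s hs => ?_)).resolve_left hq
  by_cases h0 : famTriple x τ s = 0
  · rw [h0, map_zero, zero_mul]
  have hPhi : Phi k (famMatrix x τ s) ≠ 0 := by
    rw [Phi_famMatrix]; exact smul_ne_zero hs h0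
  have hw : (Projectivization.mk k _ (pluckerVec_ne_zero_of_Phi_ne_zero hPhi),
      Projectivization.mk k _ h0) ∈
      graph k V :=
    mem_graph (isPt_mk _) (by rw [Phi_famMatrix]; exact (isPt_mk h0).smul hs)
  rw [hfΓ _ hw _ _ (isPt_mk _) (isPt_mk h0), mul_zero]

/-- Every point of the family lies on the closure of the graph. -/
theorem mem_blowUp_of_isPt_fam [CharZero k] [FiniteDimensional k V]
    {w : ℙ k (PluckerSpace k V) × ℙ k (Triple k V)} {x : V} {τ : Fin 3 → V} {s : k}
    (h1 : IsPt k w.1 (pluckerVec k (famMatrix x τ s))) (h2 : IsPt k w.2 (famTriple x τ s)) :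
    w ∈ blowUp k V := by
  by_cases hs : s = 0
  · subst hs
    rw [famMatrix_zero] at h1
    rw [famTriple_zero] at h2
    exact exceptionalPairs_subset_blowUp ⟨x, τ, h1, h2⟩
  · exact subset_zariskiClosure _ (mem_graph h1 (by rw [Phi_famMatrix]; exact h2.smul hs))

/-! ### Equations of the closure of the graph -/

/-- An equation of bidegree `(1, 1)` that holds on the graph holds on its closure. -/
theorem eq_of_mem_blowUp {N : Type*} [AddCommGroup N] [Module k N]
    {B B' : PluckerSpace k V → Triple k V → N}
    (hB : IsPolyMap k fun ab : PluckerSpace k V × Triple k V => B ab.1 ab.2)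
    (hB' : IsPolyMap k fun ab : PluckerSpace k V × Triple k V => B' ab.1 ab.2)
    (hom : ∀ (c d : k) a b, B (c • a) (d • b) = (c * d) • B a b)
    (hom' : ∀ (c d : k) a b, B' (c • a) (d • b) = (c * d) • B' a b)
    (h : ∀ A, B (pluckerVec k A) (Phi k A) = B' (pluckerVec k A) (Phi k A))
    {w : ℙ k (PluckerSpace k V) × ℙ k (Triple k V)} (hw : w ∈ blowUp k V)
    {a : PluckerSpace k V} {b : Triple k V} (ha : IsPt k w.1 a) (hb : IsPt k w.2 b) :
    B a b = B' a b := by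
  refine sub_eq_zero.1 ((Module.forall_dual_apply_eq_zero_iff k _).1 fun φ => ?_)
  have hf : IsBihomog k fun ab : PluckerSpace k V × Triple k V =>
      φ (B ab.1 ab.2 - B' ab.1 ab.2) := by
    refine ⟨(hB.sub hB') φ, 1, 1, fun c d a b => ?_⟩
    simp only [hom, hom', ← smul_sub, map_smul, smul_eq_mul, pow_one]
  refine hw _ hf ?_ a b ha hb
  rintro s ⟨-, A, hA1, hA2⟩
  refine vanishesAt_of_apply_eq_zero hf hA1 hA2 ?_
  simp only [h, sub_self, map_zero]

theorem fst_mem_grassmannian_of_mem_blowUp [CharZero k] [FiniteDimensional k V]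
    {w : ℙ k (PluckerSpace k V) × ℙ k (Triple k V)} (hw : w ∈ blowUp k V) :
    w.1 ∈ grassmannian k V := by
  refine (isPt_rep w.1).mem_grassmannian fun f g => ?_
  refine sub_eq_zero.1 ((Module.forall_dual_apply_eq_zero_iff k _).1 fun φ => ?_)
  have hf : IsBihomog k fun ab : PluckerSpace k V × Triple k V =>
      φ (g (contract f ab.1) • ab.1 - wedge k (contract f ab.1) (contract g ab.1)) := by
    have h1 : ∀ f : Module.Dual k (Row V),
        IsPolyMap k fun ab : PluckerSpace k V × Triple k V => contract f ab.1 :=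
      fun f => IsPolyMap.linear_fst (contract f)
    refine ⟨((IsPolyMap.smul (h1 f g) (IsPolyMap.linear_fst LinearMap.id)).sub
      ((h1 f).bilin (wedgeBilin k (Row V)) (h1 g))) φ, 2, 0, fun c d a b => ?_⟩
    have e : g (contract f (c • a)) • c • a - wedge k (contract f (c • a)) (contract g (c • a)) =
        (c ^ 2 * d ^ 0) • (g (contract f a) • a - wedge k (contract f a) (contract g a)) := by
      simp only [map_smul, wedge_smul_left, wedge_smul_right, smul_eq_mul]
      module
    change φ (g (contract f (c • a)) • c • a -
      wedge k (contract f (c • a)) (contract g (c • a))) = _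
    rw [e, map_smul, smul_eq_mul]
  refine hw _ hf ?_ w.1.rep w.2.rep (isPt_rep _) (isPt_rep _)
  rintro s ⟨-, A, hA1, hA2⟩
  refine vanishesAt_of_apply_eq_zero hf hA1 hA2 ?_
  change φ (g (contract f (pluckerVec k A)) • pluckerVec k A - _) = 0
  rw [pluckerRelations_pluckerVec k V A f g, sub_self, map_zero]

section Equations

variable {w : ℙ k (PluckerSpace k V) × ℙ k (Triple k V)}
  {a : PluckerSpace k V} {b : Triple k V}

/-- `Phi A` is proportional to the second component of a point of the closure of the graph. -/
theorem apply_smul_phiLin_of_mem_blowUp (hw : w ∈ blowUp k V)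
    (ha : IsPt k w.1 a) (hb : IsPt k w.2 b) (q : Module.Dual k (Triple k V)) :
    q b • phiLin k V a = q (phiLin k V a) • b := by
  refine eq_of_mem_blowUp (B := fun a b => q b • phiLin k V a)
    (B' := fun a b => q (phiLin k V a) • b)
    (IsPolyMap.smul (dual_snd_mem_polyFun q)
      (IsPolyMap.linear_fst (phiLin k V)))
    (IsPolyMap.smul (dual_fst_mem_polyFun (q ∘ₗ phiLin k V))
      (IsPolyMap.linear_snd LinearMap.id))
    ?_ ?_ (fun A => ?_) hw ha hb
  · intro c d a b
    simp only [map_smul, smul_eq_mul]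
    module
  · intro c d a b
    simp only [map_smul, smul_eq_mul]
    module
  · simp only [phiLin_pluckerVec]

theorem isPolyMap_wedge_firstRow [FiniteDimensional k V] (f : Module.Dual k V) (i : Fin 2)
    (j : Fin 3) :
    IsPolyMap k fun ab : PluckerSpace k V × Triple k V =>
      wedge k (firstRow f ab.1 i) (contract f (ab.2 j)) :=
  (IsPolyMap.linear_fst (rowProj k V i ∘ₗ firstRow f)).bilin (wedgeBilin k V)
    (IsPolyMap.linear_snd (contract f ∘ₗ tripleProj k V j))

theorem diagForm_smul_zero_of_mem_blowUp [FiniteDimensional k V] (hw : w ∈ blowUp k V)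
    (ha : IsPt k w.1 a) (hb : IsPt k w.2 b) (f : Module.Dual k V) :
    diagForm f a • b 0 = wedge k (firstRow f a 0) (contract f (b 0)) := by
  refine eq_of_mem_blowUp (B := fun a b => diagForm f a • b 0)
    (B' := fun a b => wedge k (firstRow f a 0) (contract f (b 0)))
    (IsPolyMap.smul (dual_fst_mem_polyFun (diagForm f))
      (IsPolyMap.linear_snd (tripleProj k V 0)))
    (isPolyMap_wedge_firstRow f 0 0) ?_ ?_ (fun A => ?_) hw ha hb
  · intro c d a b
    simp only [map_smul, Pi.smul_apply, smul_eq_mul]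
    module
  · intro c d a b
    simp only [map_smul, Pi.smul_apply, wedge_smul_left, wedge_smul_right]
    module
  · rw [pluckerVec_eq, diagForm_wedge, firstRow_wedge]
    simp [Phi, wedge_sub_left, wedge_sub_right, wedge_smul_left,
      wedge_smul_right, wedge_swap (A 0 0) (A 1 0)]
    module

theorem diagForm_smul_one_of_mem_blowUp [FiniteDimensional k V] (hw : w ∈ blowUp k V)
    (ha : IsPt k w.1 a) (hb : IsPt k w.2 b) (f : Module.Dual k V) :
    diagForm f a • b 1 = wedge k (firstRow f a 0) (contract f (b 1)) +
      wedge k (firstRow f a 1) (contract f (b 0)) := by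
  refine eq_of_mem_blowUp (B := fun a b => diagForm f a • b 1)
    (B' := fun a b => wedge k (firstRow f a 0) (contract f (b 1)) +
      wedge k (firstRow f a 1) (contract f (b 0)))
    (IsPolyMap.smul (dual_fst_mem_polyFun (diagForm f))
      (IsPolyMap.linear_snd (tripleProj k V 1)))
    ((isPolyMap_wedge_firstRow f 0 1).add (isPolyMap_wedge_firstRow f 1 0)) ?_ ?_
    (fun A => ?_) hw ha hb
  · intro c d a b
    simp only [map_smul, Pi.smul_apply, smul_eq_mul]
    module
  · intro c d a b
    simp only [map_smul, Pi.smul_apply, wedge_smul_left, wedge_smul_right]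
    module
  · rw [pluckerVec_eq, diagForm_wedge, firstRow_wedge]
    simp [Phi, wedge_sub_left, wedge_sub_right, wedge_add_right, wedge_smul_left,
      wedge_smul_right, wedge_swap (A 0 0) (A 1 0), wedge_swap (A 0 0) (A 0 1),
      wedge_swap (A 0 0) (A 1 1), wedge_swap (A 1 0) (A 1 1), wedge_swap (A 0 1) (A 1 0)]
    module

theorem diagForm_smul_two_of_mem_blowUp [FiniteDimensional k V] (hw : w ∈ blowUp k V)
    (ha : IsPt k w.1 a) (hb : IsPt k w.2 b) (f : Module.Dual k V) :
    diagForm f a • b 2 = wedge k (firstRow f a 0) (contract f (b 2)) +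
      wedge k (firstRow f a 1) (contract f (b 1)) := by
  refine eq_of_mem_blowUp (B := fun a b => diagForm f a • b 2)
    (B' := fun a b => wedge k (firstRow f a 0) (contract f (b 2)) +
      wedge k (firstRow f a 1) (contract f (b 1)))
    (IsPolyMap.smul (dual_fst_mem_polyFun (diagForm f))
      (IsPolyMap.linear_snd (tripleProj k V 2)))
    ((isPolyMap_wedge_firstRow f 0 2).add (isPolyMap_wedge_firstRow f 1 1)) ?_ ?_
    (fun A => ?_) hw ha hb
  · intro c d a b
    simp only [map_smul, Pi.smul_apply, smul_eq_mul]
    module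
  · intro c d a b
    simp only [map_smul, Pi.smul_apply, wedge_smul_left, wedge_smul_right]
    module
  · rw [pluckerVec_eq, diagForm_wedge, firstRow_wedge]
    simp [Phi, wedge_sub_left, wedge_sub_right, wedge_add_right, wedge_smul_left,
      wedge_smul_right, wedge_swap (A 0 1) (A 1 1), wedge_swap (A 0 0) (A 0 1),
      wedge_swap (A 0 0) (A 1 1), wedge_swap (A 1 0) (A 1 1), wedge_swap (A 0 1) (A 1 0)]
    module

end Equations

end ClosureOfGraph

/-! ### Description of the closure of the graph and of the exceptional divisor -/

section Description

variable {k : Type*} [Field k] {V : Type*} [AddCommGroup V] [Module k V]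

theorem vec_wedge_eq (x u w v : V) :
    ![wedge k x u, wedge k x w, wedge k x v] = fun i => wedge k x (![u, w, v] i) := by
  funext i
  fin_cases i <;> rfl

theorem mem_blowUp_iff [CharZero k] [FiniteDimensional k V]
    {w : ℙ k (PluckerSpace k V) × ℙ k (Triple k V)} :
    w ∈ blowUp k V ↔ w ∈ graph k V ∨ w ∈ exceptionalPairs k V := by
  refine ⟨fun hw => ?_, fun h => h.elim (fun h => subset_zariskiClosure _ h)
    fun h => exceptionalPairs_subset_blowUp h⟩
  have ha := isPt_rep w.1
  have hb := isPt_rep w.2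
  have hX := fst_mem_grassmannian_of_mem_blowUp hw
  by_cases h : phiLin k V w.1.rep = 0
  · right
    obtain ⟨f, hf⟩ := exists_diagForm_ne_zero ha.ne_zero h
    refine ⟨firstRow f w.1.rep 0, fun i => contract f (w.2.rep i), ?_, ?_⟩
    · rw [← (ha.pluckerRelations hX).diagForm_smul_eq_diagVec h f]
      exact ha.smul hf
    · have e : (fun i => wedge k (firstRow f w.1.rep 0) (contract f (w.2.rep i))) =
          diagForm f w.1.rep • w.2.rep := by
        have h1 : firstRow f w.1.rep 1 = 0 := by rw [firstRow_one, h]; simp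
        funext i
        rw [Pi.smul_apply]
        fin_cases i
        · exact (diagForm_smul_zero_of_mem_blowUp hw ha hb f).symm
        · exact ((diagForm_smul_one_of_mem_blowUp hw ha hb f).trans (by rw [h1]; simp)).symm
        · exact ((diagForm_smul_two_of_mem_blowUp hw ha hb f).trans (by rw [h1]; simp)).symm
      rw [e]
      exact hb.smul hf
  · left
    obtain ⟨A, hA⟩ := exists_eq_pluckerVec ha.ne_zero (ha.pluckerRelations hX)
    obtain ⟨q, hq⟩ := not_forall.1 fun h =>
      hb.ne_zero ((Module.forall_dual_apply_eq_zero_iff k _).1 h)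
    have e := apply_smul_phiLin_of_mem_blowUp hw ha hb q
    have hc : q (phiLin k V w.1.rep) ≠ 0 := fun h0 => by
      rw [h0, zero_smul] at e
      exact h ((smul_eq_zero.1 e).resolve_left hq)
    have e' : phiLin k V w.1.rep = ((q w.2.rep)⁻¹ * q (phiLin k V w.1.rep)) • w.2.rep := by
      rw [mul_smul, ← e, smul_smul, inv_mul_cancel₀ hq, one_smul]
    have h2 := hb.smul (mul_ne_zero (inv_ne_zero hq) hc)
    rw [← e', hA, phiLin_pluckerVec] at h2
    exact mem_graph (hA ▸ ha) h2

theorem exceptionalDivisor_eq [CharZero k] [FiniteDimensional k V] :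
    exceptionalDivisor k V = exceptionalPairs k V := by
  ext w
  refine ⟨fun h => (mem_blowUp_iff.1 h.1).resolve_left fun h' => h'.1 h.2, fun h => ?_⟩
  refine ⟨exceptionalPairs_subset_blowUp h, ?_⟩
  obtain ⟨x, τ, hx, -⟩ := h
  exact diagVec_mem_fixedLocus hx

theorem mem_exceptionalPairs_iff {w : ℙ k (PluckerSpace k V) × ℙ k (Triple k V)} :
    w ∈ exceptionalPairs k V ↔ ∃ x u w' v : V, IsPt k w.1 (pluckerVec k !![x, 0; 0, x]) ∧
      IsPt k w.2 ![wedge k x u, wedge k x w', wedge k x v] := by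
  constructor
  · rintro ⟨x, τ, h1, h2⟩
    refine ⟨x, τ 0, τ 1, τ 2, h1, ?_⟩
    have e : ![τ 0, τ 1, τ 2] = τ := by
      funext i
      fin_cases i <;> rfl
    rw [vec_wedge_eq, e]
    exact h2
  · rintro ⟨x, u, w', v, h1, h2⟩
    rw [vec_wedge_eq] at h2
    exact ⟨x, _, h1, h2⟩

theorem wedgeCondition_iff {A : Matrix (Fin 2) (Fin 2) V} {t : Triple k V} :
    WedgeCondition k A t ↔ ∀ i,
      ExteriorAlgebra.ι k (A i 0) * (t 0).1 = 0 ∧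
      ExteriorAlgebra.ι k (A i 0) * (t 1).1 + ExteriorAlgebra.ι k (A i 1) * (t 0).1 = 0 ∧
      ExteriorAlgebra.ι k (A i 0) * (t 2).1 + ExteriorAlgebra.ι k (A i 1) * (t 1).1 = 0 ∧
      ExteriorAlgebra.ι k (A i 1) * (t 2).1 = 0 := by
  rw [WedgeCondition, ← Matrix.ext_iff]
  refine forall_congr' fun i => ?_
  simp [Fin.forall_fin_succ, Matrix.mul_apply, Fin.sum_univ_two]

theorem ι_mul_ι_mul_self (x : V) (c : ExteriorAlgebra k V) :
    ExteriorAlgebra.ι k x * (ExteriorAlgebra.ι k x * c) = 0 := by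
  rw [← mul_assoc, ExteriorAlgebra.ι_sq_zero, zero_mul]

theorem ι_mul_ι_swap (x y : V) (c : ExteriorAlgebra k V) :
    ExteriorAlgebra.ι k y * (ExteriorAlgebra.ι k x * c) =
      -(ExteriorAlgebra.ι k x * (ExteriorAlgebra.ι k y * c)) := by
  rw [← mul_assoc, ← mul_assoc, ← neg_mul]
  congr 1
  exact eq_neg_of_add_eq_zero_right (ExteriorAlgebra.ι_add_mul_swap x y)

theorem wedgeCondition_Phi (A : Matrix (Fin 2) (Fin 2) V) : WedgeCondition k A (Phi k A) := by
  have h (x y : V) : ExteriorAlgebra.ι k x * (ExteriorAlgebra.ι k y * ExteriorAlgebra.ι k x) =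
      0 := by
    rw [ι_mul_ι_swap, ExteriorAlgebra.ι_sq_zero, mul_zero, neg_zero]
  have h' (x y : V) : ExteriorAlgebra.ι k x * (ExteriorAlgebra.ι k x * ExteriorAlgebra.ι k y) =
      0 := ι_mul_ι_mul_self x _
  rw [wedgeCondition_iff]
  intro i
  fin_cases i
  · simp [Phi, wedge_coe, mul_add, h']
    rw [ι_mul_ι_swap (A 0 0) (A 0 1) (ExteriorAlgebra.ι k (A 1 0)),
      ι_mul_ι_swap (A 0 0) (A 0 1) (ExteriorAlgebra.ι k (A 1 1))]
    simp
  · simp [Phi, wedge_coe, mul_add, h]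
    rw [ι_mul_ι_swap (A 0 0) (A 1 0) (ExteriorAlgebra.ι k (A 1 1)),
      ι_mul_ι_swap (A 0 0) (A 1 1) (ExteriorAlgebra.ι k (A 1 0)),
      ι_mul_ι_swap (A 0 1) (A 1 0) (ExteriorAlgebra.ι k (A 1 1)),
      ι_mul_ι_swap (A 0 1) (A 1 1) (ExteriorAlgebra.ι k (A 1 0))]
    have e := ExteriorAlgebra.ι_add_mul_swap (R := k) (A 1 0) (A 1 1)
    constructor
    · rw [← neg_add, ← mul_add, e, mul_zero, neg_zero]
    · rw [add_comm, ← neg_add, ← mul_add, add_comm, e, mul_zero, neg_zero]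

theorem blowUp_eq_setOf_wedgeCondition [CharZero k] [FiniteDimensional k V] :
    blowUp k V = {w | ∃ (A : Matrix (Fin 2) (Fin 2) V) (t : Triple k V),
      IsPt k w.1 (pluckerVec k A) ∧ IsPt k w.2 t ∧
      Phi k A ∈ Submodule.span k {t} ∧ WedgeCondition k A t} := by
  ext w
  rw [mem_blowUp_iff]
  constructor
  · rintro (⟨-, A, h1, h2⟩ | ⟨x, τ, h1, h2⟩)
    · exact ⟨A, _, h1, h2, Submodule.mem_span_singleton_self _, wedgeCondition_Phi A⟩
    · refine ⟨_, _, h1, h2, ?_, ?_⟩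
      · rw [← phiLin_pluckerVec]
        change phiLin k V (diagVec x) ∈ _
        rw [phiLin_diagVec]
        exact zero_mem _
      · rw [wedgeCondition_iff]
        intro i
        fin_cases i <;> simp [wedge_coe, ι_mul_ι_mul_self]
  · rintro ⟨A, t, h1, h2, h3, h4⟩
    obtain ⟨c, hc⟩ := Submodule.mem_span_singleton.1 h3
    by_cases h : phiLin k V (pluckerVec k A) = 0
    · right
      obtain ⟨f, hf⟩ := exists_diagForm_ne_zero h1.ne_zero h
      have hx : IsPt k w.1 (diagVec (firstRow f (pluckerVec k A) 0)) := by
        rw [← (pluckerRelations_pluckerVec k V A).diagForm_smul_eq_diagVec h f]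
        exact h1.smul hf
      refine ⟨_, fun i => contract f (t i), hx, ?_⟩
      -- `(x, 0)` is a linear combination of the rows of `A`
      have hr : f (A 1 1) • A 0 - f (A 0 1) • A 1 = firstRow f (pluckerVec k A) :=
        (firstRow_wedge f _ _).symm
      have hr0 : f (A 1 1) • A 0 0 - f (A 0 1) • A 1 0 = firstRow f (pluckerVec k A) 0 :=
        congrFun hr 0
      have hr1 : f (A 1 1) • A 0 1 - f (A 0 1) • A 1 1 = 0 := by
        refine (congrFun hr 1).trans ?_
        rw [firstRow_one, h]
        simp
      have key : ∀ i, ExteriorAlgebra.ι k (firstRow f (pluckerVec k A) 0) *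
          (t i : ExteriorAlgebra k V) = 0 := by
        obtain ⟨p0, p1, p2, -⟩ := wedgeCondition_iff.1 h4 0
        obtain ⟨q0, q1, q2, -⟩ := wedgeCondition_iff.1 h4 1
        intro i
        have comb : ∀ c d : ExteriorAlgebra k V,
            ExteriorAlgebra.ι k (A 0 0) * c + ExteriorAlgebra.ι k (A 0 1) * d = 0 →
            ExteriorAlgebra.ι k (A 1 0) * c + ExteriorAlgebra.ι k (A 1 1) * d = 0 →
            ExteriorAlgebra.ι k (firstRow f (pluckerVec k A) 0) * c = 0 := by
          intro c d e0 e1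
          have : ExteriorAlgebra.ι k (f (A 1 1) • A 0 0 - f (A 0 1) • A 1 0) * c +
              ExteriorAlgebra.ι k (f (A 1 1) • A 0 1 - f (A 0 1) • A 1 1) * d =
              f (A 1 1) • (ExteriorAlgebra.ι k (A 0 0) * c + ExteriorAlgebra.ι k (A 0 1) * d) -
              f (A 0 1) • (ExteriorAlgebra.ι k (A 1 0) * c +
                ExteriorAlgebra.ι k (A 1 1) * d) := by
            simp only [map_sub, map_smul, sub_mul, smul_mul_assoc, smul_add]
            abel
          rw [e0, e1, hr0, hr1] at this
          simpa using this
        fin_cases i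
        · exact comb _ 0 (by rw [mul_zero, add_zero]; exact p0)
            (by rw [mul_zero, add_zero]; exact q0)
        · exact comb _ _ p1 q1
        · exact comb _ _ p2 q2
      have e : (fun i => wedge k (firstRow f (pluckerVec k A) 0) (contract f (t i))) =
          f (firstRow f (pluckerVec k A) 0) • t := by
        funext i
        exact (smul_eq_wedge_contract_of_ι_mul_eq_zero (key i) f).symm
      rw [e, apply_firstRow_zero]
      exact h2.smul hf
    · left
      rw [phiLin_pluckerVec] at h
      refine mem_graph h1 ?_
      rw [← hc]
      exact h2.smul fun h0 => h (by rw [← hc, h0, zero_smul])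

/-! ### The group action -/

theorem act_one (w : ℙ k (PluckerSpace k V) × ℙ k (Triple k V)) : act k V 1 w = w := by
  refine Prod.ext ?_ ?_
  · refine ((isPt_rep w.1).map _ (actPluckerLin_injective k V 1)).eq ?_
    rw [actPluckerLin_one]
    exact isPt_rep w.1
  · refine ((isPt_rep w.2).map _ (actTripleLin_injective k V 1)).eq ?_
    rw [actTripleLin_one]
    exact isPt_rep w.2

theorem act_mul (g h : Matrix.SpecialLinearGroup (Fin 2) k)
    (w : ℙ k (PluckerSpace k V) × ℙ k (Triple k V)) :
    act k V (g * h) w = act k V h (act k V g w) := by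
  refine Prod.ext ?_ ?_
  · refine ((isPt_rep w.1).map _ (actPluckerLin_injective k V (g * h))).eq ?_
    rw [actPluckerLin_mul]
    exact ((isPt_rep w.1).map _ (actPluckerLin_injective k V g)).map _
      (actPluckerLin_injective k V h)
  · refine ((isPt_rep w.2).map _ (actTripleLin_injective k V (g * h))).eq ?_
    rw [actTripleLin_mul]
    exact ((isPt_rep w.2).map _ (actTripleLin_injective k V g)).map _
      (actTripleLin_injective k V h)

theorem isPt_actPlucker_pluckerVec {p : ℙ k (PluckerSpace k V)} {A : Matrix (Fin 2) (Fin 2) V}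
    (h : IsPt k p (pluckerVec k A)) (g : Matrix.SpecialLinearGroup (Fin 2) k) :
    IsPt k (actPlucker k V g p) (pluckerVec k fun i => rowMul k g.1 (A i)) := by
  rw [← actPluckerLin_pluckerVec]
  exact h.map _ _

theorem actPlucker_mem_grassmannian (g : Matrix.SpecialLinearGroup (Fin 2) k)
    {p : ℙ k (PluckerSpace k V)} (hp : p ∈ grassmannian k V) :
    actPlucker k V g p ∈ grassmannian k V := by
  obtain ⟨A, hA⟩ := hp
  exact ⟨_, isPt_actPlucker_pluckerVec hA g⟩

theorem act_mem_blowUp [CharZero k] [FiniteDimensional k V]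
    (g : Matrix.SpecialLinearGroup (Fin 2) k) {w : ℙ k (PluckerSpace k V) × ℙ k (Triple k V)}
    (hw : w ∈ blowUp k V) : act k V g w ∈ blowUp k V := by
  rw [mem_blowUp_iff] at hw ⊢
  obtain ⟨-, A, h1, h2⟩ | ⟨x, τ, h1, h2⟩ := hw
  · left
    refine mem_graph (isPt_actPlucker_pluckerVec h1 g) ?_
    rw [← actTripleLin_Phi]
    exact h2.map _ (actTripleLin_injective k V g)
  · right
    refine ⟨x, rowMul k (symSq k g.1) τ, ?_, ?_⟩
    · rw [← actPluckerLin_diagVec g]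
      exact h1.map _ (actPluckerLin_injective k V g)
    · have e : (fun i => wedge k x (rowMul k (symSq k g.1) τ i)) =
          actTripleLin k V g fun i => wedge k x (τ i) := by
        funext i
        simp only [actTripleLin, rowMul_apply, ← wedgeBilin_apply, map_sum, map_smul]
      rw [e]
      exact h2.map _ (actTripleLin_injective k V g)

end Description

/-! ### The isomorphism `P(V) ≅ Z_G` and the bundle structure of the exceptional divisor -/

section RationalMaps

variable {k : Type*} [Field k]
variable {E : Type*} [AddCommGroup E] [Module k E]
variable {F : Type*} [AddCommGroup F] [Module k F]
variable {E' : Type*} [AddCommGroup E'] [Module k E']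

open Classical in
/-- The map of projective spaces given by a bihomogeneous map `G`. It takes the value `d` where `G`
vanishes. -/
def ratMap (G : E → F → E') (d : ℙ k E') (w : ℙ k E × ℙ k F) : ℙ k E' :=
  if h : G w.1.rep w.2.rep ≠ 0 then Projectivization.mk k _ h else d

theorem isPt_ratMap {G : E → F → E'} {d : ℙ k E'} {m n : ℕ}
    (hG : ∀ (c c' : k) a b, G (c • a) (c' • b) = (c ^ m * c' ^ n) • G a b)
    {w : ℙ k E × ℙ k F} {a : E} {b : F} (ha : IsPt k w.1 a) (hb : IsPt k w.2 b)
    (h : G a b ≠ 0) : IsPt k (ratMap G d w) (G a b) := by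
  obtain ⟨c, hc, hc'⟩ := ha.exists_smul_eq (isPt_rep w.1)
  obtain ⟨e, he, he'⟩ := hb.exists_smul_eq (isPt_rep w.2)
  have hs : c ^ m * e ^ n ≠ 0 := mul_ne_zero (pow_ne_zero _ hc) (pow_ne_zero _ he)
  have hrep : G w.1.rep w.2.rep = (c ^ m * e ^ n) • G a b := by rw [hc', he', hG]
  have h0 : G w.1.rep w.2.rep ≠ 0 := by rw [hrep]; exact smul_ne_zero hs h
  rw [ratMap, dif_pos h0]
  have := (isPt_mk (k := k) h0).smul (inv_ne_zero hs)
  have e' : (c ^ m * e ^ n)⁻¹ • G w.1.rep w.2.rep = G a b := by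
    rw [hrep, smul_smul, inv_mul_cancel₀ hs, one_smul]
  rwa [e'] at this

theorem isBiregular_ratMap {G : E → F → E'} {d : ℙ k E'} {m n : ℕ}
    (hG : ∀ (c c' : k) a b, G (c • a) (c' • b) = (c ^ m * c' ^ n) • G a b)
    (hpoly : IsPolyMap k fun ab : E × F => G ab.1 ab.2) {S : Set (ℙ k E × ℙ k F)}
    (hS : ∀ w ∈ S, ∀ a b, IsPt k w.1 a → IsPt k w.2 b → G a b ≠ 0) :
    IsBiregular k S (ratMap G d) := fun s hs =>
  ⟨fun ab => G ab.1 ab.2, hpoly, ⟨m, n, hG⟩, hS s hs,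
    fun _ _ _ _ ha hb h => isPt_ratMap hG ha hb h⟩

end RationalMaps

section Bundle

variable {k : Type*} [Field k] {V : Type*} [AddCommGroup V] [Module k V]

theorem isPolyMap_diagVec [FiniteDimensional k V] : IsPolyMap k (diagVec (k := k) (V := V)) := by
  have := isPolyMap_pluckerVec_famMatrix (k := k) (N := V) (x := fun x => x) (τ := fun _ => 0)
    (s := fun _ => 0) (IsPolyMap.linear LinearMap.id) (IsPolyMap.const 0) (const_mem_polyFun 0)
  simpa only [famMatrix_zero] using this

/-- The map `P(V) → Z_G`, `[x] ↦ [diag(x, x)]`. -/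
def diagPoint (p : ℙ k V) : ℙ k (PluckerSpace k V) :=
  Projectivization.mk k (diagVec p.rep) (diagVec_ne_zero p.rep_nonzero)

theorem isPt_diagPoint {p : ℙ k V} {x : V} (hx : IsPt k p x) :
    IsPt k (diagPoint p) (diagVec x) := by
  obtain ⟨c, hc, rfl⟩ := (isPt_rep p).exists_smul_eq hx
  rw [diagVec_smul]
  exact (isPt_mk _).smul (mul_ne_zero hc hc)

theorem range_diagPoint [CharZero k] [FiniteDimensional k V] :
    Set.range (diagPoint (k := k) (V := V)) = fixedLocus k V := by
  ext P
  constructor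
  · rintro ⟨p, rfl⟩
    exact diagVec_mem_fixedLocus (isPt_diagPoint (isPt_rep p))
  · intro hP
    obtain ⟨x, hx⟩ := exists_isPt_diagVec_of_mem_fixedLocus hP
    have hx0 : x ≠ 0 := by
      rintro rfl
      refine hx.ne_zero ?_
      rw [← zero_smul k (0 : V), diagVec_smul, zero_mul, zero_smul]
    exact ⟨Projectivization.mk k x hx0, (isPt_diagPoint (isPt_mk hx0)).eq hx⟩

/-- The inverse of `diagPoint` is given by the linear maps `a ↦ firstRow f a 0`. -/
theorem isPt_firstRow {p : ℙ k V} {a : PluckerSpace k V} (ha : IsPt k (diagPoint p) a)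
    {f : Module.Dual k V} (h : firstRow f a 0 ≠ 0) : IsPt k p (firstRow f a 0) := by
  obtain ⟨c, hc, rfl⟩ := (isPt_diagPoint (isPt_rep p)).exists_smul_eq ha
  have e : firstRow f (c • diagVec p.rep) 0 = (c * f p.rep) • p.rep := by
    rw [map_smul, firstRow_diagVec]
    simp [smul_smul]
  rw [e] at h ⊢
  exact (isPt_rep p).smul (smul_ne_zero_iff.1 h).1

theorem exists_diagForm_ne_zero_of_mem_fixedLocus [CharZero k] [FiniteDimensional k V]
    {p : ℙ k (PluckerSpace k V)} (hp : p ∈ fixedLocus k V) :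
    ∃ f : Module.Dual k V, ∀ a, IsPt k p a → diagForm f a ≠ 0 := by
  obtain ⟨f, hf⟩ := exists_diagForm_ne_zero (isPt_rep p).ne_zero
    (phiLin_eq_zero_of_mem_fixedLocus (isPt_rep p) hp)
  refine ⟨f, fun a ha => ?_⟩
  obtain ⟨c, hc, rfl⟩ := (isPt_rep p).exists_smul_eq ha
  rw [map_smul]
  exact smul_ne_zero hc hf

theorem firstRow_ne_zero {f : Module.Dual k V} {a : PluckerSpace k V} (h : diagForm f a ≠ 0) :
    firstRow f a 0 ≠ 0 := fun h0 => h (by rw [← apply_firstRow_zero, h0, map_zero])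

theorem diagPoint_injective [CharZero k] [FiniteDimensional k V] :
    Function.Injective (diagPoint (k := k) (V := V)) := by
  intro p p' h
  have hp : diagPoint p ∈ fixedLocus k V := by rw [← range_diagPoint]; exact ⟨p, rfl⟩
  obtain ⟨f, hf⟩ := exists_diagForm_ne_zero_of_mem_fixedLocus hp
  have h0 := firstRow_ne_zero (hf _ (isPt_rep _))
  exact (isPt_firstRow (isPt_rep _) h0).eq (isPt_firstRow (h ▸ isPt_rep (diagPoint p)) h0)

theorem exists_inverse_diagPoint [CharZero k] [FiniteDimensional k V] [Nontrivial V] :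
    ∃ (ν : ℙ k V → ℙ k (PluckerSpace k V)) (κ : ℙ k (PluckerSpace k V) → ℙ k V),
      (∀ p x, IsPt k p x → IsPt k (ν p) (pluckerVec k !![x, 0; 0, x])) ∧
      Set.range ν = fixedLocus k V ∧ (∀ p, κ (ν p) = p) ∧
      IsRegular k Set.univ ν ∧ IsRegular k (fixedLocus k V) κ := by
  have hinv : ∀ p : ℙ k V, Function.invFun diagPoint (diagPoint p) = p :=
    Function.leftInverse_invFun diagPoint_injective
  refine ⟨diagPoint, Function.invFun diagPoint, fun p x hx => isPt_diagPoint hx, range_diagPoint,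
    hinv, fun p _ => ?_, fun P hP => ?_⟩
  · refine ⟨diagVec, isPolyMap_diagVec, ⟨2, fun c a => ?_⟩, fun a ha => diagVec_ne_zero ha.ne_zero,
      fun p _ a ha _ => isPt_diagPoint ha⟩
    rw [diagVec_smul, pow_two]
  · obtain ⟨f, hf⟩ := exists_diagForm_ne_zero_of_mem_fixedLocus hP
    refine ⟨fun a => firstRow f a 0, IsPolyMap.linear (rowProj k V 0 ∘ₗ firstRow f),
      ⟨1, fun c a => ?_⟩, fun a ha => firstRow_ne_zero (hf a ha), fun Q hQ a ha h => ?_⟩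
    · simp only [map_smul, pow_one, Pi.smul_apply]
    · rw [← range_diagPoint] at hQ
      obtain ⟨p, rfl⟩ := hQ
      rw [hinv]
      exact isPt_firstRow ha h

theorem contract_wedge_of_apply_eq_zero {f : Module.Dual k V} {y : V} (hy : f y = 0) (x : V) :
    contract f (wedge k x y) = f x • y := by
  rw [contract_wedge, hy, zero_smul, sub_zero]

/-- Where the linear form `f` on `P(V)` does not vanish, the points of the exceptional divisor over
`[x]` are uniquely of the form `[x ∧ τ 0, x ∧ τ 1, x ∧ τ 2]` with `[τ] ∈ P((ker f)³)`. -/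
theorem isProjectiveBundle_exceptionalDivisor [CharZero k] (hV : Module.finrank k V = 3) :
    IsProjectiveBundle k 5 (exceptionalDivisor k V) (fixedLocus k V) := by
  have : FiniteDimensional k V := Module.finite_of_finrank_pos (by omega)
  refine ⟨fun w hw => hw.2, fun z hz => ?_⟩
  obtain ⟨f, hf⟩ := exists_diagForm_ne_zero_of_mem_fixedLocus hz
  refine ⟨diagForm f, ⟨dual_mem_polyFun _, 1, fun c a => by rw [map_smul, pow_one, smul_eq_mul]⟩,
    hf, ?_⟩
  have hf0 : f ≠ 0 := by
    rintro rfl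
    refine hf _ (isPt_rep z) ?_
    rw [← apply_firstRow_zero, LinearMap.zero_apply]
  have hK : Module.finrank k (LinearMap.ker f) = 2 := by
    have := Module.Dual.finrank_ker_add_one_of_ne_zero hf0
    omega
  obtain ⟨e⟩ : Nonempty ((Fin (5 + 1) → k) ≃ₗ[k] (Fin 3 → LinearMap.ker f)) :=
    FiniteDimensional.nonempty_linearEquiv_of_finrank_eq (by
      rw [Module.finrank_fin_fun, Module.finrank_pi_fintype]
      simp [hK])
  let J : (Fin (5 + 1) → k) →ₗ[k] (Fin 3 → V) :=
    (LinearMap.ker f).subtype.compLeft (Fin 3) ∘ₗ e.toLinearMap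
  have hJ : ∀ c i, J c i = e c i := fun _ _ => rfl
  have hJf : ∀ c i, f (J c i) = 0 := fun c i => (e c i).2
  have hJinj : Function.Injective J := fun c c' h =>
    e.injective (funext fun i => Subtype.ext (congrFun h i))
  obtain ⟨R, hR⟩ := LinearMap.exists_leftInverse_of_injective J (LinearMap.ker_eq_bot.2 hJinj)
  have hRJ : ∀ c, R (J c) = c := LinearMap.congr_fun hR
  have hJR : ∀ τ : Fin 3 → V, (∀ i, f (τ i) = 0) → J (R τ) = τ := by
    intro τ hτ
    have : J (e.symm fun i => ⟨τ i, hτ i⟩) = τ := by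
      funext i
      rw [hJ, LinearEquiv.apply_symm_apply]
    rw [← this, hRJ]
  let G : PluckerSpace k V → (Fin (5 + 1) → k) → Triple k V :=
    fun a c i => wedge k (firstRow f a 0) (J c i)
  have hGhom : ∀ (c c' : k) a b, G (c • a) (c' • b) = (c ^ 1 * c' ^ 1) • G a b := by
    intro c c' a b
    funext i
    simp only [G, map_smul, Pi.smul_apply, wedge_smul_left, wedge_smul_right, pow_one, smul_smul,
      mul_comm]
  have hGpoly : IsPolyMap k fun ac : PluckerSpace k V × (Fin (5 + 1) → k) => G ac.1 ac.2 :=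
    IsPolyMap.pi fun i => (IsPolyMap.linear_fst (rowProj k V 0 ∘ₗ firstRow f)).bilin
      (wedgeBilin k V) (IsPolyMap.linear_snd (LinearMap.proj i ∘ₗ J))
  let H : PluckerSpace k V → Triple k V → (Fin (5 + 1) → k) :=
    fun _ b => R fun i => contract f (b i)
  have hHhom : ∀ (c c' : k) a b, H (c • a) (c' • b) = (c ^ 0 * c' ^ 1) • H a b := by
    intro c c' a b
    have : (fun i => contract f ((c' • b) i)) = c' • fun i => contract f (b i) :=
      funext fun i => (contract f).map_smul c' (b i)
    simp only [H, pow_zero, one_mul, pow_one, this, map_smul]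
  have hHpoly : IsPolyMap k fun ab : PluckerSpace k V × Triple k V => H ab.1 ab.2 :=
    IsPolyMap.linear_snd (R ∘ₗ (contract f).compLeft (Fin 3))
  have hHG : ∀ a c, H a (G a c) = diagForm f a • c := by
    intro a c
    have : (fun i => contract f (G a c i)) = diagForm f a • J c := by
      funext i
      rw [Pi.smul_apply, ← apply_firstRow_zero, ← contract_wedge_of_apply_eq_zero (hJf c i)]
    change R (fun i => contract f (G a c i)) = _
    rw [this, map_smul, hRJ]
  have hGne : ∀ a c, diagForm f a ≠ 0 → c ≠ 0 → G a c ≠ 0 := by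
    intro a c ha hc h0
    have := hHG a c
    rw [h0] at this
    refine smul_ne_zero ha hc (this.symm.trans ?_)
    change R (fun i => contract f 0) = 0
    rw [map_zero]
    exact map_zero R
  have hGH : ∀ w ∈ exceptionalDivisor k V, ∀ a b, IsPt k w.1 a → IsPt k w.2 b →
      G a (H a b) = (diagForm f a) • b := by
    intro w hw a b ha hb
    have h1 : firstRow f a 1 = 0 := by
      rw [firstRow_one, phiLin_eq_zero_of_mem_fixedLocus ha hw.2]
      simp
    have : J (H a b) = fun i => contract f (b i) := hJR _ fun i => apply_contract_self f (b i)
    funext i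
    change wedge k (firstRow f a 0) (J (H a b) i) = diagForm f a • b i
    rw [this]
    fin_cases i
    · exact (diagForm_smul_zero_of_mem_blowUp hw.1 ha hb f).symm
    · exact ((diagForm_smul_one_of_mem_blowUp hw.1 ha hb f).trans (by rw [h1]; simp)).symm
    · exact ((diagForm_smul_two_of_mem_blowUp hw.1 ha hb f).trans (by rw [h1]; simp)).symm
  have hHne : ∀ w ∈ exceptionalDivisor k V, NonvanishingAt k (diagForm f) w.1 → ∀ a b,
      IsPt k w.1 a → IsPt k w.2 b → H a b ≠ 0 := by
    intro w hw hn a b ha hb h0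
    refine smul_ne_zero (hn a ha) hb.ne_zero ((hGH w hw a b ha hb).symm.trans ?_)
    rw [h0]
    funext i
    change wedge k _ (J 0 i) = 0
    rw [map_zero]
    exact wedge_zero_right _
  have c₀ : (1 : Fin (5 + 1) → k) ≠ 0 := one_ne_zero
  refine ⟨ratMap G (Projectivization.mk k _ (hGne z.rep 1 (hf _ (isPt_rep z)) c₀)),
    ratMap H (Projectivization.mk k _ c₀),
    isBiregular_ratMap hGhom hGpoly fun w hw a c ha hc => hGne a c (hw.2 a ha) hc.ne_zero,
    isBiregular_ratMap hHhom hHpoly fun w hw a b ha hb => hHne w hw.1 hw.2 a b ha hb,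
    fun p hp hn c => ?_, fun w hw hn => ?_⟩
  · have hn' := hn _ (isPt_rep p)
    have hψ := isPt_ratMap (d := Projectivization.mk k _ (hGne z.rep 1 (hf _ (isPt_rep z)) c₀))
      hGhom (w := (p, c)) (isPt_rep p) (isPt_rep c) (hGne _ _ hn' c.rep_nonzero)
    constructor
    · rw [exceptionalDivisor_eq]
      refine ⟨firstRow f p.rep 0, J c.rep, ?_, hψ⟩
      rw [← ((isPt_rep p).pluckerRelations hp.1).diagForm_smul_eq_diagVec
        (phiLin_eq_zero_of_mem_fixedLocus (isPt_rep p) hp) f]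
      exact (isPt_rep p).smul hn'
    · have hc := (isPt_rep c).smul hn'
      rw [← hHG] at hc
      exact (isPt_ratMap hHhom (w := (p, _)) (isPt_rep p) hψ hc.ne_zero).eq hc
  · have ha := isPt_rep w.1
    have hb := isPt_rep w.2
    have hχ := isPt_ratMap (d := Projectivization.mk k _ c₀) hHhom ha hb
      (hHne w hw hn _ _ ha hb)
    have hb' := hb.smul (hn _ ha)
    rw [← hGH w hw _ _ ha hb] at hb'
    exact (isPt_ratMap hGhom (w := (w.1, ratMap H (Projectivization.mk k _ c₀) w)) ha hχ
      hb'.ne_zero).eq hb'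

end Bundle

/-! ### Smoothness of the closure of the graph -/

section SmoothCharts

variable {k : Type*} [Field k] {V : Type*} [AddCommGroup V] [Module k V]

theorem compLeft_contract_apply (f : Module.Dual k V) (b : Triple k V) :
    (contract f).compLeft (Fin 3) b = fun i => contract f (b i) := rfl

/-- Away from `Z_G` the closure of the graph is isomorphic to `X`. If the Plücker coordinate of two
forms `f`, `g` factors through `phiLin`, then the affine open piece where it does not vanish
consists of the pairs `(r ∧ s, phiLin (r ∧ s))` with `f r = g s = 1`, `f s = g r = 0`. -/
theorem formallySmooth_graphChart [CharZero k] [FiniteDimensional k V]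
    {f g : Module.Dual k (Row V)} {q : Module.Dual k (Triple k V)}
    (hq : ∀ a, g (contract f a) = q (phiLin k V a)) {r s : Row V} (hfr : f r = 1) (hgr : g r = 0)
    (hfs : f s = 0) (hgs : g s = 1) :
    Algebra.FormallySmooth k (coordRing k (biChart k (g ∘ₗ contract f) q (blowUp k V))) := by
  let P₁ : Row V → Row V := fun n => n - f n • r - g n • s + r
  let P₂ : Row V → Row V := fun n => n - f n • r - g n • s + s
  have hf₁ : ∀ n, f (P₁ n) = 1 := fun n => by simp [P₁, hfr, hfs]
  have hf₂ : ∀ n, f (P₂ n) = 0 := fun n => by simp [P₂, hfr, hfs]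
  have hg₂ : ∀ n, g (P₂ n) = 1 := fun n => by simp [P₂, hgr, hgs]
  have hpoly : ∀ c : Row V, IsPolyMap k fun n : Row V => n - f n • r - g n • s + c := fun c =>
    (((IsPolyMap.linear LinearMap.id).sub
      (IsPolyMap.smul (dual_mem_polyFun f) (IsPolyMap.const r))).sub
      (IsPolyMap.smul (dual_mem_polyFun g) (IsPolyMap.const s))).add (IsPolyMap.const c)
  have hwedge : IsPolyMap k fun n : Row V × Row V => wedge k (P₁ n.1) (P₂ n.2) :=
    ((hpoly r).comp (IsPolyMap.linear_fst LinearMap.id)).bilin (wedgeBilin k (Row V))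
      ((hpoly s).comp (IsPolyMap.linear_snd LinearMap.id))
  have hval : ∀ n : Row V × Row V, g (contract f (wedge k (P₁ n.1) (P₂ n.2))) = 1 := fun n => by
    simp [hf₁, hf₂, hg₂]
  refine formallySmooth_coordRing_of_retract
    (fun n : Row V × Row V => (wedge k (P₁ n.1) (P₂ n.2), phiLin k V (wedge k (P₁ n.1) (P₂ n.2))))
    (fun ab => (-contract g ab.1, contract f ab.1))
    (hwedge.prodMk ((IsPolyMap.linear (phiLin k V)).comp hwedge))
    ((IsPolyMap.linear_fst (contract g)).neg.prodMk (IsPolyMap.linear_fst (contract f)))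
    (fun n => ?_) ?_
  · have hq1 : q (phiLin k V (wedge k (P₁ n.1) (P₂ n.2))) = 1 := by rw [← hq, hval]
    have h2 : phiLin k V (wedge k (P₁ n.1) (P₂ n.2)) ≠ 0 := fun h => by
      rw [h, map_zero] at hq1
      exact zero_ne_one hq1
    have h1 : wedge k (P₁ n.1) (P₂ n.2) ≠ 0 := fun h => h2 (by rw [h, map_zero])
    refine ⟨hval n, hq1, (Projectivization.mk k _ h1, Projectivization.mk k _ h2), ?_, isPt_mk h1,
      isPt_mk h2⟩
    refine subset_zariskiClosure _ (mem_graph (A := Matrix.of ![P₁ n.1, P₂ n.2]) (isPt_mk h1) ?_)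
    rw [← phiLin_pluckerVec]
    exact isPt_mk h2
  · rintro ⟨a, b⟩ ⟨ha1, hb1, w, hw, ha, hb⟩
    have hfg : g (contract f a) = 1 := ha1
    have e₁ : P₁ (-contract g a) = -contract g a := by
      have h1 : f (-contract g a) = 1 := by rw [map_neg, ← apply_contract_swap, hfg]
      have h2 : g (-contract g a) = 0 := by rw [map_neg, apply_contract_self, neg_zero]
      simp only [P₁, h1, h2, one_smul, zero_smul, sub_zero, sub_add_cancel]
    have e₂ : P₂ (contract f a) = contract f a := by
      simp only [P₂, apply_contract_self, hfg, one_smul, zero_smul, sub_zero, sub_add_cancel]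
    have e : wedge k (-contract g a) (contract f a) = a := by
      rw [wedge_neg_left, ← wedge_swap,
        ← ha.pluckerRelations (fst_mem_grassmannian_of_mem_blowUp hw) f g, hfg, one_smul]
    have hphi : phiLin k V a = b := by
      have := apply_smul_phiLin_of_mem_blowUp hw ha hb q
      rwa [← hq, hfg, one_smul, show q b = 1 from hb1, one_smul] at this
    simp only [e₁, e₂, e, hphi]

/-- Near the exceptional divisor the closure of the graph is the blow-up of an affine space along
a linear subspace, in the affine open piece where the equation of the exceptional divisor is `s`:
the matrices `famMatrix y τ s` with `f y = 1`, `f (τ i) = 0` and `μ τ = 1`. -/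
theorem formallySmooth_exceptionalChart [CharZero k] [FiniteDimensional k V]
    {f : Module.Dual k V} {x : V} (hx : f x = 1) {μ : Module.Dual k (Fin 3 → V)} {κ : Fin 3 → V}
    (hκ : ∀ i, f (κ i) = 0) (hμ : μ κ = 1) :
    Algebra.FormallySmooth k (coordRing k (biChart k (diagForm f)
      (μ ∘ₗ (contract f).compLeft (Fin 3)) (blowUp k V))) := by
  let Y : V → V := fun y => y - f y • x + x
  let T₀ : (Fin 3 → V) → Fin 3 → V := fun τ i => τ i - f (τ i) • x
  let T : (Fin 3 → V) → Fin 3 → V := fun τ => T₀ τ + (1 - μ (T₀ τ)) • κ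
  have hY : ∀ y, f (Y y) = 1 := fun y => by simp [Y, hx]
  have hT : ∀ τ i, f (T τ i) = 0 := fun τ i => by simp [T, T₀, hx, hκ]
  have hTμ : ∀ τ, μ (T τ) = 1 := fun τ => by simp [T, hμ]
  have pY : IsPolyMap k Y := ((IsPolyMap.linear LinearMap.id).sub
    (IsPolyMap.smul (dual_mem_polyFun f) (IsPolyMap.const x))).add (IsPolyMap.const x)
  have pT₀ : IsPolyMap k T₀ := IsPolyMap.pi fun i =>
    (IsPolyMap.linear (LinearMap.proj (φ := fun _ => V) i)).sub
      (IsPolyMap.smul (dual_mem_polyFun (f ∘ₗ LinearMap.proj (φ := fun _ => V) i))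
        (IsPolyMap.const x))
  have pT : IsPolyMap k T := pT₀.add
    (IsPolyMap.smul (sub_mem_polyFun (const_mem_polyFun 1) (pT₀ μ)) (IsPolyMap.const κ))
  have p1 : IsPolyMap k fun n : V × k × (Fin 3 → V) => Y n.1 :=
    pY.comp (IsPolyMap.linear_fst LinearMap.id)
  have p2 : IsPolyMap k fun n : V × k × (Fin 3 → V) => T n.2.2 :=
    pT.comp (IsPolyMap.linear_snd (LinearMap.snd k k (Fin 3 → V)))
  have p3 : (fun n : V × k × (Fin 3 → V) => n.2.1) ∈ polyFun k (V × k × (Fin 3 → V)) :=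
    dual_snd_mem_polyFun (LinearMap.fst k k (Fin 3 → V))
  have hcontract : ∀ (y : V) (τ : Fin 3 → V) (s : k) (i : Fin 3),
      contract f (famTriple (Y y) (T τ) s i) = T τ i := by
    intro y τ s i
    fin_cases i <;> simp [famTriple, hY, hT]
  refine formallySmooth_coordRing_of_retract
    (fun n : V × k × (Fin 3 → V) =>
      (pluckerVec k (famMatrix (Y n.1) (T n.2.2) n.2.1), famTriple (Y n.1) (T n.2.2) n.2.1))
    (fun ab => (firstRow f ab.1 0, (μ fun i => contract f (phiLin k V ab.1 i)),
      fun i => contract f (ab.2 i)))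
    ((isPolyMap_pluckerVec_famMatrix p1 p2 p3).prodMk (isPolyMap_famTriple p1 p2 p3))
    ((IsPolyMap.linear_fst (rowProj k V 0 ∘ₗ firstRow f)).prodMk
      ((IsPolyMap.linear_fst (μ ∘ₗ (contract f).compLeft (Fin 3) ∘ₗ phiLin k V)).prodMk
        (IsPolyMap.linear_snd ((contract f).compLeft (Fin 3)))))
    (fun n => ?_) ?_
  · have hp : diagForm f (pluckerVec k (famMatrix (Y n.1) (T n.2.2) n.2.1)) = 1 := by
      rw [pluckerVec_eq, diagForm_wedge]
      simp [famMatrix, hY, hT]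
    have hq : μ (fun i => contract f (famTriple (Y n.1) (T n.2.2) n.2.1 i)) = 1 := by
      simp only [hcontract]
      exact hTμ n.2.2
    have h1 : pluckerVec k (famMatrix (Y n.1) (T n.2.2) n.2.1) ≠ 0 := fun h => by
      rw [h, map_zero] at hp
      exact zero_ne_one hp
    have h2 : famTriple (Y n.1) (T n.2.2) n.2.1 ≠ 0 := fun h => by
      rw [h, ← compLeft_contract_apply, map_zero, map_zero] at hq
      exact zero_ne_one hq
    exact ⟨hp, hq, (Projectivization.mk k _ h1, Projectivization.mk k _ h2),
      mem_blowUp_of_isPt_fam (isPt_mk h1) (isPt_mk h2), isPt_mk h1, isPt_mk h2⟩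
  · rintro ⟨a, b⟩ ⟨ha1, hb1, w, hw, ha, hb⟩
    change diagForm f a = 1 at ha1
    change μ (fun i => contract f (b i)) = 1 at hb1
    have hphi : phiLin k V a = (μ fun i => contract f (phiLin k V a i)) • b := by
      have := apply_smul_phiLin_of_mem_blowUp hw ha hb (μ ∘ₗ (contract f).compLeft (Fin 3))
      simp only [LinearMap.comp_apply, compLeft_contract_apply] at this
      rwa [hb1, one_smul] at this
    change (pluckerVec k (famMatrix (Y (firstRow f a 0)) (T fun i => contract f (b i)) _),
      famTriple (Y (firstRow f a 0)) (T fun i => contract f (b i)) _) = (a, b)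
    set s := μ fun i => contract f (phiLin k V a i)
    have eY : Y (firstRow f a 0) = firstRow f a 0 := by
      simp only [Y, apply_firstRow_zero, ha1, one_smul, sub_add_cancel]
    have eT₀ : T₀ (fun i => contract f (b i)) = fun i => contract f (b i) := by
      funext i
      simp only [T₀, apply_contract_self, zero_smul, sub_zero]
    have eT : T (fun i => contract f (b i)) = fun i => contract f (b i) := by
      simp only [T, eT₀, hb1, sub_self, zero_smul, add_zero]
    have hs : ∀ i, contract f (phiLin k V a i) = s • contract f (b i) := fun i => by
      rw [hphi, Pi.smul_apply, map_smul]
    rw [eY, eT]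
    refine Prod.ext ?_ ?_
    · have hA : famMatrix (firstRow f a 0) (fun i => contract f (b i)) s =
          Matrix.of ![firstRow f a, secondRow f a] := by
        funext i j
        fin_cases i <;> fin_cases j
        · rfl
        · exact ((firstRow_one f a).trans (by rw [hs]; rfl)).symm
        · exact ((secondRow_zero f a).trans (by rw [hs]; rfl)).symm
        · exact ((secondRow_one f a).trans (by rw [hs]; rfl)).symm
      change pluckerVec k _ = a
      rw [hA, ← wedge_eq_pluckerVec, ← PluckerRelations.diagForm_smul, ha1, one_smul]
      exact ha.pluckerRelations (fst_mem_grassmannian_of_mem_blowUp hw)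
    · have e0 := diagForm_smul_zero_of_mem_blowUp hw ha hb f
      have e1 := diagForm_smul_one_of_mem_blowUp hw ha hb f
      have e2 := diagForm_smul_two_of_mem_blowUp hw ha hb f
      rw [ha1, one_smul] at e0 e1 e2
      rw [firstRow_one, hs] at e1 e2
      funext i
      fin_cases i
      · exact e0.symm
      · refine Eq.trans ?_ e1.symm
        rw [wedge_neg_left, wedge_smul_left, ← sub_eq_add_neg]
        rfl
      · refine Eq.trans ?_ e2.symm
        rw [wedge_neg_left, wedge_smul_left, ← sub_eq_add_neg]
        rfl

/-- A nonzero triple has nonzero image under one of the maps `ξ`, `η`, `ξ + ω + η`. On `Phi A`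
they take the decomposable values `x ∧ y`, `x' ∧ y'`, `(x + x') ∧ (y + y')`. -/
theorem exists_decomposable_component {t : Triple k V} (ht : t ≠ 0) :
    ∃ (D : Row V →ₗ[k] V) (Λ : Triple k V →ₗ[k] ⋀[k]^2 V),
      (∀ a, Λ (phiLin k V a) = exteriorPower.map 2 D a) ∧ Λ t ≠ 0 := by
  by_contra! h
  have h0 : t 0 = 0 := h (rowProj k V 0) (tripleProj k V 0) fun a => rfl
  have h2 : t 2 = 0 := h (rowProj k V 1) (tripleProj k V 2) fun a => rfl
  have h1 : t 0 + t 1 + t 2 = 0 := h (rowProj k V 0 + rowProj k V 1)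
    (tripleProj k V 0 + tripleProj k V 1 + tripleProj k V 2) fun a => by
      change phiLin k V a 0 + phiLin k V a 1 + phiLin k V a 2 = _
      rw [phiLin_zero, phiLin_one, phiLin_two]
      abel
  rw [h0, h2, zero_add, add_zero] at h1
  refine ht (funext fun i => ?_)
  fin_cases i
  exacts [h0, h1, h2]

theorem isSmoothVariety_blowUp [IsAlgClosed k] [CharZero k] [FiniteDimensional k V] :
    IsSmoothVariety k (blowUp k V) := by
  have of_isPt {w : ℙ k (PluckerSpace k V) × ℙ k (Triple k V)}
      {p : Module.Dual k (PluckerSpace k V)} {q : Module.Dual k (Triple k V)}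
      {a : PluckerSpace k V} {b : Triple k V} (ha : IsPt k w.1 a) (hb : IsPt k w.2 b) (hp : p a ≠ 0) (hq : q b ≠ 0) :
      ∀ a b, IsPt k w.1 a → IsPt k w.2 b → p a * q b ≠ 0 := by
    intro a' b' ha' hb'
    obtain ⟨c, hc, rfl⟩ := ha.exists_smul_eq ha'
    obtain ⟨d, hd, rfl⟩ := hb.exists_smul_eq hb'
    rw [map_smul, map_smul]
    exact mul_ne_zero (smul_ne_zero hc hp) (smul_ne_zero hd hq)
  refine isSmoothVariety_of_forall_exists_chart zariskiClosure_blowUp fun w hw => ?_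
  obtain ⟨-, A, ha, hb⟩ | ⟨x, τ, ha, hb⟩ := mem_blowUp_iff.1 hw
  · obtain ⟨D, Λ, hΛ, ht⟩ := exists_decomposable_component hb.ne_zero
    obtain ⟨φ, ψ, hφψ⟩ := exists_apply_contract_ne_zero ht
    have hpq : ∀ a, (ψ ∘ₗ D) (contract (φ ∘ₗ D) a) = (ψ ∘ₗ contract φ ∘ₗ Λ) (phiLin k V a) := by
      intro a
      simp only [LinearMap.comp_apply, hΛ]
      have e : ψ ∘ₗ D ∘ₗ contract (φ ∘ₗ D) = ψ ∘ₗ contract φ ∘ₗ exteriorPower.map 2 D :=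
        bivector_linearMap_ext fun r s => by simp [map_wedge]
      exact LinearMap.congr_fun e a
    set f := φ ∘ₗ D
    set g := ψ ∘ₗ D
    set a := pluckerVec k A
    have hp : g (contract f a) ≠ 0 := by
      rw [hpq, phiLin_pluckerVec]
      exact hφψ
    refine ⟨g ∘ₗ contract f, ψ ∘ₗ contract φ ∘ₗ Λ, of_isPt ha hb hp hφψ,
      formallySmooth_graphChart hpq (r := (g (contract f a))⁻¹ • -contract g a)
        (s := (g (contract f a))⁻¹ • contract f a) ?_ ?_ ?_ ?_⟩
    · rw [map_smul, map_neg, ← apply_contract_swap, smul_eq_mul, inv_mul_cancel₀ hp]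
    · rw [map_smul, map_neg, apply_contract_self, neg_zero, smul_zero]
    · rw [map_smul, apply_contract_self, smul_zero]
    · rw [map_smul, smul_eq_mul, inv_mul_cancel₀ hp]
  · obtain ⟨f, hf⟩ := exists_diagForm_ne_zero ha.ne_zero (phiLin_diagVec x)
    have hfx : f x ≠ 0 := fun h => hf (by rw [diagForm_diagVec, h, mul_zero])
    set b : Triple k V := fun i => wedge k x (τ i)
    -- `b = x ∧ κ` up to a factor, so `κ` is nonzero
    set κ : Fin 3 → V := fun i => contract f (b i)
    have hκ : κ ≠ 0 := by
      intro h
      refine smul_ne_zero hfx hb.ne_zero (funext fun i => ?_)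
      have hi : contract f (wedge k x (τ i)) = 0 := congrFun h i
      rw [contract_wedge, sub_eq_zero] at hi
      change f x • wedge k x (τ i) = 0
      rw [← wedge_smul_right, hi, wedge_smul_right, wedge_self, smul_zero]
    obtain ⟨μ, hμ⟩ := not_forall.1 fun h =>
      hκ ((Module.forall_dual_apply_eq_zero_iff k _).1 h)
    refine ⟨diagForm f, μ ∘ₗ (contract f).compLeft (Fin 3), of_isPt ha hb hf hμ,
      formallySmooth_exceptionalChart (x := (f x)⁻¹ • x) (κ := (μ κ)⁻¹ • κ) ?_ (fun i => ?_) ?_⟩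
    · rw [map_smul, smul_eq_mul, inv_mul_cancel₀ hfx]
    · rw [Pi.smul_apply, map_smul, apply_contract_self, smul_zero]
    · rw [map_smul, smul_eq_mul, inv_mul_cancel₀ hμ]

end SmoothCharts

/-! ### Homogenization -/

section Homogenization

variable {k : Type*} [Field k]
variable {E : Type*} [AddCommGroup E] [Module k E]
variable {F : Type*} [AddCommGroup F] [Module k F]

theorem exists_homogenization (l : Module.Dual k E) {f : E → k} (hf : f ∈ polyFun k E) :
    ∃ (D : ℕ) (H : E → k), H ∈ polyFun k E ∧ (∀ (c : k) a, H (c • a) = c ^ D * H a) ∧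
      ∀ a, l a = 1 → H a = f a := by
  refine polyFun_induction (P := fun f => ∃ (D : ℕ) (H : E → k), H ∈ polyFun k E ∧
    (∀ (c : k) a, H (c • a) = c ^ D * H a) ∧ ∀ a, l a = 1 → H a = f a) ?_ ?_ ?_ ?_ hf
  · intro φ
    exact ⟨1, φ, dual_mem_polyFun φ, fun c a => by rw [map_smul, pow_one, smul_eq_mul],
      fun _ _ => rfl⟩
  · exact fun c => ⟨0, fun _ => c, const_mem_polyFun c, fun c a => by simp, fun _ _ => rfl⟩
  · rintro f g - - ⟨D, H, hH, hom, h⟩ ⟨D', H', hH', hom', h'⟩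
    refine ⟨D + D', fun a => l a ^ D' * H a + l a ^ D * H' a, add_mem_polyFun
      (mul_mem_polyFun (pow_mem_polyFun (dual_mem_polyFun l) _) hH)
      (mul_mem_polyFun (pow_mem_polyFun (dual_mem_polyFun l) _) hH'), fun c a => ?_, fun a ha => ?_⟩
    · simp only [hom, hom', map_smul, smul_eq_mul]
      ring
    · simp only [ha, h a ha, h' a ha, one_pow, one_mul]
  · rintro f g - - ⟨D, H, hH, hom, h⟩ ⟨D', H', hH', hom', h'⟩
    refine ⟨D + D', fun a => H a * H' a, mul_mem_polyFun hH hH', fun c a => ?_, fun a ha => ?_⟩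
    · simp only [hom, hom']
      ring
    · simp only [h a ha, h' a ha]

theorem exists_bihomogenization (l : Module.Dual k E) (m : Module.Dual k F) {f : E × F → k}
    (hf : f ∈ polyFun k (E × F)) :
    ∃ (D : ℕ) (H : E × F → k), H ∈ polyFun k (E × F) ∧
      (∀ (c d : k) a b, H (c • a, d • b) = c ^ D * d ^ D * H (a, b)) ∧
      ∀ a b, l a = 1 → m b = 1 → H (a, b) = f (a, b) := by
  have hl : (fun ab : E × F => l ab.1) ∈ polyFun k (E × F) := dual_fst_mem_polyFun l
  have hm : (fun ab : E × F => m ab.2) ∈ polyFun k (E × F) := dual_snd_mem_polyFun m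
  refine polyFun_induction (P := fun f => ∃ (D : ℕ) (H : E × F → k), H ∈ polyFun k (E × F) ∧
    (∀ (c d : k) a b, H (c • a, d • b) = c ^ D * d ^ D * H (a, b)) ∧
    ∀ a b, l a = 1 → m b = 1 → H (a, b) = f (a, b)) ?_ ?_ ?_ ?_ hf
  · intro φ
    refine ⟨1, fun ab => m ab.2 * (φ ∘ₗ LinearMap.inl k E F) ab.1 +
      l ab.1 * (φ ∘ₗ LinearMap.inr k E F) ab.2, add_mem_polyFun
        (mul_mem_polyFun hm (dual_fst_mem_polyFun (φ ∘ₗ LinearMap.inl k E F)))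
        (mul_mem_polyFun hl (dual_snd_mem_polyFun (φ ∘ₗ LinearMap.inr k E F))),
      fun c d a b => ?_, fun a b ha hb => ?_⟩
    · simp only [map_smul, smul_eq_mul]
      ring
    · simp only [ha, hb, one_mul, LinearMap.comp_apply, ← map_add]
      simp
  · exact fun c => ⟨0, fun _ => c, const_mem_polyFun c, fun c d a b => by simp, fun _ _ _ _ => rfl⟩
  · rintro f g - - ⟨D, H, hH, hom, h⟩ ⟨D', H', hH', hom', h'⟩
    refine ⟨D + D', fun ab => (l ab.1 * m ab.2) ^ D' * H ab + (l ab.1 * m ab.2) ^ D * H' ab,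
      add_mem_polyFun (mul_mem_polyFun (pow_mem_polyFun (mul_mem_polyFun hl hm) _) hH)
      (mul_mem_polyFun (pow_mem_polyFun (mul_mem_polyFun hl hm) _) hH'), fun c d a b => ?_,
      fun a b ha hb => ?_⟩
    · simp only [hom, hom', map_smul, smul_eq_mul]
      ring
    · simp only [ha, hb, h a b ha hb, h' a b ha hb, mul_one, one_pow, one_mul]
  · rintro f g - - ⟨D, H, hH, hom, h⟩ ⟨D', H', hH', hom', h'⟩
    refine ⟨D + D', fun ab => H ab * H' ab, mul_mem_polyFun hH hH', fun c d a b => ?_,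
      fun a b ha hb => ?_⟩
    · simp only [hom, hom']
      ring
    · simp only [h a b ha hb, h' a b ha hb]

/-- A polynomial function takes the same values modulo `J` at two points whose coordinates are
congruent modulo `J`. -/
theorem exists_mem_ideal_eq_sub {S : Set E} (J : Ideal (coordRing k S)) {v v' : S → F}
    (hv : ∀ l : Module.Dual k F, (fun s => l (v s)) ∈ coordRing k S)
    (hv' : ∀ l : Module.Dual k F, (fun s => l (v' s)) ∈ coordRing k S)
    (h : ∀ l : Module.Dual k F, ∃ j ∈ J, ∀ s, j.1 s = l (v s) - l (v' s)) {H : F → k}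
    (hH : H ∈ polyFun k F) : ∃ j ∈ J, ∀ s, j.1 s = H (v s) - H (v' s) := by
  have : (fun s => H (v s)) ∈ coordRing k S ∧ (fun s => H (v' s)) ∈ coordRing k S ∧
      ∃ j ∈ J, ∀ s, j.1 s = H (v s) - H (v' s) := by
    refine polyFun_induction (P := fun H => (fun s => H (v s)) ∈ coordRing k S ∧
      (fun s => H (v' s)) ∈ coordRing k S ∧ ∃ j ∈ J, ∀ s, j.1 s = H (v s) - H (v' s)) ?_ ?_ ?_ ?_ hH
    · exact fun l => ⟨hv l, hv' l, h l⟩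
    · exact fun c => ⟨(coordRing k S).algebraMap_mem c, (coordRing k S).algebraMap_mem c, 0,
        J.zero_mem, fun s => (sub_self c).symm⟩
    · rintro f g - - ⟨hf, hf', j, hj, ej⟩ ⟨hg, hg', i, hi, ei⟩
      refine ⟨add_mem hf hg, add_mem hf' hg', j + i, J.add_mem hj hi, fun s => ?_⟩
      change j.1 s + i.1 s = _
      rw [ej, ei]
      ring
    · rintro f g - - ⟨hf, hf', j, hj, ej⟩ ⟨hg, hg', i, hi, ei⟩
      refine ⟨mul_mem hf hg, mul_mem hf' hg', ⟨_, hg⟩ * j + ⟨_, hf'⟩ * i,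
        J.add_mem (J.mul_mem_left _ hj) (J.mul_mem_left _ hi), fun s => ?_⟩
      change g (v s) * j.1 s + f (v' s) * i.1 s = _
      rw [ej, ei]
      ring
  exact this.2.2

end Homogenization

/-! ### The ideal of the fixed locus -/

section IdealOfFixedLocus

variable {k : Type*} [Field k] {V : Type*} [AddCommGroup V] [Module k V]

variable (k V) in
/-- The ideal generated by the components of `Phi` in the coordinate ring of an affine open piece
of the Grassmannian. -/
def phiIdeal (l : Module.Dual k (PluckerSpace k V)) :
    Ideal (coordRing k (chart k l (grassmannian k V))) :=
  Ideal.span (Set.range fun φ : Module.Dual k (Triple k V) => coord k _ (φ ∘ₗ phiLin k V))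

theorem exists_mem_phiIdeal [FiniteDimensional k V] (l : Module.Dual k (PluckerSpace k V))
    {N : Type*} [AddCommGroup N] [Module k N] (B : Triple k V →ₗ[k] N →ₗ[k] k)
    {G : PluckerSpace k V → N} (hG : IsPolyMap k G) :
    ∃ j ∈ phiIdeal k V l, ∀ s, j.1 s = B (phiLin k V s.1) (G s.1) := by
  let b := Module.finBasis k (Triple k V)
  refine ⟨∑ i, restrictPoly _ ⟨fun a => B (b i) (G a), hG (B (b i))⟩ *
    coord k _ (b.coord i ∘ₗ phiLin k V),
    Ideal.sum_mem _ fun i _ => Ideal.mul_mem_left _ _ (Ideal.subset_span ⟨_, rfl⟩), fun s => ?_⟩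
  conv_rhs => rw [← b.sum_repr (phiLin k V s.1)]
  simp only [AddSubmonoidClass.coe_finsetSum, map_sum, map_smul, LinearMap.sum_apply,
    LinearMap.smul_apply, smul_eq_mul, Finset.sum_apply]
  refine Finset.sum_congr rfl fun i _ => ?_
  exact mul_comm _ _

/-- The matrix with rows `firstRow f a` and `secondRow f a` is congruent to `diag(x, x)` modulo the
components of `Phi`, where `x` is the first component of `firstRow f a`. -/
theorem exists_mem_phiIdeal_eq_sub_diagVec [FiniteDimensional k V]
    (l : Module.Dual k (PluckerSpace k V)) (f : Module.Dual k V)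
    (φ : Module.Dual k (PluckerSpace k V)) :
    ∃ j ∈ phiIdeal k V l, ∀ s, j.1 s = φ (wedge k (firstRow f s.1) (secondRow f s.1)) -
      φ (diagVec (firstRow f s.1 0)) := by
  let Q : Triple k V →ₗ[k] Row V := LinearMap.pi ![0, -(contract f ∘ₗ tripleProj k V 2)]
  let Q' : Triple k V →ₗ[k] Row V :=
    LinearMap.pi ![contract f ∘ₗ tripleProj k V 0, contract f ∘ₗ tripleProj k V 1]
  let ρ : PluckerSpace k V →ₗ[k] Row V := LinearMap.pi ![rowProj k V 0 ∘ₗ firstRow f, 0]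
  let ρ' : PluckerSpace k V →ₗ[k] Row V := LinearMap.pi ![0, rowProj k V 0 ∘ₗ firstRow f]
  have hr : ∀ a, firstRow f a = ρ a + Q (phiLin k V a) := by
    intro a
    funext i
    fin_cases i
    · exact (add_zero _).symm
    · exact (firstRow_one f a).trans (zero_add _).symm
  have hr' : ∀ a, secondRow f a = ρ' a + Q' (phiLin k V a) := by
    intro a
    funext i
    fin_cases i
    · exact (secondRow_zero f a).trans (zero_add _).symm
    · exact secondRow_one f a
  have hρ : ∀ a, wedge k (ρ a) (ρ' a) = diagVec (firstRow f a 0) := by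
    intro a
    rw [diagVec_eq]
    congr 1 <;> funext i <;> fin_cases i <;> rfl
  have p1 : IsPolyMap k fun a : PluckerSpace k V => secondRow f a := IsPolyMap.linear _
  have p2 : IsPolyMap k fun a : PluckerSpace k V => ρ a := IsPolyMap.linear _
  obtain ⟨j, hj, ej⟩ := exists_mem_phiIdeal l (((wedgeBilin k (Row V)).compr₂ φ).comp Q) p1
  obtain ⟨j', hj', ej'⟩ :=
    exists_mem_phiIdeal l (((wedgeBilin k (Row V)).flip.compr₂ φ).comp Q') p2
  refine ⟨j + j', Ideal.add_mem _ hj hj', fun s => ?_⟩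
  have e : (j + j').1 s = φ (wedge k (Q (phiLin k V s.1)) (secondRow f s.1)) +
      φ (wedge k (ρ s.1) (Q' (phiLin k V s.1))) :=
    congrArg₂ (· + ·) (ej s) (ej' s)
  rw [e, ← hρ, ← map_add, ← map_sub]
  congr 1
  rw [hr s.1, hr' s.1]
  simp only [wedge_add_left, wedge_add_right]
  abel

/-- A homogeneous function that restricts to a function on an affine open piece of the Grassmannian
which vanishes on `Z_G`, becomes zero on all of `Z_G` when multiplied by the equation of the
complement. -/
theorem homogeneous_mul_apply_diagVec {l : Module.Dual k (PluckerSpace k V)}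
    {H : PluckerSpace k V → k} {D : ℕ} (hom : ∀ (c : k) a, H (c • a) = c ^ D * H a)
    (h0 : ∀ a ∈ chart k l (fixedLocus k V), H a = 0) (x : V) :
    H (diagVec x) * l (diagVec x) = 0 := by
  by_cases hl : l (diagVec x) = 0
  · rw [hl, mul_zero]
  have hx : diagVec (k := k) x ≠ 0 := fun h0 => hl (by rw [h0, map_zero])
  have h := h0 ((l (diagVec x))⁻¹ • diagVec x)
    ⟨by rw [map_smul, smul_eq_mul, inv_mul_cancel₀ hl], _, diagVec_mem_fixedLocus (isPt_mk hx),
      (isPt_mk hx).smul (inv_ne_zero hl)⟩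
  rw [hom] at h
  rw [(mul_eq_zero.1 h).resolve_left (pow_ne_zero _ (inv_ne_zero hl)), zero_mul]

/-- On the open set `diagForm f ≠ 0` the vanishing ideal of `Z_G` is generated by the components of
`Phi`, because `diagForm f a • a` is congruent to the Plücker vector of a matrix `diag(x, x)`
modulo these. -/
theorem exists_pow_mul_mem_phiIdeal [CharZero k] [FiniteDimensional k V]
    (l : Module.Dual k (PluckerSpace k V)) (f : Module.Dual k V)
    {h : coordRing k (chart k l (grassmannian k V))}
    (hh : h ∈ idealOf k (chart k l (grassmannian k V)) (chart k l (fixedLocus k V))) :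
    ∃ n : ℕ, coord k _ (diagForm f) ^ n * h ∈ phiIdeal k V l := by
  obtain ⟨⟨F, hF⟩, rfl⟩ := restrictPoly_surjective _ h
  obtain ⟨D, H, hH, hom, hHF⟩ := exists_homogenization l hF
  have hZ := homogeneous_mul_apply_diagVec (l := l) hom fun a ha => (hHF a ha.1).trans
    (hh ⟨a, ha.1, ha.2.imp fun _ hp => ⟨hp.1.1, hp.2⟩⟩ ha)
  have p1 : IsPolyMap k fun a : PluckerSpace k V => wedge k (firstRow f a) (secondRow f a) :=
    (IsPolyMap.linear (firstRow f)).bilin (wedgeBilin k (Row V)) (IsPolyMap.linear (secondRow f))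
  have p2 : IsPolyMap k fun a : PluckerSpace k V => diagVec (k := k) (firstRow f a 0) :=
    isPolyMap_diagVec.comp (IsPolyMap.linear (rowProj k V 0 ∘ₗ firstRow f))
  obtain ⟨j, hj, ej⟩ := exists_mem_ideal_eq_sub (phiIdeal k V l)
    (v := fun s => wedge k (firstRow f s.1) (secondRow f s.1))
    (v' := fun s => diagVec (firstRow f s.1 0))
    (fun φ => (restrictPoly _ ⟨_, p1 φ⟩).2) (fun φ => (restrictPoly _ ⟨_, p2 φ⟩).2)
    (exists_mem_phiIdeal_eq_sub_diagVec l f) (mul_mem_polyFun hH (dual_mem_polyFun l))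
  refine ⟨D + 1, ?_⟩
  have e : coord k _ (diagForm f) ^ (D + 1) * restrictPoly _ ⟨F, hF⟩ = j := by
    refine coordRing_ext fun s => ?_
    rw [ej]
    obtain ⟨s, hs, p, hp, hsp⟩ := s
    have e1 : (coord k (chart k l (grassmannian k V)) (diagForm f) ^ (D + 1) *
        restrictPoly _ ⟨F, hF⟩).1 ⟨s, hs, p, hp, hsp⟩ = diagForm f s ^ (D + 1) * F s := rfl
    rw [e1]
    simp only [hZ, ← (hsp.pluckerRelations hp).diagForm_smul, hom, map_smul, hs, hHF s hs, sub_zero,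
      smul_eq_mul]
    ring
  rw [e]
  exact hj

theorem mem_chart_of_forall_polyFun [CharZero k] [FiniteDimensional k V]
    {l : Module.Dual k (PluckerSpace k V)} {a : PluckerSpace k V}
    (h : ∀ f ∈ polyFun k (PluckerSpace k V),
      (∀ s ∈ chart k l (grassmannian k V), f s = 0) → f a = 0) :
    a ∈ chart k l (grassmannian k V) := by
  have hl : l a = 1 := sub_eq_zero.1 <| h (fun s => l s - 1)
    (sub_mem_polyFun (dual_mem_polyFun l) (const_mem_polyFun 1)) fun s hs => sub_eq_zero.2 hs.1
  have ha : a ≠ 0 := fun h0 => one_ne_zero (by rw [← hl, h0, map_zero])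
  refine ⟨hl, _, (isPt_mk ha).mem_grassmannian fun f g => ?_, isPt_mk ha⟩
  refine sub_eq_zero.1 ((Module.forall_dual_apply_eq_zero_iff k _).1 fun φ => ?_)
  refine h (fun a => φ (g (contract f a) • a - wedge k (contract f a) (contract g a)))
    (((IsPolyMap.smul (dual_mem_polyFun (g ∘ₗ contract f)) (IsPolyMap.linear LinearMap.id)).sub
      ((IsPolyMap.linear (contract f)).bilin (wedgeBilin k (Row V))
        (IsPolyMap.linear (contract g)))) φ) ?_
  rintro s ⟨-, p, hp, hs⟩
  rw [hs.pluckerRelations hp f g, sub_self, map_zero]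

/-- The components of `Phi` generate the ideal of `Z_G`. -/
theorem idealOf_fixedLocus [IsAlgClosed k] [CharZero k] [FiniteDimensional k V]
    (l : Module.Dual k (PluckerSpace k V)) :
    idealOf k (chart k l (grassmannian k V)) (chart k l (fixedLocus k V)) = phiIdeal k V l := by
  refine le_antisymm (fun h hh => ?_) (Ideal.span_le.2 ?_)
  · -- the ideal of all `r` with `r * h` in `phiIdeal` is not contained in any maximal ideal
    let T : Ideal (coordRing k (chart k l (grassmannian k V))) :=
      Submodule.comap (LinearMap.mulRight _ h) (phiIdeal k V l)
    have hT : ∀ r, r ∈ T ↔ r * h ∈ phiIdeal k V l := fun r => Iff.rfl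
    by_contra hcon
    have hne : T ≠ ⊤ := fun h1 => hcon (by
      have := (hT 1).1 (h1 ▸ Submodule.mem_top)
      rwa [one_mul] at this)
    obtain ⟨M, hM, hTM⟩ := Ideal.exists_le_maximal T hne
    obtain ⟨a, ha, hmem⟩ := exists_point_of_isMaximal (k := k) M
    obtain ⟨-, p, hp, hpa⟩ := mem_chart_of_forall_polyFun ha
    have hcoord : ∀ φ : Module.Dual k (PluckerSpace k V), coord k _ φ ∈ M → φ a = 0 :=
      fun φ h => (hmem ⟨_, dual_mem_polyFun φ⟩).1 h
    by_cases h0 : phiLin k V a = 0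
    · obtain ⟨f, hf⟩ := exists_diagForm_ne_zero hpa.ne_zero h0
      obtain ⟨n, hn⟩ := exists_pow_mul_mem_phiIdeal l f hh
      exact hf (hcoord _ (hM.isPrime.mem_of_pow_mem n (hTM ((hT _).2 hn))))
    · refine h0 ((Module.forall_dual_apply_eq_zero_iff k _).1 fun φ => hcoord (φ ∘ₗ phiLin k V) ?_)
      exact hTM ((hT _).2 (Ideal.mul_mem_right _ _ (Ideal.subset_span ⟨φ, rfl⟩)))
  · rintro _ ⟨φ, rfl⟩ s ⟨-, p, hp, hs⟩
    change φ (phiLin k V s.1) = 0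
    rw [phiLin_eq_zero_of_mem_fixedLocus hs hp, map_zero]

end IdealOfFixedLocus

/-! ### The Rees algebra -/

section Generation

variable {k : Type*} [Field k] {M : Type*} [AddCommGroup M] [Module k M]
variable {N : Type*} [AddCommGroup N] [Module k N]

theorem range_le_of_forall_coord_mem {B : Type*} [CommRing B] [Algebra k B] {S : Set M}
    (F : coordRing k S →ₐ[k] B) (R : Subalgebra k B) (h : ∀ φ, F (coord k S φ) ∈ R) :
    F.range ≤ R := by
  rintro _ ⟨⟨c, hc⟩, rfl⟩
  refine Algebra.adjoin_induction (p := fun c hc => F ⟨c, hc⟩ ∈ R) ?_ ?_ ?_ ?_ hc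
  · rintro _ ⟨φ, rfl⟩
    exact h φ
  · intro r
    have := F.commutes r
    exact this ▸ R.algebraMap_mem r
  · intro x y hx hy h1 h2
    have := F.map_add ⟨x, hx⟩ ⟨y, hy⟩
    exact this ▸ R.add_mem h1 h2
  · intro x y hx hy h1 h2
    have := F.map_mul ⟨x, hx⟩ ⟨y, hy⟩
    exact this ▸ R.mul_mem h1 h2

theorem coord_prod (S : Set (M × N)) (φ : Module.Dual k (M × N)) :
    coord k S φ = coord k S ((φ ∘ₗ LinearMap.inl k M N) ∘ₗ LinearMap.fst k M N) +
      coord k S ((φ ∘ₗ LinearMap.inr k M N) ∘ₗ LinearMap.snd k M N) := by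
  refine Subtype.ext (funext fun s => ?_)
  change φ s.1 = φ (LinearMap.inl k M N s.1.1) + φ (LinearMap.inr k M N s.1.2)
  rw [← map_add]
  simp

theorem range_le_of_forall_coord_fst_mem_of_forall_coord_snd_mem {B : Type*} [CommRing B]
    [Algebra k B] {S : Set (M × N)} (F : coordRing k S →ₐ[k] B) (R : Subalgebra k B)
    (h₁ : ∀ m, F (coord k S (m ∘ₗ LinearMap.fst k M N)) ∈ R)
    (h₂ : ∀ m, F (coord k S (m ∘ₗ LinearMap.snd k M N)) ∈ R) : F.range ≤ R := by
  refine range_le_of_forall_coord_mem F R fun φ => ?_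
  rw [coord_prod, map_add]
  exact add_mem (h₁ _) (h₂ _)

theorem exists_algEquiv_of_range_eq {A A' B : Type*} [CommRing A] [CommRing A'] [CommRing B]
    [Algebra k A] [Algebra k A'] [Algebra k B] {f : A →ₐ[k] B} {g : A' →ₐ[k] B}
    (hf : Function.Injective f) (hg : Function.Injective g) (h : f.range = g.range) :
    ∃ e : A ≃ₐ[k] A', ∀ a, g (e a) = f a :=
  ⟨((AlgEquiv.ofInjective f hf).trans (Subalgebra.equivOfEq _ _ h)).trans
    (AlgEquiv.ofInjective g hg).symm, fun a => congrArg Subtype.val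
      ((AlgEquiv.ofInjective g hg).apply_symm_apply
        (Subalgebra.equivOfEq _ _ h (AlgEquiv.ofInjective f hf a)))⟩

/-- Evaluation of polynomials with coefficients in a ring `R` of functions on `S`, as functions on
`S × k`. -/
def polynomialEval {S : Type*} (R : Subalgebra k (S → k)) : Polynomial R →ₐ[k] (S × k → k) where
  toFun P u := P.eval₂ ((Pi.evalRingHom (fun _ : S => k) u.1).comp R.val.toRingHom) u.2
  map_one' := by funext u; simp
  map_mul' P Q := by funext u; simp [Polynomial.eval₂_mul]
  map_zero' := by funext u; simp
  map_add' P Q := by funext u; simp [Polynomial.eval₂_add]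
  commutes' c := by
    funext u
    rw [IsScalarTower.algebraMap_apply k R (Polynomial R), Polynomial.algebraMap_apply]
    simp

theorem polynomialEval_C {S : Type*} (R : Subalgebra k (S → k)) (r : R) (u : S × k) :
    polynomialEval R (Polynomial.C r) u = r.1 u.1 := by
  simp [polynomialEval]

theorem polynomialEval_monomial_one {S : Type*} (R : Subalgebra k (S → k)) (r : R) (u : S × k) :
    polynomialEval R (Polynomial.monomial 1 r) u = r.1 u.1 * u.2 := by
  simp [polynomialEval]

theorem polynomialEval_injective [Infinite k] {S : Type*} (R : Subalgebra k (S → k)) :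
    Function.Injective (polynomialEval R) := by
  rw [injective_iff_map_eq_zero]
  intro P hP
  refine Polynomial.ext fun n => Subtype.ext (funext fun s => ?_)
  have h : P.map ((Pi.evalRingHom (fun _ : S => k) s).comp R.val.toRingHom) = 0 :=
    Polynomial.funext fun c => by
      rw [Polynomial.eval_map, Polynomial.eval_zero]
      exact congrFun hP (s, c)
  have := congrArg (fun Q => Polynomial.coeff Q n) h
  rw [Polynomial.coeff_map, Polynomial.coeff_zero] at this
  exact this

end Generation

section LinearProjection

variable {k : Type*} [Field k]
variable {E : Type*} [AddCommGroup E] [Module k E] {F : Type*} [AddCommGroup F] [Module k F]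
variable {l : Module.Dual k E} {X Z : Set (ℙ k E)} {W : Set (ℙ k E × ℙ k F)} {θ : E →ₗ[k] F}

/-- The homomorphism from the coordinate ring of the relative cone of `W` to the functions on
`X_l × k`, given by the map `(a, s) ↦ (a, s • θ a)`. -/
def relConeEval (hW : ∀ a ∈ chart k l X, ∀ s : k, (a, s • θ a) ∈ relCone k l X W) :
    coordRing k (relCone k l X W) →ₐ[k] (chart k l X × k → k) where
  toFun c u := c.1 ⟨_, hW u.1.1 u.1.2 u.2⟩
  map_one' := rfl
  map_mul' _ _ := rfl
  map_zero' := rfl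
  map_add' _ _ := rfl
  commutes' _ := rfl

theorem relConeEval_injective (hW : ∀ a ∈ chart k l X, ∀ s : k, (a, s • θ a) ∈ relCone k l X W)
    (hinj : ∀ f ∈ polyFun k (E × F), (∀ a ∈ chart k l X, ∀ s : k, f (a, s • θ a) = 0) →
      ∀ ab ∈ relCone k l X W, f ab = 0) : Function.Injective (relConeEval hW) := by
  rw [injective_iff_map_eq_zero]
  intro c hc
  obtain ⟨⟨f, hf⟩, rfl⟩ := restrictPoly_surjective _ c
  refine coordRing_ext fun ab => ?_
  exact hinj f hf (fun a ha s => congrFun hc (⟨a, ha⟩, s)) ab.1 ab.2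

variable (k l X Z) in
/-- The Rees algebra as an algebra of functions on `X_l × k`. -/
def reesEval : reesAlgebra (idealOf k (chart k l X) (chart k l Z)) →ₐ[k]
    (chart k l X × k → k) :=
  (polynomialEval (coordRing k (chart k l X))).comp
    ((reesAlgebra (idealOf k (chart k l X) (chart k l Z))).val.restrictScalars k)

theorem reesEval_injective [Infinite k] : Function.Injective (reesEval k l X Z) :=
  (polynomialEval_injective _).comp Subtype.val_injective

/-- The degree one element of the Rees algebra given by an element of the ideal. -/
def reesMonomial {R : Type*} [CommRing R] {I : Ideal R} {r : R} (hr : r ∈ I) : reesAlgebra I :=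
  ⟨Polynomial.monomial 1 r, reesAlgebra.monomial_mem.2 (by rwa [pow_one])⟩

theorem relConeEval_fst (hW : ∀ a ∈ chart k l X, ∀ s : k, (a, s • θ a) ∈ relCone k l X W)
    (m : Module.Dual k E) :
    relConeEval hW (coord k _ (m ∘ₗ LinearMap.fst k E F)) =
      reesEval k l X Z (algebraMap _ _ (coord k (chart k l X) m)) :=
  funext fun u => (polynomialEval_C _ (coord k (chart k l X) m) u).symm

theorem relConeEval_snd (hW : ∀ a ∈ chart k l X, ∀ s : k, (a, s • θ a) ∈ relCone k l X W)
    {m : Module.Dual k F} (hm : coord k _ (m ∘ₗ θ) ∈ idealOf k (chart k l X) (chart k l Z)) :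
    relConeEval hW (coord k _ (m ∘ₗ LinearMap.snd k E F)) =
      reesEval k l X Z (reesMonomial hm) := by
  funext u
  refine Eq.trans ?_ (polynomialEval_monomial_one _ (coord k _ (m ∘ₗ θ)) u).symm
  change m (u.2 • θ u.1.1) = m (θ u.1.1) * u.2
  rw [map_smul, smul_eq_mul, mul_comm]

theorem polynomialEval_C_mem_range
    (hW : ∀ a ∈ chart k l X, ∀ s : k, (a, s • θ a) ∈ relCone k l X W)
    (r : coordRing k (chart k l X)) :
    polynomialEval (coordRing k (chart k l X)) (Polynomial.C r) ∈ (relConeEval hW).range := by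
  refine range_le_of_forall_coord_mem
    ((polynomialEval (coordRing k (chart k l X))).comp Polynomial.CAlgHom)
    (relConeEval hW).range (fun φ => ?_) ⟨r, rfl⟩
  exact ⟨_, relConeEval_fst (Z := ∅) hW φ⟩

theorem range_reesEval_le
    (hW : ∀ a ∈ chart k l X, ∀ s : k, (a, s • θ a) ∈ relCone k l X W)
    (hI : idealOf k (chart k l X) (chart k l Z) =
      Ideal.span (Set.range fun φ : Module.Dual k F => coord k (chart k l X) (φ ∘ₗ θ))) :
    (reesEval k l X Z).range ≤ (relConeEval hW).range := by
  rintro _ ⟨⟨x, hx⟩, rfl⟩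
  change polynomialEval _ x ∈ _
  rw [← adjoin_monomial_eq_reesAlgebra] at hx
  refine Algebra.adjoin_induction
    (p := fun x _ => polynomialEval _ x ∈ (relConeEval hW).range) ?_ ?_ ?_ ?_ hx
  · rintro _ ⟨i, hi, rfl⟩
    refine Submodule.span_induction (p := fun i _ => polynomialEval _ (Polynomial.monomial 1 i) ∈
      (relConeEval hW).range) ?_ ?_ ?_ ?_ (hI ▸ hi : i ∈ Ideal.span _)
    · rintro _ ⟨φ, rfl⟩
      have hφ : coord k (chart k l X) (φ ∘ₗ θ) ∈ idealOf k (chart k l X) (chart k l Z) :=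
        hI ▸ Ideal.subset_span ⟨φ, rfl⟩
      exact ⟨_, relConeEval_snd hW hφ⟩
    · rw [map_zero, map_zero]
      exact zero_mem _
    · intro i j _ _ hi hj
      rw [map_add, map_add]
      exact add_mem hi hj
    · intro r i _ hi
      rw [smul_eq_mul, ← Polynomial.C_mul_monomial, map_mul]
      exact mul_mem (polynomialEval_C_mem_range hW r) hi
  · exact fun r => polynomialEval_C_mem_range hW r
  · intro x y _ _ hx hy
    rw [map_add]
    exact add_mem hx hy
  · intro x y _ _ hx hy
    rw [map_mul]
    exact mul_mem hx hy

/-- If the relative cone of `W` is the closure of the image of `(a, s) ↦ (a, s • θ a)` and the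
components of `θ` generate the ideal of `Z`, then `s` plays the role of the variable of the Rees
algebra, and the coordinate ring of the relative cone is the Rees algebra. -/
theorem exists_algEquiv_reesAlgebra [Infinite k]
    (hW : ∀ a ∈ chart k l X, ∀ s : k, (a, s • θ a) ∈ relCone k l X W)
    (hinj : ∀ f ∈ polyFun k (E × F), (∀ a ∈ chart k l X, ∀ s : k, f (a, s • θ a) = 0) →
      ∀ ab ∈ relCone k l X W, f ab = 0)
    (hI : idealOf k (chart k l X) (chart k l Z) =
      Ideal.span (Set.range fun φ : Module.Dual k F => coord k (chart k l X) (φ ∘ₗ θ))) :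
    ∃ e : coordRing k (relCone k l X W) ≃ₐ[k]
        reesAlgebra (idealOf k (chart k l X) (chart k l Z)),
      (∀ m : Module.Dual k E,
        e (coord k _ (m ∘ₗ LinearMap.fst k E F)) = algebraMap _ _ (coord k (chart k l X) m)) ∧
      ∀ m : Module.Dual k F, ∃ f ∈ idealOf k (chart k l X) (chart k l Z),
        (e (coord k _ (m ∘ₗ LinearMap.snd k E F))).1 = Polynomial.monomial 1 f := by
  have hmem (m : Module.Dual k F) :
      coord k (chart k l X) (m ∘ₗ θ) ∈ idealOf k (chart k l X) (chart k l Z) :=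
    hI ▸ Ideal.subset_span ⟨m, rfl⟩
  have hle : (relConeEval hW).range ≤ (reesEval k l X Z).range :=
    range_le_of_forall_coord_fst_mem_of_forall_coord_snd_mem _ _
      (fun m => ⟨_, (relConeEval_fst hW m).symm⟩)
      (fun m => ⟨_, (relConeEval_snd hW (hmem m)).symm⟩)
  obtain ⟨e, he⟩ := exists_algEquiv_of_range_eq (relConeEval_injective hW hinj)
    (reesEval_injective (Z := Z)) (hle.antisymm (range_reesEval_le hW hI))
  refine ⟨e, fun m => reesEval_injective ((he _).trans (relConeEval_fst hW m)), fun m =>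
    ⟨_, hmem m, ?_⟩⟩
  exact congrArg Subtype.val (reesEval_injective ((he _).trans (relConeEval_snd hW (hmem m))))

end LinearProjection

section Rees

variable {k : Type*} [Field k] {V : Type*} [AddCommGroup V] [Module k V]

/-- A polynomial function is determined on the relative cone of the closure of the graph by its
values at the points `(a, s • phiLin a)`. -/
theorem eq_zero_on_relCone [FiniteDimensional k V] {l : Module.Dual k (PluckerSpace k V)}
    {f : PluckerSpace k V × Triple k V → k} (hf : f ∈ polyFun k (PluckerSpace k V × Triple k V))
    (h : ∀ a ∈ chart k l (grassmannian k V), ∀ s : k, f (a, s • phiLin k V a) = 0) :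
    ∀ ab ∈ relCone k l (grassmannian k V) (blowUp k V), f ab = 0 := by
  rintro ⟨a, b⟩ ⟨ha, p, hp, hpa, hb | ⟨q, hqb, hw⟩⟩
  · have := h a ⟨ha, p, hp, hpa⟩ 0
    rw [zero_smul] at this
    change b = 0 at hb
    rwa [hb]
  obtain ⟨m₀, hm₀⟩ := not_forall.1 fun h =>
    hqb.ne_zero ((Module.forall_dual_apply_eq_zero_iff k _).1 h)
  let m : Module.Dual k (Triple k V) := (m₀ b)⁻¹ • m₀
  have hmb : m b = 1 := inv_mul_cancel₀ hm₀
  obtain ⟨D, H, hH, hom, hHf⟩ := exists_bihomogenization l m hf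
  -- multiplied by `l * m`, the bihomogenization of `f` vanishes on the graph, hence on its closure
  have hbi : IsBihomog k fun ab : PluckerSpace k V × Triple k V => H ab * (l ab.1 * m ab.2) := by
    refine ⟨mul_mem_polyFun hH (mul_mem_polyFun (dual_fst_mem_polyFun l) (dual_snd_mem_polyFun m)),
      D + 1, D + 1, fun c d a b => ?_⟩
    simp only [hom, map_smul, smul_eq_mul]
    ring
  have hvan := hw _ hbi (fun w hw => ?_) a b hpa hqb
  · change H (a, b) * (l a * m b) = 0 at hvan
    change l a = 1 at ha
    rwa [ha, hmb, mul_one, mul_one, hHf a b ha hmb] at hvan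
  · obtain ⟨-, A, h1, h2⟩ := hw
    refine vanishesAt_of_apply_eq_zero hbi h1 h2 ?_
    by_cases hl : l (pluckerVec k A) = 0
    · rw [hl, zero_mul, mul_zero]
    by_cases hm : m (Phi k A) = 0
    · rw [hm, mul_zero, mul_zero]
    have hla : l ((l (pluckerVec k A))⁻¹ • pluckerVec k A) = 1 := by
      rw [map_smul, smul_eq_mul, inv_mul_cancel₀ hl]
    have hmb : m ((m (Phi k A))⁻¹ • Phi k A) = 1 := by
      rw [map_smul, smul_eq_mul, inv_mul_cancel₀ hm]
    have h0 := h _ ⟨hla, _, ⟨A, h1⟩, h1.smul (inv_ne_zero hl)⟩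
      ((m (Phi k A))⁻¹ * l (pluckerVec k A))
    rw [map_smul, phiLin_pluckerVec, smul_smul, mul_assoc, mul_inv_cancel₀ hl, mul_one,
      ← hHf _ _ hla hmb, hom] at h0
    rw [(mul_eq_zero.1 h0).resolve_left (mul_ne_zero (pow_ne_zero _ (inv_ne_zero hl))
      (pow_ne_zero _ (inv_ne_zero hm))), zero_mul]

theorem smul_phiLin_mem_relCone [CharZero k] {l : Module.Dual k (PluckerSpace k V)}
    {a : PluckerSpace k V} (ha : a ∈ chart k l (grassmannian k V)) (s : k) :
    (a, s • phiLin k V a) ∈ relCone k l (grassmannian k V) (blowUp k V) := by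
  obtain ⟨ha, p, hp, hpa⟩ := ha
  refine ⟨ha, p, hp, hpa, ?_⟩
  by_cases h : s • phiLin k V a = 0
  · exact Or.inl h
  · obtain ⟨A, hA⟩ := hp
    obtain ⟨c, hc, hca⟩ := hpa.exists_smul_eq hA
    refine Or.inr ⟨_, isPt_mk h, subset_zariskiClosure _ (mem_graph hA ?_)⟩
    have hs : s ≠ 0 := fun h0 => h (by rw [h0, zero_smul])
    have := (isPt_mk h).smul (mul_ne_zero hc (inv_ne_zero hs))
    rw [smul_smul, mul_assoc, inv_mul_cancel₀ hs, mul_one] at this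
    have hPhi : Phi k A = c • phiLin k V a := by rw [← phiLin_pluckerVec, hca, map_smul]
    rwa [hPhi]

theorem isBlowUp_blowUp [IsAlgClosed k] [CharZero k] [FiniteDimensional k V] :
    IsBlowUp k (grassmannian k V) (fixedLocus k V) (blowUp k V) :=
  ⟨fun _ hw => fst_mem_grassmannian_of_mem_blowUp hw, zariskiClosure_blowUp, fun l =>
    exists_algEquiv_reesAlgebra (θ := phiLin k V) (fun _ ha s => smul_phiLin_mem_relCone ha s)
      (fun _ hf h => eq_zero_on_relCone hf h) (idealOf_fixedLocus l)⟩

end Rees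

end

end KirwanBlowUp

open KirwanBlowUp in
theorem lemma4p1 {k : Type*} [Field k] [IsAlgClosed k] [CharZero k]
    {V : Type*} [AddCommGroup V] [Module k V] (hV : Module.finrank k V = 3) :
    -- the closure of the graph is the blow-up of the Grassmannian along `Z_G`
    IsBlowUp k (grassmannian k V) (fixedLocus k V) (blowUp k V) ∧
    -- (a)
    (blowUp k V = {w | ∃ (A : Matrix (Fin 2) (Fin 2) V) (t : Triple k V),
      IsPt k w.1 (pluckerVec k A) ∧ IsPt k w.2 t ∧
      Phi k A ∈ Submodule.span k {t} ∧ WedgeCondition k A t}) ∧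
    -- (b)
    (exceptionalDivisor k V = {w | ∃ x u w' v : V,
      IsPt k w.1 (pluckerVec k !![x, 0; 0, x]) ∧
      IsPt k w.2 ![wedge k x u, wedge k x w', wedge k x v]}) ∧
    -- `P(V) ≅ Z_G` by `[x] ↦ [diag(x, x)]`, and the exceptional divisor is a `ℙ₅`-bundle over it
    (∃ (ν : ℙ k V → ℙ k (PluckerSpace k V)) (κ : ℙ k (PluckerSpace k V) → ℙ k V),
      (∀ p x, IsPt k p x → IsPt k (ν p) (pluckerVec k !![x, 0; 0, x])) ∧
      Set.range ν = fixedLocus k V ∧ (∀ p, κ (ν p) = p) ∧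
      IsRegular k Set.univ ν ∧ IsRegular k (fixedLocus k V) κ) ∧
    IsProjectiveBundle k 5 (exceptionalDivisor k V) (fixedLocus k V) ∧
    -- (c)
    IsSmoothVariety k (blowUp k V) ∧
    (∀ w, act k V 1 w = w) ∧ (∀ g h w, act k V (g * h) w = act k V h (act k V g w)) ∧
    (∀ g, ∀ p ∈ grassmannian k V, actPlucker k V g p ∈ grassmannian k V) ∧
    (∀ g, ∀ w ∈ blowUp k V, act k V g w ∈ blowUp k V ∧
      (act k V g w).1 = actPlucker k V g w.1) := by
  have : FiniteDimensional k V := Module.finite_of_finrank_pos (by omega)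
  have : Nontrivial V := Module.nontrivial_of_finrank_pos (R := k) (by omega)
  refine ⟨isBlowUp_blowUp, blowUp_eq_setOf_wedgeCondition, ?_, exists_inverse_diagPoint,
    isProjectiveBundle_exceptionalDivisor hV, isSmoothVariety_blowUp, act_one, act_mul,
    fun g p hp => actPlucker_mem_grassmannian g hp, fun g w hw => ⟨act_mem_blowUp g hw, rfl⟩⟩
  rw [exceptionalDivisor_eq]
  exact Set.ext fun w => mem_exceptionalPairs_iff
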